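/- Let $M$ be a closed, oriented, smooth $3$-manifold. Polar coordinates $(r,\mu,\lambda)$ near a link $L\subset M$ are, near each component of $L$, positively oriented coordinates on a neighborhood diffeomorphic to $D^2\times S^1$, where $(r,\mu)$ are polar coordinates on $D^2$, $\lambda\in S^1$ (angles are taken mod $2\pi$) and $L=\{r=0\}$. An open book decomposition of $M$ is a pair $(L,p)$ of a non-empty link $L\subset M$ (the binding) and a smooth fibration $p\colon M\setminus L\to S^1$ such that there are polar coordinates near $L$ with $p=\mu$; the pages are the fibers of $p$ together with $L$. Contact structures on $M$ are positive. A Reeb vector field for a contact structure $\xi$ is a vector field $V$ for which there is a global contact form $\alpha$ with $\ker\alpha=\xi$, $\alpha(V)=1$ and $\imath_V d\alpha=0$. A contact structure $\xi$ is supported by the open book decomposition $(L,p)$ if it has a Reeb vector field $V$ that is transverse to (the interiors of) the pages, is tangent to the binding, and orients the binding as the boundary of the pages, where the pages are oriented by the co-orientation that $V$ gives them. The pair $(L,p)$ is a nicely fibered link supporting $\xi$ if there are a Reeb vector field $V$ for $\xi$ with $dp(V)>0$ on $M\setminus L$ and polar coordinates $(r,\mu,\lambda)$ near $L$ such that, near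 each component of $L$, $\xi=\ker(f(r)\,d\lambda+g(r)\,d\mu)$ for some smooth functions $f,g$, $V=A\,\partial_\mu+B\,\partial_\lambda$ and $p=C\mu+D\lambda$, where $A,B,C,D$ are constants (depending on the component) with $B>0$ and $C>0$. Lemma. Let $(L,p)$ be an open book decomposition of $M$ and let $\xi$ be a contact structure on $M$. (a) If $\xi$ is supported by the open book decomposition $(L,p)$, then there is a contact structure $\xi'$ on $M$, the image of $\xi$ under a smooth ambient isotopy of $M$, such that $(L,p)$ is a nicely fibered link supporting $\xi'$. (b) If $(L,p)$ is a nicely fibered link supporting $\xi$, then $\xi$ is supported by the open book decomposition $(L,p)$. -/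

import Mathlib

open scoped Manifold ContDiff Topology ComplexConjugate
open Bundle Set

noncomputable section

namespace OpenBook3

/-- The model space of `3`-manifolds. -/
abbrev E3 : Type := EuclideanSpace ℝ (Fin 3)

section Manifold

variable (M : Type*) [TopologicalSpace M] [ChartedSpace E3 M]

/-- An orientation of the smooth `3`-manifold `M`: an orientation of every tangent space such that
every point lies in the domain of a smooth chart whose coordinate frame is positive throughout. -/
structure ManifoldOrientation where
  /-- the orientation of each tangent space -/
  at_pt : ∀ x : M, Orientation ℝ (TangentSpace (𝓡 3) x) (Fin 3)
  /-- the existence of positively oriented charts -/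
  exists_chart : ∀ x : M, ∃ e ∈ IsManifold.maximalAtlas (𝓡 3) ∞ M, x ∈ e.source ∧
    ∀ y ∈ e.target, ∃ b : Module.Basis (Fin 3) ℝ (TangentSpace (𝓡 3) (e.symm y)),
      (∀ i, b i = mfderiv (𝓡 3) (𝓡 3) e.symm y (EuclideanSpace.single i (1 : ℝ))) ∧
      b.orientation = at_pt (e.symm y)

variable {M}

/-- The triple `v` of tangent vectors at `x` is a positively oriented basis. -/
def ManifoldOrientation.IsPosFrame (o : ManifoldOrientation M) (x : M)
    (v : Fin 3 → TangentSpace (𝓡 3) x) : Prop :=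
  ∃ b : Module.Basis (Fin 3) ℝ (TangentSpace (𝓡 3) x), (∀ i, b i = v i) ∧ b.orientation = o.at_pt x

variable (M) in
/-- A (not necessarily smooth) vector field. -/
abbrev VField : Type _ := ∀ x : M, TangentSpace (𝓡 3) x

variable (M) in
/-- A (not necessarily smooth) differential `1`-form. -/
abbrev OneForm : Type _ := ∀ x : M, TangentSpace (𝓡 3) x →L[ℝ] ℝ

variable (M) in
/-- A (not necessarily smooth) field of tangent subspaces. -/
abbrev SubspaceField : Type _ := ∀ x : M, Submodule ℝ (TangentSpace (𝓡 3) x)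

section Forms

variable [IsManifold (𝓡 3) ∞ M]

/-- Smoothness of a vector field. -/
def VField.IsSmooth (V : VField M) : Prop :=
  ContMDiff (𝓡 3) (𝓡 3).tangent ∞ (fun x => (⟨x, V x⟩ : TangentBundle (𝓡 3) M))

/-- Smoothness of a `1`-form on a set, as a section of the cotangent bundle. -/
def OneForm.IsSmoothOn (α : OneForm M) (U : Set M) : Prop :=
  ContMDiffOn (𝓡 3) ((𝓡 3).prod 𝓘(ℝ, E3 →L[ℝ] ℝ)) ∞
    (fun x => TotalSpace.mk' (E3 →L[ℝ] ℝ)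
      (E := fun x : M => TangentSpace (𝓡 3) x →L[ℝ] Bundle.Trivial M ℝ x) x (α x)) U

/-- The expression of the `1`-form `α` in the preferred chart at `x`, a function on `ℝ³` with
values in the linear forms on `ℝ³`. -/
def OneForm.inChart (α : OneForm M) (x : M) (y : E3) : E3 →L[ℝ] ℝ :=
  (α ((extChartAt (𝓡 3) x).symm y)).comp
    (mfderiv (𝓡 3) (𝓡 3) (extChartAt (𝓡 3) x).symm y)

/-- The exterior derivative of a `1`-form: `dα(v,w) = (D_v α)(w) - (D_w α)(v)`, computed in the
preferred chart at the point. -/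
def OneForm.d (α : OneForm M) (x : M) (v w : TangentSpace (𝓡 3) x) : ℝ :=
  let D : E3 →L[ℝ] E3 →L[ℝ] ℝ := fderiv ℝ (α.inChart x) (extChartAt (𝓡 3) x x)
  let v' : E3 := mfderiv (𝓡 3) (𝓡 3) (extChartAt (𝓡 3) x) x v
  let w' : E3 := mfderiv (𝓡 3) (𝓡 3) (extChartAt (𝓡 3) x) x w
  D v' w' - D w' v'

/-- The value of the `3`-form `α ∧ dα` on a triple of tangent vectors. -/
def OneForm.wedgeD (α : OneForm M) (x : M) (v : Fin 3 → TangentSpace (𝓡 3) x) : ℝ :=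
  α x (v 0) * α.d x (v 1) (v 2) - α x (v 1) * α.d x (v 0) (v 2) + α x (v 2) * α.d x (v 0) (v 1)

/-- A positive contact structure on the oriented `3`-manifold `M`: a plane field which is locally
the kernel of a smooth `1`-form `α` with `α ∧ dα > 0`. -/
structure ContactStructure (o : ManifoldOrientation M) where
  /-- the contact planes -/
  plane : SubspaceField M
  /-- the contact condition -/
  contact : ∀ x₀ : M, ∃ U : Set M, IsOpen U ∧ x₀ ∈ U ∧ ∃ α : OneForm M, α.IsSmoothOn U ∧
    ∀ x ∈ U, plane x = LinearMap.ker (α x : TangentSpace (𝓡 3) x →ₗ[ℝ] ℝ) ∧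
      ∀ v, o.IsPosFrame x v → 0 < α.wedgeD x v

variable {o : ManifoldOrientation M}

/-- `V` is a Reeb vector field for `ξ`: there is a smooth global contact form `α` for `ξ` with
`α(V) = 1` and `ι_V dα = 0`. -/
def ContactStructure.IsReeb (ξ : ContactStructure o) (V : VField M) : Prop :=
  V.IsSmooth ∧ ∃ α : OneForm M, α.IsSmoothOn univ ∧
    (∀ x, ξ.plane x = LinearMap.ker (α x : TangentSpace (𝓡 3) x →ₗ[ℝ] ℝ)) ∧
    (∀ x, α x (V x) = 1) ∧ ∀ x w, α.d x (V x) w = 0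

/-- `ξ'` is isotopic to `ξ`: it is the image of `ξ` under the time one map of a smooth ambient
isotopy of `M`. -/
def ContactStructure.Isotopic (ξ ξ' : ContactStructure o) : Prop :=
  ∃ φ : ℝ → (M ≃ₘ^∞⟮𝓡 3, 𝓡 3⟯ M),
    ContMDiff (𝓘(ℝ, ℝ).prod (𝓡 3)) (𝓡 3) ∞ (fun q : ℝ × M => φ q.1 q.2) ∧
    (∀ x, φ 0 x = x) ∧
    ∀ x, ξ'.plane (φ 1 x) =
      (ξ.plane x).map (mfderiv (𝓡 3) (𝓡 3) (φ 1) x :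
        TangentSpace (𝓡 3) x →ₗ[ℝ] TangentSpace (𝓡 3) (φ 1 x))

end Forms

/-- A link: a finite disjoint union of smoothly embedded circles. -/
def IsLink (L : Set M) : Prop :=
  ∃ (n : ℕ) (γ : Fin n → Circle → M),
    (∀ i, Manifold.IsSmoothEmbedding (𝓡 1) (𝓡 3) ∞ (γ i)) ∧
    Pairwise (fun i j => Disjoint (range (γ i)) (range (γ j))) ∧
    L = ⋃ i, range (γ i)

/-- The angular derivative `dp(v) ∈ ℝ` of a circle valued map: if `p = e^{iθ}` locally, this is
`dθ(v)`. -/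
def angularDeriv (p : M → Circle) (x : M) (v : TangentSpace (𝓡 3) x) : ℝ :=
  let w : ℂ := mfderiv (𝓡 3) 𝓘(ℝ, ℂ) (fun y => (p y : ℂ)) x v
  (conj (p x : ℂ) * w).im

variable (M) in
/-- A link `L` in `M` together with a smooth fibration `p : M ∖ L → S¹` of its complement. The
values of `p` on `L` play no role. -/
structure FiberedLink where
  /-- the link -/
  L : Set M
  /-- the fibration -/
  p : M → Circle
  isLink : IsLink L
  smooth : ContMDiffOn (𝓡 3) (𝓡 1) ∞ p Lᶜ
  submersion : ∀ x, x ∉ L → ∃ v, angularDeriv p x v ≠ 0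
  locally_trivial : ∀ θ : Circle,
    ∃ e : Trivialization {x : ↥(Lᶜ) // p x = θ} (fun x : ↥(Lᶜ) => p x), θ ∈ e.baseSet

/-- Positively oriented polar coordinates `(r, μ, λ)` near a component of `L`, given by the
parametrization `(z, λ) ↦ Φ(z, λ)`, where `z = r e^{iμ}` runs over the open disc of radius `R` and
`λ ∈ ℝ / 2πℤ` is lifted to `ℝ`. By `posFrame` and `inj`, `Φ` induces a diffeomorphism of the open
solid torus onto an open subset of `M`, orientation preserving for `dr ∧ dμ ∧ dλ`; by `mem_link`,
the core `r = 0` is exactly the part of `L` in this subset, hence a component of `L`. -/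
structure PolarCoords (o : ManifoldOrientation M) (L : Set M) where
  /-- the radius -/
  R : ℝ
  R_pos : 0 < R
  /-- the parametrization -/
  Φ : ℂ × ℝ → M
  smooth : ContMDiffOn 𝓘(ℝ, ℂ × ℝ) (𝓡 3) ∞ Φ {q | ‖q.1‖ < R}
  inj : ∀ q q' : ℂ × ℝ, ‖q.1‖ < R → ‖q'.1‖ < R →
    (Φ q = Φ q' ↔ q.1 = q'.1 ∧ ∃ n : ℤ, q'.2 = q.2 + n * (2 * Real.pi))
  posFrame : ∀ q : ℂ × ℝ, ‖q.1‖ < R → o.IsPosFrame (Φ q) (fun i =>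
    mfderiv 𝓘(ℝ, ℂ × ℝ) (𝓡 3) Φ q
      ((![((1 : ℂ), (0 : ℝ)), (Complex.I, 0), (0, 1)] : Fin 3 → ℂ × ℝ) i))
  mem_link : ∀ q : ℂ × ℝ, ‖q.1‖ < R → (Φ q ∈ L ↔ q.1 = 0)

namespace PolarCoords

variable {o : ManifoldOrientation M} {L : Set M}

/-- The coordinate neighborhood is one of the component of `L` that contains `x`. -/
def IsAround (c : PolarCoords o L) (x : M) : Prop := ∃ l : ℝ, c.Φ (0, l) = x

/-- The tangent vector `dΦ_q(w, s)`. -/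
def push (c : PolarCoords o L) (q : ℂ × ℝ) (w : ℂ) (s : ℝ) : TangentSpace (𝓡 3) (c.Φ q) :=
  mfderiv 𝓘(ℝ, ℂ × ℝ) (𝓡 3) c.Φ q ((w, s) : ℂ × ℝ)

/-- `p = C μ + D λ` in the coordinates `c`. -/
def FibrationIs (c : PolarCoords o L) (p : M → Circle) (C D : ℝ) : Prop :=
  ∀ r m l : ℝ, 0 < r → r < c.R →
    p (c.Φ ((r : ℂ) * Complex.exp (m * Complex.I), l)) = Circle.exp (C * m + D * l)

/-- `V = A ∂_μ + B ∂_λ` in the coordinates `c`; at the point `(z, λ)`, `∂_μ = (iz, 0)` and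
`∂_λ = (0, 1)`. -/
def FieldIs (c : PolarCoords o L) (V : VField M) (A B : ℝ) : Prop :=
  ∀ q : ℂ × ℝ, ‖q.1‖ < c.R → V (c.Φ q) = c.push q (A * (Complex.I * q.1)) B

/-- `ξ = ker (f(r) dλ + g(r) dμ)` in the coordinates `c` (away from `r = 0`, where `dμ` is not
defined); at the point `(z, λ)`, `dμ(w, s) = Im (w / z)` and `dλ(w, s) = s`. -/
def PlaneIs (c : PolarCoords o L) (ξ : SubspaceField M) (f g : ℝ → ℝ) : Prop :=
  ∀ q : ℂ × ℝ, 0 < ‖q.1‖ → ‖q.1‖ < c.R → ∀ (w : ℂ) (s : ℝ),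
    c.push q w s ∈ ξ (c.Φ q) ↔ f ‖q.1‖ * s + g ‖q.1‖ * (w / q.1).im = 0

end PolarCoords

/-- An open book decomposition of `M` with binding `L` and fibration `p`: the link `L` is non-empty
and near each component of `L` there are polar coordinates with `p = μ`. -/
structure OpenBook (o : ManifoldOrientation M) extends FiberedLink M where
  nonempty : L.Nonempty
  longitudinal : ∀ x ∈ L, ∃ c : PolarCoords o L, c.IsAround x ∧ c.FibrationIs p 1 0

/-- The vector field `V` respects the open book decomposition: it is transverse to the pages,
tangent to the binding, and orients the binding as the boundary of the pages that it co-orients.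

In positively oriented polar coordinates with `p = μ`, the page `{μ = const}`, co-oriented by
`∂_μ`, is oriented by `(-∂_r, ∂_λ)` because `(∂_μ, -∂_r, ∂_λ)` is positive; since `-∂_r` points out
of the page along the binding, `∂_λ` is the boundary orientation. If the co-orientation is reversed,
so is the boundary orientation. Hence the sign of the `∂_λ`-component `b` of `V` on the binding has
to be the sign of `dp(V)` nearby. -/
def OpenBook.RespectedBy {o : ManifoldOrientation M} (B : OpenBook o) (V : VField M) : Prop :=
  (∀ x, x ∉ B.L → angularDeriv B.p x (V x) ≠ 0) ∧
  ∀ x ∈ B.L, ∃ c : PolarCoords o B.L, c.IsAround x ∧ c.FibrationIs B.p 1 0 ∧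
    ∀ l : ℝ, ∃ b : ℝ, V (c.Φ (0, l)) = c.push (0, l) 0 b ∧
      ∀ q : ℂ × ℝ, 0 < ‖q.1‖ → ‖q.1‖ < c.R → 0 < b * angularDeriv B.p (c.Φ q) (V (c.Φ q))

variable [IsManifold (𝓡 3) ∞ M] {o : ManifoldOrientation M}

/-- The contact structure `ξ` is supported by the open book decomposition. -/
def OpenBook.Supports (B : OpenBook o) (ξ : ContactStructure o) : Prop :=
  ∃ V : VField M, ξ.IsReeb V ∧ B.RespectedBy V

/-- `(L, p)` is a nicely fibered link supporting `ξ`: there is a Reeb field `V` for `ξ` with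
`dp(V) > 0`, and near each component of `L` there are polar coordinates in which
`ξ = ker (f(r) dλ + g(r) dμ)`, `V = A ∂_μ + B ∂_λ` and `p = C μ + D λ` with constants `A, B, C, D`
such that `B > 0` and `C > 0`. -/
def FiberedLink.NicelySupports (F : FiberedLink M) (ξ : ContactStructure o) : Prop :=
  ∃ V : VField M, ξ.IsReeb V ∧ (∀ x, x ∉ F.L → 0 < angularDeriv F.p x (V x)) ∧
    ∀ x ∈ F.L, ∃ c : PolarCoords o F.L, c.IsAround x ∧
      (∃ f g : ℝ → ℝ, ContDiff ℝ ∞ f ∧ ContDiff ℝ ∞ g ∧ c.PlaneIs ξ.plane f g) ∧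
      ∃ A B C D : ℝ, 0 < B ∧ 0 < C ∧ c.FieldIs V A B ∧ c.FibrationIs F.p C D

end Manifold

end OpenBook3

end

open scoped Manifold ContDiff Topology ComplexConjugate
open Bundle Set

noncomputable section

/-! Part (a) needs no isotopy: it suffices to choose coordinates well and to rescale the contact
form near the binding. A Reeb field `V` that respects the open book may be taken with `dp(V) > 0`,
after `(α, V)` is replaced by `(-α, -V)` on the open and closed set where the sign is negative; then
`α(∂_λ) > 0` along the binding (`OpenBook.RespectedBy.exists_pos`).

Near a component of the binding, coordinates with `p = μ` are changed in two ways, both of which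
keep `μ`. Integrating `ξ` along the rays that leave the core gives a new longitude for which the
rays are tangent to `ξ` (`exists_reparam_radial`). The planes are then the kernel of `dλ + G r² dμ`
with `G` smooth; the contact condition makes `G` positive on the core, and a rescaling of the radius
turns `G` into `1` (`exists_reparam_standard`). Both changes are smooth because the fixed point of a
uniform contraction depends smoothly on parameters (`exists_smooth_fixedPoint`); for the rays the
contraction acts on a space of continuous curves.

Now `α = (dλ + r² dμ) / H`, and its Reeb field `X` satisfies `r² dμ(X) = r ∂_r H / 2`
(`reebField_angular`). Off the binding, positive transversality to the pages therefore means exactly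
that `H` increases radially. For `H = c₀ + c₁ r²` the Reeb field is `c₁ ∂_μ + c₀ ∂_λ`. Hence it is
enough to make `H` quadratic near the core while keeping it positive and radially increasing
(`exists_quadratic_near_core`). This changes the form but not the planes. Doing it at finitely many
points of the binding, whose coordinate neighbourhoods cover the binding, gives (a).

For (b) the given Reeb field works. The point is that the nice coordinates and the coordinates with
`p = μ` orient the binding in the same way. The transition map carries core to core and the ray of
angle `m` to points of angle `C m + D λ`. As `C > 0`, its derivative preserves the orientation of
the normal discs; since it also preserves the orientation of `M`, it preserves the direction of the
core (`PolarCoords.exists_pos_transition`). -/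

namespace OpenBook3

/-! ### Superposition operators and smooth dependence of fixed points -/

section Superposition

universe u

variable {K : Type*} [TopologicalSpace K] [CompactSpace K]
  {E F : Type*} [NormedAddCommGroup E] [NormedSpace ℝ E] [NormedAddCommGroup F] [NormedSpace ℝ F]

instance : NormedAddCommGroup C(K, E →L[ℝ] F) := ContinuousMap.instNormedAddCommGroup

instance : NormedSpace ℝ C(K, E →L[ℝ] F) := ContinuousMap.normedSpace

variable (K E F) in
/-- Pointwise application of a continuous family of operators, as a bounded bilinear map. -/
def pointwiseApply : C(K, E →L[ℝ] F) →L[ℝ] C(K, E) →L[ℝ] C(K, F) :=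
  LinearMap.mkContinuous₂
    (LinearMap.mk₂ ℝ
      (fun (a : C(K, E →L[ℝ] F)) (u : C(K, E)) =>
        (⟨fun t => a t (u t), a.continuous.clm_apply u.continuous⟩ : C(K, F)))
      (fun _ _ _ => by ext; simp) (fun _ _ _ => by ext; simp)
      (fun _ _ _ => by ext; simp) (fun _ _ _ => by ext; simp)) 1
    (fun a u => by
      rw [one_mul]
      refine (ContinuousMap.norm_le _ (by positivity)).2 fun t => ?_
      exact (a t).le_of_opNorm_le_of_le (a.norm_coe_le_norm t) (u.norm_coe_le_norm t))

@[simp] lemma pointwiseApply_apply (a : C(K, E →L[ℝ] F)) (u : C(K, E)) (t : K) :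
    pointwiseApply K E F a u t = a t (u t) := rfl

lemma contDiff_pointwiseApply {X : Type*} [NormedAddCommGroup X] [NormedSpace ℝ X] {n : ℕ∞ω}
    {a : X → C(K, E →L[ℝ] F)} {u : X → C(K, E)} (ha : ContDiff ℝ n a) (hu : ContDiff ℝ n u) :
    ContDiff ℝ n (fun x => pointwiseApply K E F (a x) (u x)) :=
  ((pointwiseApply K E F).contDiff.comp ha).clm_apply hu

/-- The mean value inequality is applied at each `t`. It is uniform in `t` because composition with
`fderiv ℝ f` is continuous for the sup norm. -/
lemma hasFDerivAt_superposition {f : E → F} (hf : ContDiff ℝ 1 f) (u : C(K, E)) :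
    HasFDerivAt (fun v : C(K, E) => (⟨f, hf.continuous⟩ : C(E, F)).comp v)
      (pointwiseApply K E F
        ((⟨fderiv ℝ f, hf.continuous_fderiv one_ne_zero⟩ : C(E, E →L[ℝ] F)).comp u)) u := by
  set N := (⟨fderiv ℝ f, hf.continuous_fderiv one_ne_zero⟩ : C(E, E →L[ℝ] F)) with hN
  have hcont : Continuous (fun v : C(K, E) => N.comp v) := N.continuous_postcomp
  rw [hasFDerivAt_iff_isLittleO_nhds_zero, Asymptotics.isLittleO_iff]
  intro ε hε
  obtain ⟨δ, hδ, hball⟩ := Metric.continuousAt_iff.1 hcont.continuousAt ε hε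
  filter_upwards [Metric.ball_mem_nhds (0 : C(K, E)) hδ] with h hh
  refine (ContinuousMap.norm_le _ (by positivity)).2 fun t => ?_
  have hht : ‖h t‖ ≤ ‖h‖ := h.norm_coe_le_norm t
  have hhδ : ‖h‖ < δ := by simpa using hh
  have key : ‖f (u t + h t) - f (u t) - fderiv ℝ f (u t) ((u t + h t) - u t)‖
      ≤ ε * ‖(u t + h t) - u t‖ := by
    refine (convex_ball (u t) δ).norm_image_sub_le_of_norm_hasFDerivWithin_le'
      (f' := fderiv ℝ f)
      (fun y _ => ((hf.differentiable one_ne_zero) y).hasFDerivAt.hasFDerivWithinAt) ?_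
      (Metric.mem_ball_self hδ) (by simpa using hht.trans_lt hhδ)
    intro y hy
    -- Moving `u` by the constant `y - u t` gives a nearby curve with value `y` at `t`, so
    -- continuity in the sup norm yields the pointwise estimate.
    have hd : dist (u + ContinuousMap.const K (y - u t)) u < δ := by
      rw [dist_eq_norm, add_sub_cancel_left]
      refine (ContinuousMap.norm_lt_iff _ hδ).2 fun s => ?_
      simpa [dist_eq_norm] using hy
    have h1 := (hball hd).le
    rw [dist_eq_norm] at h1
    have h2 := (ContinuousMap.norm_coe_le_norm _ t).trans h1
    simpa [hN] using h2
  have e : u t + h t - u t = h t := by abel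
  rw [e] at key
  simpa [hN] using key.trans (by gcongr)

/-- The derivative of the superposition operator of `f` is that of `fderiv ℝ f` followed by a
bounded linear map, so induction gains one order. The target must vary, from `F` to `E →L[ℝ] F`,
hence the common universe. -/
lemma contDiff_superposition_nat {E : Type u} [NormedAddCommGroup E] [NormedSpace ℝ E] (n : ℕ) :
    ∀ {F : Type u} [NormedAddCommGroup F] [NormedSpace ℝ F] {f : E → F} (hf : ContDiff ℝ ∞ f),
      ContDiff ℝ n (fun v : C(K, E) => (⟨f, hf.continuous⟩ : C(E, F)).comp v) := by
  induction n with
  | zero =>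
    intro F _ _ f hf
    exact contDiff_zero.2 (ContinuousMap.continuous_postcomp _)
  | succ n ih =>
    intro F _ _ f hf
    have h1 : ContDiff ℝ ∞ (fderiv ℝ f) := (contDiff_infty_iff_fderiv.1 hf).2
    push_cast
    refine contDiff_succ_iff_hasFDerivAt.2
      ⟨_, ?_, hasFDerivAt_superposition (hf.of_le (mod_cast le_top))⟩
    exact (pointwiseApply K E F).contDiff.comp (ih h1)

/-- Composition with a smooth map is a smooth operator on continuous functions. -/
theorem contDiff_superposition {E F : Type u} [NormedAddCommGroup E] [NormedSpace ℝ E]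
    [NormedAddCommGroup F] [NormedSpace ℝ F] {f : E → F} (hf : ContDiff ℝ ∞ f) :
    ContDiff ℝ ∞ (fun v : C(K, E) => (⟨f, hf.continuous⟩ : C(E, F)).comp v) :=
  contDiff_infty.2 fun n => contDiff_superposition_nat n hf

end Superposition

section FixedPoint

variable {P X : Type*} [NormedAddCommGroup P] [NormedSpace ℝ P] [CompleteSpace P]
  [NormedAddCommGroup X] [NormedSpace ℝ X] [CompleteSpace X]

/-- The fixed point of a uniform contraction depends smoothly on parameters. -/
theorem exists_smooth_fixedPoint {T : P × X → X} (hT : ContDiff ℝ ∞ T) {U : Set P}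
    (hlip : ∀ q ∈ U, ContractingWith (1 / 2) (fun w => T (q, w))) :
    ∃ u : P → X, (∀ q ∈ U, T (q, u q) = u q) ∧ (∀ q ∈ U, ∀ v, T (q, v) = v → v = u q) ∧
      (IsOpen U → ContDiffOn ℝ ∞ u U) := by
  have hd : ∀ q v, HasFDerivAt (fun w => T (q, w)) ((fderiv ℝ T (q, v)).comp (.inr ℝ P X)) v := by
    intro q v
    have h1 : HasFDerivAt T (fderiv ℝ T (q, v)) (q, v) :=
      (hT.differentiable (by simp) _).hasFDerivAt
    exact h1.comp v (hasFDerivAt_prodMk_right q v)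
  have hex : ∀ q, ∃ v, q ∈ U → T (q, v) = v ∧ ∀ w, T (q, w) = w → w = v := by
    intro q
    by_cases hq : q ∈ U
    · exact ⟨(hlip q hq).fixedPoint, fun _ => ⟨(hlip q hq).fixedPoint_isFixedPt,
        fun w hw => (hlip q hq).fixedPoint_unique hw⟩⟩
    · exact ⟨0, fun h => absurd h hq⟩
  choose u hu using hex
  refine ⟨u, fun q hq => (hu q hq).1, fun q hq => (hu q hq).2, fun hU q hq => ?_⟩
  refine ContDiffAt.contDiffWithinAt ?_
  -- The fixed points are the zeros of `G`. The partial derivative of `T` in the second variable has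
  -- norm at most `1 / 2`, so that of `G` is invertible by a Neumann series.
  set G : P × X → X := fun y => y.2 - T y with hGdef
  have hG : ContDiff ℝ ∞ G := contDiff_snd.sub hT
  have hGd : fderiv ℝ G (q, u q) ∘L .inr ℝ P X
      = 1 - (fderiv ℝ T (q, u q)).comp (.inr ℝ P X) := by
    have : HasFDerivAt G (.snd ℝ P X - fderiv ℝ T (q, u q)) (q, u q) :=
      hasFDerivAt_snd.sub (hT.differentiable (by simp) _).hasFDerivAt
    rw [this.fderiv]
    ext v
    simp
  have hinv : (fderiv ℝ G (q, u q) ∘L .inr ℝ P X).IsInvertible := by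
    rw [hGd]
    have hlt : ‖(fderiv ℝ T (q, u q)).comp (.inr ℝ P X)‖ < 1 :=
      ((hd q (u q)).le_of_lipschitz (hlip q hq).2).trans_lt (hlip q hq).1
    refine ⟨ContinuousLinearEquiv.ofUnit (Units.oneSub _ hlt), ?_⟩
    ext v
    rfl
  have hcd : ContDiffAt ℝ ∞ G (q, u q) := hG.contDiffAt
  refine (hcd.contDiffAt_implicitFunction (by simp) hinv).congr_of_eventuallyEq ?_
  filter_upwards [hcd.eventually_apply_implicitFunction (by simp) hinv, hU.mem_nhds hq]
    with y hy hyU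
  have h0 : G (q, u q) = 0 := by simp [hGdef, (hu q hq).1]
  rw [h0] at hy
  -- The implicit function satisfies the same fixed point equation, so uniqueness identifies it with
  -- `u`.
  exact ((hu y hyU).2 _ (sub_eq_zero.1 hy).symm).symm

end FixedPoint

/-! ### Analysis on solid tori -/

section Tube

/-- The universal cover of the open solid torus of radius `R`. -/
def Tube (R : ℝ) : Set (ℂ × ℝ) := {q | ‖q.1‖ < R}

lemma isOpen_tube (R : ℝ) : IsOpen (Tube R) := isOpen_lt (by fun_prop) continuous_const

lemma mem_tube {R : ℝ} {q : ℂ × ℝ} : q ∈ Tube R ↔ ‖q.1‖ < R := Iff.rfl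

lemma tube_mono {R R' : ℝ} (h : R ≤ R') : Tube R ⊆ Tube R' := fun _ hq => lt_of_lt_of_le hq h

/-- By periodicity only one compact period of the core matters, and there the tube lemma applies. -/
lemma exists_tube_of_eventually {P : ℂ × ℝ → Prop}
    (hper : ∀ z l, P (z, l + 2 * Real.pi) ↔ P (z, l)) (hP : ∀ l, ∀ᶠ q in 𝓝 ((0 : ℂ), l), P q) :
    ∃ ε > 0, ∀ q ∈ Tube ε, P q := by
  have hc : IsCompact (Icc (0 : ℝ) (2 * Real.pi)) := isCompact_Icc
  have h1 : ∀ᶠ z in 𝓝 (0 : ℂ), ∀ l ∈ Icc (0 : ℝ) (2 * Real.pi), P (z, l) :=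
    hc.eventually_forall_of_forall_eventually fun l _ => hP l
  obtain ⟨ε, hε, hball⟩ := Metric.eventually_nhds_iff.1 h1
  refine ⟨ε, hε, fun q hq => ?_⟩
  have hp : Function.Periodic (fun l => P (q.1, l)) (2 * Real.pi) := fun l => propext (hper q.1 l)
  obtain ⟨y, hy, he⟩ := hp.exists_mem_Ico₀ Real.two_pi_pos q.2
  have := hball (y := q.1) (by simpa [mem_tube] using hq) y ⟨hy.1, hy.2.le⟩
  exact he.mpr this

/-- Periodicity and vanishing outside a disc reduce the bound to a compact set. -/
lemma exists_bound_of_periodic {F : Type*} [NormedAddCommGroup F] {f : ℂ × ℝ → F}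
    (hf : Continuous f) (hper : ∀ z l, f (z, l + 2 * Real.pi) = f (z, l)) {R : ℝ}
    (h0 : ∀ q : ℂ × ℝ, R < ‖q.1‖ → f q = 0) : ∃ C, 0 ≤ C ∧ ∀ q, ‖f q‖ ≤ C := by
  have hc : IsCompact (Metric.closedBall (0 : ℂ) R ×ˢ Icc (0 : ℝ) (2 * Real.pi)) :=
    (isCompact_closedBall _ _).prod isCompact_Icc
  obtain ⟨C, hC⟩ := hc.exists_bound_of_continuousOn hf.continuousOn
  refine ⟨max C 0, le_max_right _ _, fun q => ?_⟩
  by_cases hq : R < ‖q.1‖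
  · simp [h0 q hq]
  · have hp : Function.Periodic (fun l => f (q.1, l)) (2 * Real.pi) := fun l => hper q.1 l
    obtain ⟨y, hy, he⟩ := hp.exists_mem_Ico₀ Real.two_pi_pos q.2
    have he' : f q = f (q.1, y) := he
    rw [he']
    exact (hC _ ⟨by simpa using not_lt.1 hq, hy.1, hy.2.le⟩).trans (le_max_left _ _)

/-- The cutoff depends on `z` only, so periodicity survives. The gain is a global Lipschitz
constant, which makes the equations for the rays and for the radius contractions on thin tubes. -/
lemma exists_periodic_extension {F : Type*} [NormedAddCommGroup F] [NormedSpace ℝ F]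
    {f : ℂ × ℝ → F} {R : ℝ} (hR : 0 < R) (hf : ContDiffOn ℝ ∞ f (Tube R))
    (hper : ∀ z l, ‖z‖ < R → f (z, l + 2 * Real.pi) = f (z, l)) :
    ∃ g : ℂ × ℝ → F, ContDiff ℝ ∞ g ∧ (∀ z l, g (z, l + 2 * Real.pi) = g (z, l)) ∧
      (∀ q ∈ Tube (R / 2), g q = f q) ∧ (∃ C, ∀ q, ‖g q‖ ≤ C) ∧ ∃ C, LipschitzWith C g := by
  let χ : ContDiffBump (0 : ℂ) := ⟨R / 2, 3 * R / 4, by linarith, by linarith⟩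
  have hχ0 : ∀ z : ℂ, 3 * R / 4 ≤ ‖z‖ → χ z = 0 := fun z hz => χ.zero_of_le_dist (by simpa using hz)
  set g : ℂ × ℝ → F := fun q => χ q.1 • f q with hg
  have hsm : ContDiff ℝ ∞ g := by
    refine contDiff_iff_contDiffAt.2 fun q => ?_
    by_cases hq : ‖q.1‖ < R
    · exact (χ.contDiff.contDiffAt.comp q contDiffAt_fst).smul
        (hf.contDiffAt ((isOpen_tube R).mem_nhds hq))
    · have : g =ᶠ[𝓝 q] fun _ => 0 := by
        have ho : IsOpen {q : ℂ × ℝ | 3 * R / 4 < ‖q.1‖} := isOpen_lt continuous_const (by fun_prop)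
        filter_upwards [ho.mem_nhds (show 3 * R / 4 < ‖q.1‖ by linarith)] with y hy
        simp [hg, hχ0 y.1 (le_of_lt hy)]
      exact contDiffAt_const.congr_of_eventuallyEq this
  have hgper : ∀ z l, g (z, l + 2 * Real.pi) = g (z, l) := by
    intro z l
    by_cases hz : ‖z‖ < R
    · simp [hg, hper z l hz]
    · simp [hg, hχ0 z (by linarith)]
  have hg0 : ∀ q : ℂ × ℝ, 3 * R / 4 < ‖q.1‖ → g q = 0 := fun q hq => by simp [hg, hχ0 _ hq.le]
  refine ⟨g, hsm, hgper, ?_, ?_, ?_⟩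
  · intro q hq
    have : χ q.1 = 1 := χ.one_of_mem_closedBall (by simpa using (mem_tube.1 hq).le)
    simp [hg, this]
  · obtain ⟨C, -, hC⟩ := exists_bound_of_periodic hsm.continuous hgper hg0
    exact ⟨C, hC⟩
  · have hp : ∀ z l, fderiv ℝ g (z, l + 2 * Real.pi) = fderiv ℝ g (z, l) := by
      intro z l
      have h1 : (fun q : ℂ × ℝ => g (q + ((0 : ℂ), 2 * Real.pi))) = g := by
        ext q
        have := hgper q.1 q.2
        simpa [Prod.add_def] using this
      have h2 := fderiv_comp_add_right (𝕜 := ℝ) (f := g) (x := (z, l)) ((0 : ℂ), 2 * Real.pi)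
      rw [h1] at h2
      rw [h2]
      simp
    have hz : ∀ q : ℂ × ℝ, 3 * R / 4 < ‖q.1‖ → fderiv ℝ g q = 0 := by
      intro q hq
      have : g =ᶠ[𝓝 q] fun _ => 0 := by
        have ho : IsOpen {q : ℂ × ℝ | 3 * R / 4 < ‖q.1‖} := isOpen_lt continuous_const (by fun_prop)
        filter_upwards [ho.mem_nhds hq] with y hy using hg0 y hy
      rw [this.fderiv_eq]
      simp
    obtain ⟨C, hC0, hC⟩ := exists_bound_of_periodic (hsm.continuous_fderiv (by simp)) hp hz
    refine ⟨⟨C, hC0⟩, lipschitzWith_of_nnnorm_fderiv_le (𝕜 := ℝ)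
      (hsm.differentiable (by simp)) fun q => ?_⟩
    exact_mod_cast hC q

lemma eq_zero_of_continuousAt_of_forall_ne {φ : ℝ → ℝ} (hφ : ContinuousAt φ 0)
    (h : ∀ᶠ x in 𝓝[≠] 0, φ x = 0) : φ 0 = 0 :=
  tendsto_nhds_unique (hφ.tendsto.mono_left nhdsWithin_le_nhds)
    ((Filter.tendsto_congr' h).2 tendsto_const_nhds)

end Tube

/-! ### Integral curves along rays, radial rescaling and division of forms -/

section Rays

/-- Constant functions, as a continuous linear map. -/
def constL (F : Type*) [NormedAddCommGroup F] [NormedSpace ℝ F] : F →L[ℝ] C(unitInterval, F) :=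
  LinearMap.mkContinuous
    { toFun := fun x => ContinuousMap.const _ x
      map_add' := fun _ _ => rfl
      map_smul' := fun _ _ => rfl } 1
    (fun x => by
      rw [one_mul]
      exact (ContinuousMap.norm_le _ (norm_nonneg _)).2 fun _ => le_rfl)

@[simp] lemma constL_apply {F : Type*} [NormedAddCommGroup F] [NormedSpace ℝ F] (x : F)
    (t : unitInterval) : constL F x t = x := rfl

/-- The primitive of `f` that vanishes at `0`. -/
def primitiveFun (f : C(unitInterval, ℝ)) (t : ℝ) : ℝ :=
  ∫ s in (0 : ℝ)..t, IccExtend zero_le_one f s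

lemma continuous_iccExtend (f : C(unitInterval, ℝ)) :
    Continuous (IccExtend (zero_le_one (α := ℝ)) f) := f.continuous.Icc_extend'

lemma hasDerivAt_primitiveFun (f : C(unitInterval, ℝ)) (t : ℝ) :
    HasDerivAt (primitiveFun f) (IccExtend zero_le_one f t) t :=
  intervalIntegral.integral_hasDerivAt_right ((continuous_iccExtend f).intervalIntegrable _ _)
    ((continuous_iccExtend f).stronglyMeasurableAtFilter _ _) (continuous_iccExtend f).continuousAt

lemma norm_primitiveFun_le {f : C(unitInterval, ℝ)} {C : ℝ} (hC : ∀ s, ‖f s‖ ≤ C)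
    (t : unitInterval) : ‖primitiveFun f t‖ ≤ C := by
  have h0 : 0 ≤ C := (norm_nonneg _).trans (hC 0)
  refine (intervalIntegral.norm_integral_le_of_norm_le_const (C := C) fun s _ => hC _).trans ?_
  rw [sub_zero, abs_of_nonneg t.2.1]
  exact mul_le_of_le_one_right h0 t.2.2

/-- Integration from `0`, as an operator on continuous functions. -/
def primitiveL : C(unitInterval, ℝ) →L[ℝ] C(unitInterval, ℝ) :=
  LinearMap.mkContinuous
    { toFun := fun f => ⟨fun t => primitiveFun f t,
        (continuous_iff_continuousAt.2 fun t =>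
          (hasDerivAt_primitiveFun f t).continuousAt).comp continuous_subtype_val⟩
      map_add' := fun f g => by
        ext t
        exact intervalIntegral.integral_add ((continuous_iccExtend f).intervalIntegrable _ _)
          ((continuous_iccExtend g).intervalIntegrable _ _)
      map_smul' := fun c f => by
        ext t
        exact intervalIntegral.integral_const_mul c _ } 1
    (fun f => by
      rw [one_mul]
      exact (ContinuousMap.norm_le _ (norm_nonneg _)).2
        fun t => norm_primitiveFun_le f.norm_coe_le_norm t)

/-- The curve `s ↦ (s z, u s)`. -/
def rayCurve : ℂ × C(unitInterval, ℝ) →L[ℝ] C(unitInterval, ℂ × ℝ) :=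
  LinearMap.mkContinuous
    { toFun := fun y => ⟨fun s => (((s : ℝ) : ℂ) * y.1, y.2 s), by fun_prop⟩
      map_add' := fun y y' => by ext s <;> simp [mul_add]
      map_smul' := fun c y => by ext s <;> simp [mul_left_comm] } 1
    (fun y => by
      rw [one_mul]
      refine (ContinuousMap.norm_le _ (norm_nonneg _)).2 fun s => ?_
      refine max_le_max ?_ (y.2.norm_coe_le_norm s)
      have h0 : ‖((s : ℝ) : ℂ)‖ ≤ 1 := by
        rw [Complex.norm_real, Real.norm_of_nonneg s.2.1]; exact s.2.2
      simpa using mul_le_mul_of_nonneg_right h0 (norm_nonneg y.1))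

@[simp] lemma rayCurve_apply (z : ℂ) (u : C(unitInterval, ℝ)) (s : unitInterval) :
    rayCurve (z, u) s = (((s : ℝ) : ℂ) * z, u s) := rfl

/-- The integral operator whose fixed points are the integral curves over rays of the plane field
`dλ + a = 0`. -/
def rayOperator {a : ℂ × ℝ → ℂ →L[ℝ] ℝ} (ha : Continuous a)
    (y : (ℂ × ℝ) × C(unitInterval, ℝ)) : C(unitInterval, ℝ) :=
  constL ℝ y.1.2 - primitiveL (pointwiseApply unitInterval ℂ ℝ
    ((⟨a, ha⟩ : C(ℂ × ℝ, ℂ →L[ℝ] ℝ)).comp (rayCurve (y.1.1, y.2))) (constL ℂ y.1.1))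

lemma contDiff_rayOperator {a : ℂ × ℝ → ℂ →L[ℝ] ℝ} (ha : ContDiff ℝ ∞ a) :
    ContDiff ℝ ∞ (rayOperator ha.continuous) := by
  have h1 := (contDiff_superposition (K := unitInterval) ha).comp
    (rayCurve.contDiff.comp (g := rayCurve)
      (f := fun y : (ℂ × ℝ) × C(unitInterval, ℝ) => (y.1.1, y.2))
      (n := ∞) (by fun_prop))
  have h3 : ContDiff ℝ ∞ (fun y : (ℂ × ℝ) × C(unitInterval, ℝ) => constL ℂ y.1.1) :=
    (constL ℂ).contDiff.comp (by fun_prop)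
  have h4 : ContDiff ℝ ∞ (fun y : (ℂ × ℝ) × C(unitInterval, ℝ) => constL ℝ y.1.2) :=
    (constL ℝ).contDiff.comp (by fun_prop)
  exact h4.sub (primitiveL.contDiff.comp (contDiff_pointwiseApply h1 h3))

/-- The integrand is a value of `a` applied to `z`, so a Lipschitz constant `C` of `a` becomes `C
‖z‖` for the operator, which is small on a thin tube. -/
lemma contractingWith_rayOperator {a : ℂ × ℝ → ℂ →L[ℝ] ℝ} (ha : Continuous a) {C : NNReal}
    (hC : LipschitzWith C a) {q : ℂ × ℝ} (hq : C * ‖q.1‖ ≤ 1 / 2) :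
    ContractingWith (1 / 2) (fun u => rayOperator ha (q, u)) := by
  refine ⟨by rw [← NNReal.coe_lt_coe]; norm_num, LipschitzWith.of_dist_le_mul fun u v => ?_⟩
  rw [dist_eq_norm, dist_eq_norm, rayOperator, rayOperator, sub_sub_sub_cancel_left, ← map_sub]
  refine (ContinuousMap.norm_le _ (by positivity)).2 fun t => ?_
  refine norm_primitiveFun_le (fun s => ?_) t
  have h1 : ‖a ((s : ℝ) * q.1, v s) - a ((s : ℝ) * q.1, u s)‖ ≤ C * ‖u - v‖ := by
    refine (hC.norm_sub_le _ _).trans ?_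
    gcongr
    rw [norm_sub_rev u v]
    refine max_le (by simp) ((v - u).norm_coe_le_norm s)
  have h2 := (a ((s : ℝ) * q.1, v s) - a ((s : ℝ) * q.1, u s)).le_of_opNorm_le h1 q.1
  calc _ ≤ C * ‖u - v‖ * ‖q.1‖ := h2
    _ = (C * ‖q.1‖) * ‖u - v‖ := by ring
    _ ≤ _ := by simpa using mul_le_mul_of_nonneg_right hq (norm_nonneg (u - v))

lemma rayOperator_apply {a : ℂ × ℝ → ℂ →L[ℝ] ℝ} (ha : Continuous a) (q : ℂ × ℝ)
    (u : C(unitInterval, ℝ)) (t : unitInterval) :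
    rayOperator ha (q, u) t = q.2 - ∫ s in (0 : ℝ)..t,
      a ((projIcc 0 1 zero_le_one s : ℝ) * q.1, u (projIcc 0 1 zero_le_one s)) q.1 := rfl

/-- The plane field `dλ + a = 0` is integrated along rays: following the integral curve over the ray
through `z` that starts at height `λ` on the core defines a smooth function `S (z, λ)`. -/
theorem exists_ray_integral {a : ℂ × ℝ → ℂ →L[ℝ] ℝ} (ha : ContDiff ℝ ∞ a)
    (hper : ∀ z l, a (z, l + 2 * Real.pi) = a (z, l)) {C : NNReal} (hC : LipschitzWith C a) :
    ∃ ε > 0, ∃ S : ℂ × ℝ → ℝ, ContDiffOn ℝ ∞ S (Tube ε) ∧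
      (∀ q ∈ Tube ε, S (q.1, q.2 + 2 * Real.pi) = S q + 2 * Real.pi) ∧ (∀ l, S (0, l) = l) ∧
      ∀ q ∈ Tube ε, fderiv ℝ S q (q.1, 0) = - a (q.1, S q) q.1 := by
  -- This gives `C δ ≤ 1 / 2`; adding `1` keeps the denominator positive when `C = 0`.
  set δ : ℝ := 1 / (2 * (C + 1)) with hδ
  have hδ0 : 0 < δ := by positivity
  have hcon : ∀ q ∈ Tube δ,
      ContractingWith (1 / 2) (fun u => rayOperator ha.continuous (q, u)) := by
    intro q hq
    refine contractingWith_rayOperator _ hC ?_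
    have h1 : (C : ℝ) * ‖q.1‖ ≤ (C + 1) * δ := by
      gcongr
      · linarith
      · exact (mem_tube.1 hq).le
    refine h1.trans (le_of_eq ?_)
    rw [hδ]; field_simp
  obtain ⟨u, hu, huniq, hsm⟩ := exists_smooth_fixedPoint (contDiff_rayOperator ha) hcon
  -- By uniqueness, the solution over the shorter ray to `t z` is the solution over the ray to `z`
  -- run at speed `t`. The endpoint values thus record the whole curve.
  have hscale : ∀ q ∈ Tube δ, ∀ t : unitInterval, u ((t : ℝ) * q.1, q.2) 1 = u q t := by
    intro q hq t
    have hmem : (((t : ℝ) : ℂ) * q.1, q.2) ∈ Tube δ := by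
      rw [mem_tube, norm_mul, Complex.norm_real, Real.norm_of_nonneg t.2.1]
      exact (mul_le_of_le_one_left (norm_nonneg _) t.2.2).trans_lt hq
    set v : C(unitInterval, ℝ) := ⟨fun s => u q (t * s), by fun_prop⟩ with hv
    have : v = u (((t : ℝ) : ℂ) * q.1, q.2) := by
      refine huniq _ hmem v ?_
      ext s
      rw [rayOperator_apply]
      have h1 : v s = rayOperator ha.continuous (q, u q) (t * s) := by rw [hu q hq]; rfl
      rw [h1, rayOperator_apply]
      congr 1
      have h2 := intervalIntegral.smul_integral_comp_mul_left (a := 0) (b := (s : ℝ))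
        (fun x => a ((projIcc 0 1 zero_le_one x : ℝ) * q.1, u q (projIcc 0 1 zero_le_one x)) q.1)
        (t : ℝ)
      rw [mul_zero] at h2
      rw [show ((t * s : unitInterval) : ℝ) = t * s from rfl, ← h2, smul_eq_mul,
        ← intervalIntegral.integral_const_mul]
      refine intervalIntegral.integral_congr fun x hx => ?_
      rw [uIcc_of_le s.2.1] at hx
      have hx01 : x ∈ Icc (0 : ℝ) 1 := ⟨hx.1, hx.2.trans s.2.2⟩
      have htx : (t : ℝ) * x ∈ Icc (0 : ℝ) 1 := unitInterval.mul_mem t.2 hx01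
      have e1 : projIcc 0 1 zero_le_one ((t : ℝ) * x) = t * ⟨x, hx01⟩ :=
        projIcc_of_mem _ htx
      have e2 : projIcc 0 1 zero_le_one x = ⟨x, hx01⟩ := projIcc_of_mem _ hx01
      simp only [e1, e2, hv]
      have e3 : (((t : ℝ) : ℂ)) * q.1 = (t : ℝ) • q.1 := by simp
      rw [e3, map_smul, smul_eq_mul]
      congr 3
      simp only [ContinuousMap.coe_mk, Prod.mk.injEq, and_true]
      simp
      ring
    rw [← this]
    simp [hv]
  have hSsm : ContDiffOn ℝ ∞ (fun q => u q 1) (Tube δ) := by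
    have := (ContinuousMap.evalCLM ℝ (1 : unitInterval) : C(unitInterval, ℝ) →L[ℝ] ℝ).contDiff
      (n := ∞)
    exact this.comp_contDiffOn (hsm (isOpen_tube δ))
  refine ⟨δ / 2, half_pos hδ0, fun q => u q 1, hSsm.mono (tube_mono (by linarith)), ?_, ?_, ?_⟩
  · intro q hq
    have hqδ : q ∈ Tube δ := tube_mono (by linarith) hq
    have hqδ' : (q.1, q.2 + 2 * Real.pi) ∈ Tube δ := hqδ
    -- As `a` is periodic, the translate of a solution by `2π` solves the translated problem.
    have := huniq _ hqδ' (u q + constL ℝ (2 * Real.pi)) ?_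
    · change u (q.1, q.2 + 2 * Real.pi) 1 = u q 1 + 2 * Real.pi
      rw [← this]; rfl
    · ext t
      rw [rayOperator_apply]
      have h1 : u q t = rayOperator ha.continuous (q, u q) t := by rw [hu q hqδ]
      rw [ContinuousMap.add_apply, h1, rayOperator_apply]
      simp only [ContinuousMap.add_apply, constL_apply, hper]
      ring
  · intro l
    have h0 : ((0 : ℂ), l) ∈ Tube δ := by simpa [mem_tube] using hδ0
    have h1 : u (0, l) 1 = rayOperator ha.continuous ((0, l), u (0, l)) 1 := by rw [hu _ h0]
    change u (0, l) 1 = l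
    rw [h1, rayOperator_apply]
    simp
  · intro q hq
    -- The point `q` is the midpoint of the ray to `p`, so the curve is differentiated at the
    -- interior parameter `1 / 2`. This is why the final radius is `δ / 2`.
    set p : ℂ × ℝ := (2 * q.1, q.2) with hp
    have hpδ : p ∈ Tube δ := by
      rw [mem_tube] at hq ⊢
      simp only [hp, norm_mul, Complex.norm_ofNat]; linarith
    have hqδ : q ∈ Tube δ := tube_mono (by linarith) hq
    have hhalf : (1 / 2 : ℝ) ∈ Icc (0 : ℝ) 1 := by norm_num
    have hqp : (((1 / 2 : ℝ) : ℂ) * p.1, p.2) = q := by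
      ext <;> simp [hp]
    have hd1 : HasDerivAt (fun t : ℝ => u ((t : ℂ) * p.1, p.2) 1)
        (fderiv ℝ (fun q => u q 1) q (p.1, 0)) (1 / 2) := by
      have hS : HasFDerivAt (fun q => u q 1) (fderiv ℝ (fun q => u q 1) q)
          (((1 / 2 : ℝ) : ℂ) * p.1, p.2) := by
        rw [hqp]
        exact ((hSsm.contDiffAt ((isOpen_tube δ).mem_nhds hqδ)).differentiableAt
          (by simp)).hasFDerivAt
      have hc : HasDerivAt (fun t : ℝ => ((t : ℂ) * p.1, p.2)) (p.1, 0) (1 / 2) := by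
        refine HasDerivAt.prodMk ?_ (hasDerivAt_const _ _)
        simpa using (Complex.ofRealCLM.hasDerivAt (x := (1 / 2 : ℝ))).mul_const p.1
      exact hS.comp_hasDerivAt (1 / 2 : ℝ) hc
    have hd2 : HasDerivAt (fun t : ℝ => u ((t : ℂ) * p.1, p.2) 1)
        (- a (q.1, u q 1) p.1) (1 / 2) := by
      have hF := (hasDerivAt_primitiveFun (pointwiseApply unitInterval ℂ ℝ
        ((⟨a, ha.continuous⟩ : C(ℂ × ℝ, ℂ →L[ℝ] ℝ)).comp (rayCurve (p.1, u p)))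
          (constL ℂ p.1)) (1 / 2)).const_sub p.2
      rw [IccExtend_of_mem _ _ hhalf] at hF
      have e : u p ⟨1 / 2, hhalf⟩ = u q 1 := by
        rw [← hscale p hpδ ⟨1 / 2, hhalf⟩]
        simp only [hqp]
      simp only [pointwiseApply_apply, ContinuousMap.comp_apply, rayCurve_apply, constL_apply,
        ContinuousMap.coe_mk, e] at hF
      have hq1 : ((1 / 2 : ℝ) : ℂ) * p.1 = q.1 := congrArg Prod.fst hqp
      rw [hq1] at hF
      refine hF.congr_of_eventuallyEq ?_
      filter_upwards [Icc_mem_nhds (show (0 : ℝ) < 1 / 2 by norm_num)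
        (show (1 / 2 : ℝ) < 1 by norm_num)] with t ht
      have := hscale p hpδ ⟨t, ht⟩
      simp only at this
      rw [this]
      exact (DFunLike.congr_fun (hu p hpδ) ⟨t, ht⟩).symm
    -- The chain rule and the integral equation compute the same derivative; the factor `2` in `p.1
    -- = 2 q.1` cancels.
    have h3 := hd1.unique hd2
    have h4 : (p.1, (0 : ℝ)) = (2 : ℝ) • ((q.1, 0) : ℂ × ℝ) := by ext <;> simp [hp]
    have h5 : p.1 = (2 : ℝ) • q.1 := by simp [hp]
    rw [h4, map_smul, h5, map_smul, smul_eq_mul, smul_eq_mul] at h3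
    linarith

end Rays

section Radial

/-- Solving `κ = h (κ z, λ)` for small `z`. -/
theorem exists_radial_rescaling {h : ℂ × ℝ → ℝ} (hh : ContDiff ℝ ∞ h)
    (hper : ∀ z l, h (z, l + 2 * Real.pi) = h (z, l)) {C : NNReal} (hC : LipschitzWith C h) :
    ∃ ε > 0, ∃ κ : ℂ × ℝ → ℝ, ContDiffOn ℝ ∞ κ (Tube ε) ∧
      (∀ q ∈ Tube ε, κ (q.1, q.2 + 2 * Real.pi) = κ q) ∧
      (∀ q ∈ Tube ε, κ q = h ((κ q : ℂ) * q.1, q.2)) := by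
  set δ : ℝ := 1 / (2 * (C + 1)) with hδ
  have hδ0 : 0 < δ := by positivity
  have hT : ContDiff ℝ ∞ (fun y : (ℂ × ℝ) × ℝ => h ((y.2 : ℂ) * y.1.1, y.1.2)) := by
    have h1 : ContDiff ℝ ∞ (fun y : (ℂ × ℝ) × ℝ => (y.2 : ℂ)) :=
      Complex.ofRealCLM.contDiff.comp contDiff_snd
    refine hh.comp ((h1.mul ?_).prodMk ?_) <;> fun_prop
  have hcon : ∀ q ∈ Tube δ, ContractingWith (1 / 2)
      (fun w : ℝ => (fun y : (ℂ × ℝ) × ℝ => h ((y.2 : ℂ) * y.1.1, y.1.2)) (q, w)) := by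
    intro q hq
    refine ⟨by rw [← NNReal.coe_lt_coe]; norm_num, LipschitzWith.of_dist_le_mul fun u v => ?_⟩
    have h1 : (C : ℝ) * ‖q.1‖ ≤ 1 / 2 := by
      have : (C : ℝ) * ‖q.1‖ ≤ (C + 1) * δ := by
        gcongr
        · linarith
        · exact (mem_tube.1 hq).le
      refine this.trans (le_of_eq ?_)
      rw [hδ]; field_simp
    refine (hC.dist_le_mul _ _).trans ?_
    have h2 : dist ((u : ℂ) * q.1, q.2) ((v : ℂ) * q.1, q.2) = ‖q.1‖ * dist u v := by
      rw [Prod.dist_eq, dist_self, max_eq_left dist_nonneg, dist_eq_norm, ← sub_mul, norm_mul,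
        ← Complex.ofReal_sub, Complex.norm_real, mul_comm]
      rfl
    simp only [h2]
    rw [← mul_assoc]
    simpa using mul_le_mul_of_nonneg_right h1 (dist_nonneg (x := u) (y := v))
  obtain ⟨κ, hκ, huniq, hsm⟩ := exists_smooth_fixedPoint hT hcon
  refine ⟨δ, hδ0, κ, hsm (isOpen_tube δ), fun q hq => ?_, fun q hq => (hκ q hq).symm⟩
  refine (huniq (q.1, q.2 + 2 * Real.pi) hq _ ?_).symm
  simp only [hper]
  exact hκ q hq

/-- Averaging along horizontal segments, as a linear family of curves. -/
def horizontalCurve : ℂ × ℝ →L[ℝ] C(unitInterval, ℂ × ℝ) :=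
  LinearMap.mkContinuous
    { toFun := fun q => ⟨fun s => (((s : ℝ) : ℂ) * (q.1.re : ℂ) + (q.1.im : ℂ) * Complex.I, q.2),
        by fun_prop⟩
      map_add' := fun y y' => by ext s <;> simp; ring
      map_smul' := fun c y => by ext s <;> simp; ring } 2
    (fun q => by
      refine (ContinuousMap.norm_le _ (by positivity)).2 fun s => ?_
      have hq1 : ‖q.1‖ ≤ ‖q‖ := le_max_left _ _
      have hq2 : ‖q.2‖ ≤ ‖q‖ := le_max_right _ _
      refine max_le ?_ (hq2.trans (by linarith [norm_nonneg q]))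
      have h0 : ‖((s : ℝ) : ℂ)‖ ≤ 1 := by
        rw [Complex.norm_real, Real.norm_of_nonneg s.2.1]; exact s.2.2
      refine (norm_add_le _ _).trans ?_
      rw [norm_mul, norm_mul, Complex.norm_I, mul_one, Complex.norm_real, Complex.norm_real]
      have h1 : ‖q.1.re‖ ≤ ‖q.1‖ := Complex.abs_re_le_norm q.1
      have h2 : ‖q.1.im‖ ≤ ‖q.1‖ := Complex.abs_im_le_norm q.1
      rw [Complex.norm_real] at h0
      have h3 := mul_le_of_le_one_left (norm_nonneg q.1.re) h0
      rw [Complex.norm_real]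
      linarith)

/-- A `1`-form on the disc that vanishes on the radial direction is a smooth multiple of
`x dy - y dx`. -/
theorem exists_eq_mul_angular {b : ℂ × ℝ → ℂ →L[ℝ] ℝ} (hb : ContDiff ℝ ∞ b) {R : ℝ}
    (hper : ∀ z l, b (z, l + 2 * Real.pi) = b (z, l))
    (hrad : ∀ q ∈ Tube R, b q q.1 = 0) :
    ∃ G : ℂ × ℝ → ℝ, ContDiff ℝ ∞ G ∧ (∀ z l, G (z, l + 2 * Real.pi) = G (z, l)) ∧
      ∀ q ∈ Tube R, ∀ w, b q w = G q * (conj q.1 * w).im := by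
  have hb2 : ContDiff ℝ ∞ (fun q => b q Complex.I) := hb.clm_apply contDiff_const
  -- Write `b = b_x dx + b_y dy`. Then `k = ∂_x b_y`, and since `b_y` vanishes for `x = 0` in the
  -- tube, Hadamard's formula gives `b_y = x G` there, with `G` the mean of `k` over the horizontal
  -- segment from the axis `x = 0` to `z`.
  set k : ℂ × ℝ → ℝ := fun q => fderiv ℝ (fun q => b q Complex.I) q (1, 0) with hk
  have hksm : ContDiff ℝ ∞ k := (hb2.fderiv_right (m := ∞) (by simp)).clm_apply contDiff_const
  have hkper : ∀ z l, k (z, l + 2 * Real.pi) = k (z, l) := by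
    intro z l
    have h1 : (fun q : ℂ × ℝ => b (q + ((0 : ℂ), 2 * Real.pi)) Complex.I)
        = fun q => b q Complex.I := by
      ext q
      have := hper q.1 q.2
      simp [Prod.add_def, this]
    have h2 := fderiv_comp_add_right (𝕜 := ℝ) (f := fun q => b q Complex.I) (x := (z, l))
      ((0 : ℂ), 2 * Real.pi)
    rw [h1] at h2
    simp only [hk, h2]
    simp
  set G : ℂ × ℝ → ℝ := fun q =>
    primitiveL ((⟨k, hksm.continuous⟩ : C(ℂ × ℝ, ℝ)).comp (horizontalCurve q)) 1 with hG
  have hGsm : ContDiff ℝ ∞ G := by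
    have h1 := (contDiff_superposition (K := unitInterval) hksm).comp
      (horizontalCurve.contDiff (n := ∞))
    exact (ContinuousMap.evalCLM ℝ (1 : unitInterval) : C(unitInterval, ℝ) →L[ℝ] ℝ).contDiff.comp
      (primitiveL.contDiff.comp h1)
  have hGint : ∀ q : ℂ × ℝ,
      q.1.re * G q = b q Complex.I - b (q.1.im * Complex.I, q.2) Complex.I := by
    intro q
    have hd : ∀ s : ℝ, HasDerivAt
        (fun s : ℝ => b ((s : ℂ) * (q.1.re : ℂ) + (q.1.im : ℂ) * Complex.I, q.2) Complex.I)
        (q.1.re * k ((s : ℂ) * (q.1.re : ℂ) + (q.1.im : ℂ) * Complex.I, q.2)) s := by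
      intro s
      have hc : HasDerivAt (fun s : ℝ => ((s : ℂ) * (q.1.re : ℂ) + (q.1.im : ℂ) * Complex.I, q.2))
          ((q.1.re : ℂ), 0) s := by
        refine HasDerivAt.prodMk ?_ (hasDerivAt_const _ _)
        simpa using ((Complex.ofRealCLM.hasDerivAt (x := s)).mul_const
          (q.1.re : ℂ)).add_const ((q.1.im : ℂ) * Complex.I)
      have h1 := ((hb2.differentiable (by simp) _).hasFDerivAt).comp_hasDerivAt s hc
      have h2 : (((q.1.re : ℂ), 0) : ℂ × ℝ) = q.1.re • ((1, 0) : ℂ × ℝ) := by ext <;> simp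
      rw [h2, map_smul] at h1
      exact h1
    have hintegral := intervalIntegral.integral_eq_sub_of_hasDerivAt (a := 0) (b := 1)
      (fun s _ => hd s) (Continuous.intervalIntegrable (by fun_prop) _ _)
    have hG1 : G q =
        ∫ s in (0 : ℝ)..1, k ((s : ℂ) * (q.1.re : ℂ) + (q.1.im : ℂ) * Complex.I, q.2) := by
      refine intervalIntegral.integral_congr fun s hs => ?_
      have hs' : s ∈ Icc (0 : ℝ) 1 := by simpa using hs
      rw [IccExtend_of_mem _ _ hs']
      rfl
    rw [hG1, ← intervalIntegral.integral_const_mul, hintegral]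
    have e : ((1 : ℝ) : ℂ) * (q.1.re : ℂ) + (q.1.im : ℂ) * Complex.I = q.1 := by
      simp [Complex.re_add_im]
    rw [e]
    simp
  -- At `t w` the form kills `t w`, hence `w` if `t ≠ 0`; now let `t` tend to `0`.
  have hb0 : ∀ l w, 0 < R → b (0, l) w = 0 := by
    intro l w hR
    have hcont : ContinuousAt (fun t : ℝ => b ((t : ℂ) * w, l) w) 0 := by
      have := hb.continuous
      fun_prop
    have := eq_zero_of_continuousAt_of_forall_ne hcont ?_
    · simpa using this
    · have hmem : ∀ᶠ t : ℝ in 𝓝 0, ((t : ℂ) * w, l) ∈ Tube R := by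
        have : ContinuousAt (fun t : ℝ => ((t : ℂ) * w, l)) 0 := by fun_prop
        exact this.eventually_mem ((isOpen_tube R).mem_nhds (by simpa [mem_tube] using hR))
      filter_upwards [nhdsWithin_le_nhds hmem, self_mem_nhdsWithin] with t ht ht0
      have h1 := hrad _ ht
      have h2 : (t : ℂ) * w = t • w := by simp
      simp only at h1
      rw [h2, map_smul, smul_eq_mul, mul_eq_zero] at h1
      rw [h2]
      exact h1.resolve_left ht0
  have hvert : ∀ q ∈ Tube R, b (q.1.im * Complex.I, q.2) Complex.I = 0 := by
    intro q hq
    have hR : 0 < R := (norm_nonneg _).trans_lt hq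
    by_cases hy : q.1.im = 0
    · rw [hy]; simpa using hb0 q.2 Complex.I hR
    · have hm : ((q.1.im : ℂ) * Complex.I, q.2) ∈ Tube R := by
        rw [mem_tube, norm_mul, Complex.norm_I, mul_one, Complex.norm_real]
        exact (Complex.abs_im_le_norm q.1).trans_lt hq
      have h1 := hrad _ hm
      have h2 : (q.1.im : ℂ) * Complex.I = q.1.im • Complex.I := by simp
      simp only at h1
      rw [show b (↑q.1.im * Complex.I, q.2) (↑q.1.im * Complex.I)
        = q.1.im * b (↑q.1.im * Complex.I, q.2) Complex.I by
          conv_lhs => rw [h2, map_smul, smul_eq_mul, ← h2]] at h1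
      exact (mul_eq_zero.1 h1).resolve_left hy
  have hI : ∀ q ∈ Tube R, b q Complex.I = q.1.re * G q := by
    intro q hq
    rw [hGint, hvert q hq, sub_zero]
  have hdec : ∀ (q : ℂ × ℝ) (w : ℂ), b q w = w.re * b q 1 + w.im * b q Complex.I := by
    intro q w
    have : w = w.re • (1 : ℂ) + w.im • Complex.I := by simp [Complex.re_add_im]
    conv_lhs => rw [this, map_add, map_smul, map_smul, smul_eq_mul, smul_eq_mul]
  -- Dividing `x b_x + y b_y = 0` by `x` gives `b_x = -y G` off the axis `x = 0`; continuity then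
  -- extends it across the axis.
  have h1ne : ∀ q ∈ Tube R, q.1.re ≠ 0 → b q 1 + q.1.im * G q = 0 := by
    intro q hq hx
    have h1 := hrad q hq
    rw [hdec, hI q hq] at h1
    have : q.1.re * (b q 1 + q.1.im * G q) = 0 := by linarith
    exact (mul_eq_zero.1 this).resolve_left hx
  have h1 : ∀ q ∈ Tube R, b q 1 + q.1.im * G q = 0 := by
    intro q hq
    by_cases hx : q.1.re = 0
    · have hbc := hb.continuous
      have hGc := hGsm.continuous
      have hcont :
          ContinuousAt (fun t : ℝ => b (q.1 + t, q.2) 1 + q.1.im * G (q.1 + t, q.2)) 0 := by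
        fun_prop
      have := eq_zero_of_continuousAt_of_forall_ne hcont ?_
      · simpa using this
      · have hmem : ∀ᶠ t : ℝ in 𝓝 0, (q.1 + (t : ℂ), q.2) ∈ Tube R := by
          have : ContinuousAt (fun t : ℝ => (q.1 + (t : ℂ), q.2)) 0 := by fun_prop
          exact this.eventually_mem ((isOpen_tube R).mem_nhds (by simpa using hq))
        filter_upwards [nhdsWithin_le_nhds hmem, self_mem_nhdsWithin] with t ht ht0
        have := h1ne _ ht (by simpa [hx] using ht0)
        simpa using this
    · exact h1ne q hq hx
  refine ⟨G, hGsm, fun z l => ?_, fun q hq w => ?_⟩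
  · have : ((⟨k, hksm.continuous⟩ : C(ℂ × ℝ, ℝ)).comp (horizontalCurve (z, l + 2 * Real.pi)))
        = (⟨k, hksm.continuous⟩ : C(ℂ × ℝ, ℝ)).comp (horizontalCurve (z, l)) := by
      ext s
      exact hkper _ _
    simp only [hG, this]
  · rw [hdec, hI q hq, eq_neg_of_add_eq_zero_left (h1 q hq)]
    simp [Complex.mul_im]
    ring

end Radial

/-! ### The contact form `(dλ + r² dμ) / H` on a solid torus -/

section FlatContact

/-- The `1`-form `dλ + r² dμ`. -/
def stdForm (q : ℂ × ℝ) : ℂ × ℝ →L[ℝ] ℝ :=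
  .snd ℝ ℂ ℝ + Complex.imCLM.comp ((ContinuousLinearMap.mul ℝ ℂ (conj q.1)).comp (.fst ℝ ℂ ℝ))

@[simp] lemma stdForm_apply (q v : ℂ × ℝ) : stdForm q v = v.2 + (conj q.1 * v.1).im := rfl

lemma contDiff_stdForm : ContDiff ℝ ∞ stdForm := by
  refine contDiff_clm_apply_iff.2 fun v => ?_
  simp only [stdForm_apply]
  have h1 : ContDiff ℝ ∞ (fun q : ℂ × ℝ => conj q.1 * v.1) :=
    (Complex.conjCLE.contDiff.comp contDiff_fst).mul contDiff_const
  exact contDiff_const.add (Complex.imCLM.contDiff.comp h1)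

/-- The exterior derivative of a `1`-form on a vector space. -/
def dFlat {E : Type*} [NormedAddCommGroup E] [NormedSpace ℝ E] (A : E → E →L[ℝ] ℝ)
    (q v w : E) : ℝ :=
  fderiv ℝ A q v w - fderiv ℝ A q w v

lemma fderiv_smul_stdForm {F : ℂ × ℝ → ℝ} {q : ℂ × ℝ} (hF : DifferentiableAt ℝ F q) (v w : ℂ × ℝ) :
    fderiv ℝ (fun q => F q • stdForm q) q v w
      = fderiv ℝ F q v * stdForm q w + F q * (conj v.1 * w.1).im := by
  have hstd : DifferentiableAt ℝ stdForm q := contDiff_stdForm.differentiable (by simp) q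
  have h1 : fderiv ℝ stdForm q v w = (conj v.1 * w.1).im := by
    have h2 : HasFDerivAt (fun q => stdForm q w)
        (Complex.imCLM.comp (((ContinuousLinearMap.mul ℝ ℂ).flip w.1).comp
          ((Complex.conjCLE : ℂ →L[ℝ] ℂ).comp (.fst ℝ ℂ ℝ)))) q := by
      have := (Complex.imCLM.comp (((ContinuousLinearMap.mul ℝ ℂ).flip w.1).comp
          ((Complex.conjCLE : ℂ →L[ℝ] ℂ).comp (.fst ℝ ℂ ℝ)))).hasFDerivAt (x := q)
      exact this.const_add w.2
    have h3 := hstd.hasFDerivAt.clm_apply (hasFDerivAt_const w q)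
    have h4 := DFunLike.congr_fun (h3.unique h2) v
    simp at h4 ⊢
    linarith
  rw [fderiv_fun_smul hF hstd]
  simp [h1]
  ring

/-- This is `d(β / H) = -dH ∧ β / H² + dβ / H` for `β = dλ + r² dμ`, where `dβ = 2 dx ∧ dy`. -/
lemma dFlat_inv_smul_stdForm {H : ℂ × ℝ → ℝ} {q : ℂ × ℝ} (hH : DifferentiableAt ℝ H q)
    (h0 : H q ≠ 0) (X v : ℂ × ℝ) :
    dFlat (fun q => (H q)⁻¹ • stdForm q) q X v =
      (fderiv ℝ H q v * stdForm q X - fderiv ℝ H q X * stdForm q v) / H q ^ 2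
        + 2 * (conj X.1 * v.1).im / H q := by
  have hi : HasFDerivAt (fun q => (H q)⁻¹) (-(H q ^ 2)⁻¹ • fderiv ℝ H q) q :=
    (hasDerivAt_inv h0).comp_hasFDerivAt q hH.hasFDerivAt
  rw [dFlat, fderiv_smul_stdForm hi.differentiableAt, fderiv_smul_stdForm hi.differentiableAt,
    hi.fderiv]
  have : (conj v.1 * X.1).im = - (conj X.1 * v.1).im := by
    simp [Complex.mul_im]; ring
  rw [this]
  simp only [smul_apply, smul_eq_mul]
  field_simp
  ring

/-- The Reeb vector field of `(dλ + r² dμ) / H`. -/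
def reebField (H : ℂ × ℝ → ℝ) (q : ℂ × ℝ) : ℂ × ℝ :=
  -- The disc component is `(H_λ z + i ∇H) / 2`, with the gradient in `z` read as a complex number;
  -- the other component is then forced by `stdForm q X = H q`.
  let w : ℂ := (fderiv ℝ H q (0, 1) * q.1 + Complex.I *
    (fderiv ℝ H q (1, 0) + fderiv ℝ H q (Complex.I, 0) * Complex.I)) / 2
  (w, H q - (conj q.1 * w).im)

lemma reebField_fst_re (H : ℂ × ℝ → ℝ) (q : ℂ × ℝ) : (reebField H q).1.re =
    (fderiv ℝ H q (0, 1) * q.1.re - fderiv ℝ H q (Complex.I, 0)) / 2 := by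
  simp [reebField]
  ring

lemma reebField_fst_im (H : ℂ × ℝ → ℝ) (q : ℂ × ℝ) : (reebField H q).1.im =
    (fderiv ℝ H q (0, 1) * q.1.im + fderiv ℝ H q (1, 0)) / 2 := by
  simp [reebField]

lemma reebField_snd (H : ℂ × ℝ → ℝ) (q : ℂ × ℝ) :
    (reebField H q).2 = H q - (conj q.1 * (reebField H q).1).im := rfl

lemma clm_apply_prod (L : ℂ × ℝ →L[ℝ] ℝ) (v : ℂ × ℝ) :
    L v = v.1.re * L (1, 0) + v.1.im * L (Complex.I, 0) + v.2 * L (0, 1) := by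
  have : v = v.1.re • ((1, 0) : ℂ × ℝ) + v.1.im • ((Complex.I, 0) : ℂ × ℝ)
      + v.2 • ((0, 1) : ℂ × ℝ) := by
    ext <;> simp
  conv_lhs => rw [this, map_add, map_add, map_smul, map_smul, map_smul]
  simp

/-- The term `H_λ z` is radial and drops out, while the rotated gradient `i ∇H` pairs to the radial
derivative. Up to the factor `r²` the left side is `dμ` of the Reeb field, so transversality to the
pages becomes radial growth of `H`. -/
lemma reebField_angular (H : ℂ × ℝ → ℝ) (q : ℂ × ℝ) :
    (conj q.1 * (reebField H q).1).im = fderiv ℝ H q (q.1, 0) / 2 := by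
  rw [clm_apply_prod _ (q.1, 0), Complex.mul_im, reebField_fst_re, reebField_fst_im]
  simp
  ring

lemma contDiffAt_reebField {H : ℂ × ℝ → ℝ} {q : ℂ × ℝ} (hH : ContDiffAt ℝ ∞ H q) :
    ContDiffAt ℝ ∞ (reebField H) q := by
  have hd : ContDiffAt ℝ ∞ (fderiv ℝ H) q := hH.fderiv_right (by simp)
  have h : ∀ v, ContDiffAt ℝ ∞ (fun q => ((fderiv ℝ H q v : ℝ) : ℂ)) q := fun v =>
    Complex.ofRealCLM.contDiff.contDiffAt.comp q (hd.clm_apply contDiffAt_const)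
  have hw : ContDiffAt ℝ ∞ (fun q => (reebField H q).1) q := by
    refine ContDiffAt.div_const ?_ 2
    exact ((h _).mul contDiffAt_fst).add
      (contDiffAt_const.mul ((h _).add ((h _).mul contDiffAt_const)))
  refine hw.prodMk (hH.sub ?_)
  have h1 : ContDiffAt ℝ ∞ (fun q : ℂ × ℝ => conj q.1 * (reebField H q).1) q :=
    (Complex.conjCLE.contDiff.contDiffAt.comp q contDiffAt_fst).mul hw
  exact Complex.imCLM.contDiff.contDiffAt.comp q h1

/-- `reebField H` is characterized by the Reeb conditions. -/
theorem reeb_conditions_iff {H : ℂ × ℝ → ℝ} {q : ℂ × ℝ} (hH : DifferentiableAt ℝ H q)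
    (h0 : H q ≠ 0) (X : ℂ × ℝ) :
    ((H q)⁻¹ * stdForm q X = 1 ∧ ∀ v, dFlat (fun q => (H q)⁻¹ • stdForm q) q X v = 0) ↔
      X = reebField H q := by
  have key : ∀ X : ℂ × ℝ, stdForm q X = H q → ∀ v,
      dFlat (fun q => (H q)⁻¹ • stdForm q) q X v * H q ^ 2 =
        fderiv ℝ H q v * H q - fderiv ℝ H q X * stdForm q v
          + 2 * (conj X.1 * v.1).im * H q := by
    intro X hX v
    rw [dFlat_inv_smul_stdForm hH h0, hX]
    field_simp
  constructor
  · rintro ⟨h1, h2⟩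
    have hX : stdForm q X = H q := by field_simp at h1; linarith
    -- Testing on `∂_λ` determines `dH(X)`; testing on `∂_x` and `∂_y` then determines the disc
    -- component.
    have hl := key X hX (0, 1)
    have hx := key X hX (1, 0)
    have hy := key X hX (Complex.I, 0)
    rw [h2] at hl hx hy
    simp [Complex.mul_im] at hl hx hy
    have hl' : fderiv ℝ H q X = fderiv ℝ H q (0, 1) * H q := by linarith
    rw [hl'] at hx hy
    have hre : X.1.re = (reebField H q).1.re := by
      rw [reebField_fst_re]
      have :
          H q * (X.1.re * 2 - (fderiv ℝ H q (0, 1) * q.1.re - fderiv ℝ H q (Complex.I, 0))) = 0 := by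
        linarith
      linarith [(mul_eq_zero.1 this).resolve_left h0]
    have him : X.1.im = (reebField H q).1.im := by
      rw [reebField_fst_im]
      have : H q * (X.1.im * 2 - (fderiv ℝ H q (0, 1) * q.1.im + fderiv ℝ H q (1, 0))) = 0 := by
        linarith
      linarith [(mul_eq_zero.1 this).resolve_left h0]
    have hfst : X.1 = (reebField H q).1 := Complex.ext hre him
    refine Prod.ext hfst ?_
    rw [reebField_snd, ← hfst]
    rw [stdForm_apply] at hX
    linarith
  · rintro rfl
    have hX : stdForm q (reebField H q) = H q := by
      rw [stdForm_apply, reebField_snd]; ring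
    refine ⟨by rw [hX]; exact inv_mul_cancel₀ h0, fun v => ?_⟩
    have h1 := key _ hX v
    have hre := reebField_fst_re H q
    have him := reebField_fst_im H q
    have hs := reebField_snd H q
    rw [clm_apply_prod (fderiv ℝ H q) v, clm_apply_prod (fderiv ℝ H q) (reebField H q)] at h1
    rw [stdForm_apply] at h1
    simp only [Complex.mul_im, Complex.conj_re, Complex.conj_im, hre, him, hs] at h1
    have : dFlat (fun q => (H q)⁻¹ • stdForm q) q (reebField H q) v * H q ^ 2 = 0 := by
      rw [h1]; ring
    exact (mul_eq_zero.1 this).resolve_right (pow_ne_zero 2 h0)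

lemma hasDerivAt_radial {F : ℂ × ℝ → ℝ} {q : ℂ × ℝ} {t : ℝ}
    (hF : DifferentiableAt ℝ F ((t : ℂ) * q.1, q.2)) :
    HasDerivAt (fun t : ℝ => F ((t : ℂ) * q.1, q.2))
      (fderiv ℝ F ((t : ℂ) * q.1, q.2) (q.1, 0)) t := by
  have hc : HasDerivAt (fun t : ℝ => ((t : ℂ) * q.1, q.2)) (q.1, 0) t := by
    refine HasDerivAt.prodMk ?_ (hasDerivAt_const _ _)
    simpa using (Complex.ofRealCLM.hasDerivAt (x := t)).mul_const q.1
  exact hF.hasFDerivAt.comp_hasDerivAt t hc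

/-- `H` increases along the segment from the core to `q`: its derivative at `t z` in the direction
`z` is the radial derivative there divided by `t`. -/
lemma core_le_of_radial_pos {H : ℂ × ℝ → ℝ} {R : ℝ} (hH : ContDiffOn ℝ ∞ H (Tube R))
    (hrad : ∀ q ∈ Tube R, q.1 ≠ 0 → 0 < fderiv ℝ H q (q.1, 0)) {q : ℂ × ℝ} (hq : q ∈ Tube R) :
    H (0, q.2) ≤ H q := by
  by_cases hz : q.1 = 0
  · rw [← hz]
  have hmem : ∀ t ∈ Icc (0 : ℝ) 1, ((t : ℂ) * q.1, q.2) ∈ Tube R := by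
    intro t ht
    rw [mem_tube, norm_mul, Complex.norm_real, Real.norm_of_nonneg ht.1]
    exact (mul_le_of_le_one_left (norm_nonneg _) ht.2).trans_lt hq
  have hd : ∀ t ∈ Icc (0 : ℝ) 1, HasDerivAt (fun t : ℝ => H ((t : ℂ) * q.1, q.2))
      (fderiv ℝ H ((t : ℂ) * q.1, q.2) (q.1, 0)) t := fun t ht =>
    hasDerivAt_radial ((hH.contDiffAt ((isOpen_tube R).mem_nhds (hmem t ht))).differentiableAt
      (by simp))
  have hmono : MonotoneOn (fun t : ℝ => H ((t : ℂ) * q.1, q.2)) (Icc 0 1) := by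
    refine monotoneOn_of_deriv_nonneg (convex_Icc 0 1)
      (fun t ht => (hd t ht).continuousAt.continuousWithinAt) ?_ ?_
    · rw [interior_Icc]
      exact fun t ht => (hd t ⟨ht.1.le, ht.2.le⟩).differentiableAt.differentiableWithinAt
    · rw [interior_Icc]
      intro t ht
      rw [(hd t ⟨ht.1.le, ht.2.le⟩).deriv]
      have h1 := hrad _ (hmem t ⟨ht.1.le, ht.2.le⟩)
        (mul_ne_zero (Complex.ofReal_ne_zero.2 ht.1.ne') hz)
      have h2 : (((t : ℂ) * q.1, 0) : ℂ × ℝ) = t • ((q.1, 0) : ℂ × ℝ) := by ext <;> simp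
      simp only at h1
      rw [h2, map_smul, smul_eq_mul] at h1
      exact (pos_of_mul_pos_right h1 ht.1.le).le
  have := hmono (left_mem_Icc.2 zero_le_one) (right_mem_Icc.2 zero_le_one) zero_le_one
  simpa using this

/-- A radially increasing positive function on the solid torus can be made quadratic near the core,
staying radially increasing and positive. -/
theorem exists_quadratic_near_core {H : ℂ × ℝ → ℝ} {R : ℝ} (hR : 0 < R)
    (hH : ContDiffOn ℝ ∞ H (Tube R)) (hper : ∀ z l, ‖z‖ < R → H (z, l + 2 * Real.pi) = H (z, l))
    (hcore : ∀ l, 0 < H (0, l))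
    (hrad : ∀ q ∈ Tube R, q.1 ≠ 0 → 0 < fderiv ℝ H q (q.1, 0)) :
    ∃ H' : ℂ × ℝ → ℝ, ContDiffOn ℝ ∞ H' (Tube R) ∧
      (∀ z l, ‖z‖ < R → H' (z, l + 2 * Real.pi) = H' (z, l)) ∧ (∀ q ∈ Tube R, 0 < H' q) ∧
      (∀ q : ℂ × ℝ, R / 2 ≤ ‖q.1‖ → H' q = H q) ∧
      (∀ q ∈ Tube R, q.1 ≠ 0 → 0 < fderiv ℝ H' q (q.1, 0)) ∧
      ∃ c₀ c₁ : ℝ, 0 < c₀ ∧ ∀ q ∈ Tube (R / 4), H' q = c₀ + c₁ * ‖q.1‖ ^ 2 := by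
  have h0mem : ∀ l, ((0 : ℂ), l) ∈ Tube R := fun l => by simpa [mem_tube] using hR
  have hcc : Continuous (fun l : ℝ => H (0, l)) := by
    refine continuous_iff_continuousAt.2 fun l => ?_
    have := (hH.contDiffAt ((isOpen_tube R).mem_nhds (h0mem l))).continuousAt
    exact ContinuousAt.comp (f := fun l : ℝ => ((0 : ℂ), l)) this (by fun_prop)
  obtain ⟨l₀, -, hl₀⟩ := (isCompact_Icc (a := (0 : ℝ)) (b := 2 * Real.pi)).exists_isMinOn
    ⟨0, by simp [Real.pi_pos.le]⟩ hcc.continuousOn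
  have hmin : ∀ l, H (0, l₀) ≤ H (0, l) := by
    intro l
    have hp : Function.Periodic (fun l => H (0, l)) (2 * Real.pi) := fun l => hper 0 l (by simpa)
    obtain ⟨y, hy, he⟩ := hp.exists_mem_Ico₀ Real.two_pi_pos l
    have he' : H (0, l) = H (0, y) := he
    rw [he']
    exact hl₀ ⟨hy.1, hy.2.le⟩
  -- With `c₀` half the minimum of `H` on the core and `c₁ = c₀ / R²`, the quadratic function is at
  -- most `2 c₀`, hence at most `H`, on the whole tube.
  set c₀ := H (0, l₀) / 2 with hc₀
  have hc₀pos : 0 < c₀ := half_pos (hcore l₀)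
  set c₁ := c₀ / R ^ 2 with hc₁
  have hc₁pos : 0 < c₁ := by positivity
  -- `n` is `0` at radius `R / 4` and `1` at radius `R / 2`; the squared norm keeps it smooth on the
  -- core.
  set n : ℂ × ℝ → ℝ := fun q => (‖q.1‖ ^ 2 - (R / 4) ^ 2) / ((R / 2) ^ 2 - (R / 4) ^ 2) with hn
  set Q : ℂ × ℝ → ℝ := fun q => c₀ + c₁ * ‖q.1‖ ^ 2 with hQ
  have hnsq : ContDiff ℝ ∞ (fun q : ℂ × ℝ => ‖q.1‖ ^ 2) := (contDiff_norm_sq ℝ).comp contDiff_fst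
  have hden : 0 < (R / 2) ^ 2 - (R / 4) ^ 2 := by nlinarith
  have hτsm : ContDiff ℝ ∞ (fun q => Real.smoothTransition (n q)) :=
    Real.smoothTransition.contDiff.comp ((hnsq.sub contDiff_const).div_const _)
  have hQsm : ContDiff ℝ ∞ Q := contDiff_const.add (contDiff_const.mul hnsq)
  set H' : ℂ × ℝ → ℝ := fun q =>
    Real.smoothTransition (n q) * H q + (1 - Real.smoothTransition (n q)) * Q q with hH'
  have hH'sm : ContDiffOn ℝ ∞ H' (Tube R) :=
    (hτsm.contDiffOn.mul hH).add ((contDiff_const.sub hτsm).contDiffOn.mul hQsm.contDiffOn)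
  have hQle : ∀ q ∈ Tube R, Q q ≤ H q := by
    intro q hq
    have h1 := (hmin q.2).trans (core_le_of_radial_pos hH hrad hq)
    have h2 : ‖q.1‖ ^ 2 ≤ R ^ 2 := by
      have := (mem_tube.1 hq).le
      gcongr
    have h3 : c₁ * ‖q.1‖ ^ 2 ≤ c₀ := by
      calc c₁ * ‖q.1‖ ^ 2 ≤ c₁ * R ^ 2 := by gcongr
        _ = c₀ := by rw [hc₁]; field_simp
    simp only [hQ]
    linarith
  have hQpos : ∀ q, 0 < Q q := fun q => by simp only [hQ]; positivity
  refine ⟨H', hH'sm, ?_, ?_, ?_, ?_, c₀, c₁, hc₀pos, ?_⟩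
  · intro z l hz
    simp only [hH', hn, hQ, hper z l hz]
  · intro q hq
    have h1 := hQpos q
    have h2 := hQle q hq
    have h3 := Real.smoothTransition.nonneg (n q)
    have : H' q = Q q + Real.smoothTransition (n q) * (H q - Q q) := by simp only [hH']; ring
    rw [this]
    have := mul_nonneg h3 (sub_nonneg.2 h2)
    linarith
  · intro q hq
    have : 1 ≤ n q := by
      rw [hn, le_div_iff₀ hden, one_mul]
      gcongr
    simp [hH', Real.smoothTransition.one_of_one_le this]
  · intro q hq hz
    have hzpos : 0 < ‖q.1‖ := norm_pos_iff.2 hz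
    have hq1 : (((1 : ℝ) : ℂ) * q.1, q.2) = q := by ext <;> simp
    have hdiff : ∀ {F : ℂ × ℝ → ℝ}, ContDiffOn ℝ ∞ F (Tube R) → DifferentiableAt ℝ F q :=
      fun hF => (hF.contDiffAt ((isOpen_tube R).mem_nhds hq)).differentiableAt (by simp)
    have hdH : HasDerivAt (fun t : ℝ => H ((t : ℂ) * q.1, q.2)) (fderiv ℝ H q (q.1, 0)) 1 := by
      have := hasDerivAt_radial (F := H) (q := q) (t := 1) (by rw [hq1]; exact hdiff hH)
      rwa [hq1] at this
    have hdH' : HasDerivAt (fun t : ℝ => H' ((t : ℂ) * q.1, q.2)) (fderiv ℝ H' q (q.1, 0)) 1 := by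
      have := hasDerivAt_radial (F := H') (q := q) (t := 1) (by rw [hq1]; exact hdiff hH'sm)
      rwa [hq1] at this
    have hnorm : ∀ t : ℝ, ‖(t : ℂ) * q.1‖ ^ 2 = t ^ 2 * ‖q.1‖ ^ 2 := by
      intro t
      rw [norm_mul, mul_pow, Complex.norm_real, Real.norm_eq_abs, sq_abs]
    have hdsq : HasDerivAt (fun t : ℝ => ‖(t : ℂ) * q.1‖ ^ 2) (2 * ‖q.1‖ ^ 2) 1 := by
      simp only [hnorm]
      simpa using (hasDerivAt_pow 2 (1 : ℝ)).mul_const (‖q.1‖ ^ 2)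
    have hdn : HasDerivAt (fun t : ℝ => n ((t : ℂ) * q.1, q.2))
        (2 * ‖q.1‖ ^ 2 / ((R / 2) ^ 2 - (R / 4) ^ 2)) 1 := (hdsq.sub_const _).div_const _
    have hdQ : HasDerivAt (fun t : ℝ => Q ((t : ℂ) * q.1, q.2)) (c₁ * (2 * ‖q.1‖ ^ 2)) 1 :=
      (hdsq.const_mul c₁).const_add c₀
    set σ' := deriv Real.smoothTransition (n q) with hσ'
    have hσ'0 : 0 ≤ σ' := Real.smoothTransition.monotone.deriv_nonneg
    have hdσ : HasDerivAt Real.smoothTransition σ' (n (((1 : ℝ) : ℂ) * q.1, q.2)) := by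
      rw [hq1]
      exact ((Real.smoothTransition.contDiff (n := 1)).differentiable (by simp) _).hasDerivAt
    have hdτ := hdσ.comp 1 hdn
    have hall := (hdτ.mul hdH).add ((hdτ.const_sub 1).mul hdQ)
    have heq := hdH'.unique hall
    rw [heq]
    simp only [Function.comp_apply, hq1]
    have t0 := Real.smoothTransition.nonneg (n q)
    have t1 := Real.smoothTransition.le_one (n q)
    have hr := hrad q hq hz
    have hle := hQle q hq
    set τ := Real.smoothTransition (n q) with hτ
    set N := 2 * ‖q.1‖ ^ 2 / ((R / 2) ^ 2 - (R / 4) ^ 2) with hN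
    have hN0 : 0 ≤ N := by positivity
    -- The derivative of the cutoff does no harm: it is nonnegative in the radial direction and
    -- multiplies `H - Q ≥ 0`.
    have e1 : 0 ≤ σ' * N * (H q - Q q) := mul_nonneg (mul_nonneg hσ'0 hN0) (sub_nonneg.2 hle)
    have e2 : 0 < τ * fderiv ℝ H q (q.1, 0) + (1 - τ) * (c₁ * (2 * ‖q.1‖ ^ 2)) := by
      have hp : 0 < c₁ * (2 * ‖q.1‖ ^ 2) := by positivity
      rcases t0.eq_or_lt with h | h
      · rw [← h]; simpa using hp
      · have := mul_pos h hr
        have := mul_nonneg (sub_nonneg.2 t1) hp.le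
        linarith
    linarith
  · intro q hq
    have hle : n q ≤ 0 := by
      refine div_nonpos_of_nonpos_of_nonneg ?_ hden.le
      have := (mem_tube.1 hq).le
      rw [sub_nonpos]
      gcongr
    simp [hH', Real.smoothTransition.zero_of_nonpos hle, hQ]

/-- Here `i ∇H / 2 = c₁ i z`, and the longitudinal component is `H - c₁ r² = c₀`. This is the linear
field `c₁ ∂_μ + c₀ ∂_λ`. -/
lemma reebField_quadratic {H : ℂ × ℝ → ℝ} {R c₀ c₁ : ℝ}
    (hH : ∀ q ∈ Tube R, H q = c₀ + c₁ * ‖q.1‖ ^ 2) {q : ℂ × ℝ} (hq : q ∈ Tube R) :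
    reebField H q = (c₁ * (Complex.I * q.1), c₀) := by
  have he : H =ᶠ[𝓝 q] fun q => c₀ + c₁ * (q.1.re ^ 2 + q.1.im ^ 2) := by
    filter_upwards [(isOpen_tube R).mem_nhds hq] with y hy
    rw [hH y hy, ← Complex.normSq_eq_norm_sq, Complex.normSq_apply]
    ring
  have hre : HasFDerivAt (fun q : ℂ × ℝ => q.1.re) (Complex.reCLM.comp (.fst ℝ ℂ ℝ)) q :=
    (Complex.reCLM.comp (.fst ℝ ℂ ℝ)).hasFDerivAt
  have him : HasFDerivAt (fun q : ℂ × ℝ => q.1.im) (Complex.imCLM.comp (.fst ℝ ℂ ℝ)) q :=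
    (Complex.imCLM.comp (.fst ℝ ℂ ℝ)).hasFDerivAt
  have hd : HasFDerivAt H _ q :=
    ((((hre.pow 2).add (him.pow 2)).const_mul c₁).const_add c₀).congr_of_eventuallyEq he
  have h1 : (reebField H q).1 = c₁ * (Complex.I * q.1) := by
    apply Complex.ext
    · rw [reebField_fst_re, hd.fderiv]
      simp
      ring
    · rw [reebField_fst_im, hd.fderiv]
      simp
      ring
  refine Prod.ext h1 ?_
  rw [reebField_snd, h1, he.eq_of_nhds]
  simp [Complex.mul_im]
  ring

end FlatContact

/-! ### Pull-back of `1`-forms -/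

section Pullback

variable {M : Type*} [TopologicalSpace M] [ChartedSpace E3 M]
  {E : Type*} [NormedAddCommGroup E] [NormedSpace ℝ E]

/-- The pull-back of a `1`-form by a map from a vector space. -/
def pullbackForm (f : E → M) (α : OneForm M) (q : E) : E →L[ℝ] ℝ :=
  (α (f q)).comp (mfderiv 𝓘(ℝ, E) (𝓡 3) f q)

lemma pullbackForm_apply (f : E → M) (α : OneForm M) (q v : E) :
    pullbackForm f α q v = α (f q) (mfderiv 𝓘(ℝ, E) (𝓡 3) f q v) := rfl

variable [IsManifold (𝓡 3) ∞ M]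

lemma contMDiffOn_mfderiv_apply {f : E → M} {Ω : Set E} (hΩ : IsOpen Ω)
    (hf : ContMDiffOn 𝓘(ℝ, E) (𝓡 3) ∞ f Ω) {X : E → E} (hX : ContDiffOn ℝ ∞ X Ω) :
    ContMDiffOn 𝓘(ℝ, E) (𝓡 3).tangent ∞
      (fun q => (⟨f q, mfderiv 𝓘(ℝ, E) (𝓡 3) f q (X q)⟩ : TangentBundle (𝓡 3) M)) Ω := by
  have h1 := hf.contMDiffOn_tangentMapWithin (m := ∞) (by simp) hΩ.uniqueMDiffOn
  have h2 : ContMDiffOn 𝓘(ℝ, E) 𝓘(ℝ, E).tangent ∞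
      (fun q => (⟨q, X q⟩ : TangentBundle 𝓘(ℝ, E) E)) Ω := by
    intro q hq
    rw [contMDiffWithinAt_totalSpace]
    refine ⟨contMDiffWithinAt_id, ?_⟩
    simpa using (hX.contMDiffOn q hq)
  refine (h1.comp h2 (fun q hq => hq)).congr fun q hq => ?_
  simp only [Function.comp, tangentMapWithin, mfderivWithin_of_isOpen hΩ hq]

lemma contDiffOn_pullbackForm [FiniteDimensional ℝ E] {f : E → M} {Ω : Set E} (hΩ : IsOpen Ω)
    (hf : ContMDiffOn 𝓘(ℝ, E) (𝓡 3) ∞ f Ω) {α : OneForm M} {U : Set M} (hα : α.IsSmoothOn U)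
    (hmaps : MapsTo f Ω U) : ContDiffOn ℝ ∞ (pullbackForm f α) Ω := by
  refine contDiffOn_clm_apply.2 fun y => ?_
  have hv := contMDiffOn_mfderiv_apply hΩ hf (X := fun _ => y) contDiffOn_const
  have hφ := ContMDiffOn.comp hα hf hmaps
  have h1 := ContMDiffOn.clm_bundle_apply (b := f) (ϕ := fun q => α (f q))
    (v := fun q => mfderiv 𝓘(ℝ, E) (𝓡 3) f q y) (F₂ := ℝ) (E₂ := Bundle.Trivial M ℝ) hφ hv
  rw [← contMDiffOn_iff_contDiffOn]
  intro q hq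
  exact ((contMDiffWithinAt_totalSpace.1 (h1 q hq)).2)

end Pullback

/-! ### Naturality of the exterior derivative -/

section ExteriorDerivative

variable {M : Type*} [TopologicalSpace M] [ChartedSpace E3 M]
  {E : Type*} [NormedAddCommGroup E]

lemma eventually_mem_extChartAt_source {f : E → M} {q : E} (hf : ContinuousAt f q) :
    ∀ᶠ y in 𝓝 q, f y ∈ (extChartAt (𝓡 3) (f q)).source :=
  hf.eventually_mem (extChartAt_source_mem_nhds (I := 𝓡 3) (f q))

lemma OneForm.d_congr {α β : OneForm M} {x : M} (h : ∀ᶠ y in 𝓝 x, α y = β y) : α.d x = β.d x := by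
  have hev : α.inChart x =ᶠ[𝓝 (extChartAt (𝓡 3) x x)] β.inChart x := by
    have hc : ContinuousAt (extChartAt (𝓡 3) x).symm (extChartAt (𝓡 3) x x) :=
      continuousAt_extChartAt_symm x
    have h' : ∀ᶠ y in 𝓝 ((extChartAt (𝓡 3) x).symm (extChartAt (𝓡 3) x x)), α y = β y := by
      rwa [(extChartAt (𝓡 3) x).left_inv (mem_extChartAt_source x)]
    filter_upwards [hc.eventually h'] with y hy
    simp only [OneForm.inChart, hy]
  funext v w
  simp only [OneForm.d, hev.fderiv_eq]

lemma OneForm.d_neg (α : OneForm M) (x : M) (v w : TangentSpace (𝓡 3) x) :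
    (-α).d x v w = - α.d x v w := by
  have : (-α).inChart x = - α.inChart x := by
    funext y
    ext v
    rfl
  simp only [OneForm.d, this, fderiv_neg]
  have h : ∀ (D : E3 →L[ℝ] E3 →L[ℝ] ℝ) (a b : E3),
      (-D) a b - (-D) b a = -(D a b - D b a) := by
    intro D a b
    simp only [neg_apply]
    ring
  exact h _ _ _

lemma OneForm.d_neg_left (α : OneForm M) (x : M) (v w : TangentSpace (𝓡 3) x) :
    α.d x (-v) w = - α.d x v w := by
  have h : ∀ (T : TangentSpace (𝓡 3) x →L[ℝ] E3) (D : E3 →L[ℝ] E3 →L[ℝ] ℝ) (b : E3),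
      D (T (-v)) b - D b (T (-v)) = -(D (T v) b - D b (T v)) := by
    intro T D b
    simp only [map_neg, neg_apply]
    ring
  exact h _ _ _

variable [NormedSpace ℝ E]

lemma contDiffAt_extChartAt_comp {f : E → M} {q : E} (hf : ContMDiffAt 𝓘(ℝ, E) (𝓡 3) ∞ f q) :
    ContDiffAt ℝ ∞ (fun y => extChartAt (𝓡 3) (f q) (f y)) q := by
  rw [← contMDiffAt_iff_contDiffAt]
  exact (contMDiffAt_extChartAt (I := 𝓡 3) (n := ∞) (x := f q)).comp q hf

variable [IsManifold (𝓡 3) ∞ M]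

lemma mdifferentiableAt_extChartAt_symm (x : M) {y : E3} (hy : y ∈ (extChartAt (𝓡 3) x).target) :
    MDifferentiableAt 𝓘(ℝ, E3) (𝓡 3) (extChartAt (𝓡 3) x).symm y :=
  ((contMDiffOn_extChartAt_symm (n := ∞) x).contMDiffAt
    ((isOpen_extChartAt_target x).mem_nhds hy)).mdifferentiableAt (by simp)

/-- Near `q` the map `f` is the inverse chart composed with its own expression in the preferred
chart at `f q`, the chart in which `OneForm.d` is computed. -/
lemma pullbackForm_eq_inChart (α : OneForm M) {f : E → M} {Ω : Set E} (hΩ : IsOpen Ω)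
    (hf : ContMDiffOn 𝓘(ℝ, E) (𝓡 3) ∞ f Ω) {q : E} (hq : q ∈ Ω) :
    pullbackForm f α =ᶠ[𝓝 q] fun y =>
      (α.inChart (f q) (extChartAt (𝓡 3) (f q) (f y))).comp
        (fderiv ℝ (fun y => extChartAt (𝓡 3) (f q) (f y)) y) := by
  have hfq := (hf.contMDiffAt (hΩ.mem_nhds hq)).continuousAt
  have hev := (eventually_mem_extChartAt_source hfq).eventually_nhds
  filter_upwards [hΩ.mem_nhds hq, hev] with y hyΩ hy
  have hsrc : f y ∈ (extChartAt (𝓡 3) (f q)).source := hy.self_of_nhds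
  set e := extChartAt (𝓡 3) (f q) with he
  have htgt : e (f y) ∈ e.target := e.map_source hsrc
  have hfd : MDifferentiableAt 𝓘(ℝ, E) (𝓡 3) f y :=
    (hf.contMDiffAt (hΩ.mem_nhds hyΩ)).mdifferentiableAt (by simp)
  have hed : MDifferentiableAt (𝓡 3) 𝓘(ℝ, E3) e (f y) := mdifferentiableAt_extChartAt (by
    simpa [he, extChartAt_source] using hsrc)
  have hg : MDifferentiableAt 𝓘(ℝ, E) 𝓘(ℝ, E3) (fun y => e (f y)) y := hed.comp y hfd
  have hsymm : MDifferentiableAt 𝓘(ℝ, E3) (𝓡 3) e.symm (e (f y)) :=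
    mdifferentiableAt_extChartAt_symm (f q) htgt
  have heq : f =ᶠ[𝓝 y] fun y' => e.symm (e (f y')) := by
    filter_upwards [hy] with y' hy' using (e.left_inv hy').symm
  have hleft : e.symm (e (f y)) = f y := e.left_inv hsrc
  have h1 : HasMFDerivAt 𝓘(ℝ, E) (𝓡 3) (fun y' => e.symm (e (f y'))) y
      ((mfderiv 𝓘(ℝ, E3) (𝓡 3) e.symm (e (f y))).comp
        (mfderiv 𝓘(ℝ, E) 𝓘(ℝ, E3) (fun y => e (f y)) y)) :=
    hsymm.hasMFDerivAt.comp y hg.hasMFDerivAt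
  have h2 := (h1.congr_of_eventuallyEq heq).mfderiv
  rw [pullbackForm, h2, OneForm.inChart, mfderiv_eq_fderiv]
  ext v
  simp only [ContinuousLinearMap.comp_apply]
  have : ∀ {x x' : M} (h : x = x') (w : E3), α x w = α x' w := by rintro x _ rfl w; rfl
  exact this hleft.symm _

/-- The exterior derivative commutes with pull-back. -/
theorem dFlat_pullbackForm {α : OneForm M} {U : Set M} (hU : IsOpen U) (hα : α.IsSmoothOn U)
    {f : E → M} {Ω : Set E} (hΩ : IsOpen Ω) (hf : ContMDiffOn 𝓘(ℝ, E) (𝓡 3) ∞ f Ω) {q : E}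
    (hq : q ∈ Ω) (hfq : f q ∈ U) (v w : E) :
    dFlat (pullbackForm f α) q v w = α.d (f q) (mfderiv 𝓘(ℝ, E) (𝓡 3) f q v)
      (mfderiv 𝓘(ℝ, E) (𝓡 3) f q w) := by
  have hfat := hf.contMDiffAt (hΩ.mem_nhds hq)
  set e := extChartAt (𝓡 3) (f q) with he
  set g : E → E3 := fun y => e (f y) with hg
  have hgsm : ContDiffAt ℝ ∞ g q := contDiffAt_extChartAt_comp hfat
  have hgd : HasFDerivAt g (fderiv ℝ g q) q := (hgsm.differentiableAt (by simp)).hasFDerivAt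
  have hg2 : HasFDerivAt (fderiv ℝ g) (fderiv ℝ (fderiv ℝ g) q) q :=
    ((hgsm.fderiv_right (m := ∞) (by simp)).differentiableAt (by simp)).hasFDerivAt
  -- Differentiating the pull-back produces an extra term `α(D²g(v, w))`, which is symmetric and
  -- cancels on antisymmetrization.
  have hsymm : ∀ a b, fderiv ℝ (fderiv ℝ g) q a b = fderiv ℝ (fderiv ℝ g) q b a :=
    fun a b => (hgsm.isSymmSndFDerivAt (by
      rw [minSmoothness_of_isRCLikeNormedField]
      exact WithTop.coe_le_coe.2 (le_top : (2 : ℕ∞) ≤ ⊤))).eq a b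
  -- The expression of `α` in the chart is its pull-back by the inverse chart, hence smooth.
  have hin : ContDiffAt ℝ ∞ (α.inChart (f q)) (g q) := by
    have hcont : ContinuousOn e.symm e.target := continuousOn_extChartAt_symm (f q)
    have hopen : IsOpen (e.target ∩ e.symm ⁻¹' U) :=
      hcont.isOpen_inter_preimage (isOpen_extChartAt_target (f q)) hU
    have h1 : ContDiffOn ℝ ∞ (pullbackForm e.symm α) (e.target ∩ e.symm ⁻¹' U) :=
      contDiffOn_pullbackForm hopen
        ((contMDiffOn_extChartAt_symm (n := ∞) (f q)).mono inter_subset_left) hα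
        (fun y hy => hy.2)
    refine h1.contDiffAt (hopen.mem_nhds ⟨mem_extChartAt_target (f q), ?_⟩)
    change e.symm (e (f q)) ∈ U
    rwa [e.left_inv (mem_extChartAt_source (f q))]
  have hind : HasFDerivAt (α.inChart (f q)) (fderiv ℝ (α.inChart (f q)) (g q)) (g q) :=
    (hin.differentiableAt (by simp)).hasFDerivAt
  have hcomp : HasFDerivAt (fun y => (α.inChart (f q) (g y)).comp (fderiv ℝ g y)) _ q :=
    (hind.comp q hgd).clm_comp hg2
  have hA := hcomp.congr_of_eventuallyEq (pullbackForm_eq_inChart α hΩ hf hq)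
  have hch : ∀ a : E, mfderiv (𝓡 3) 𝓘(ℝ, E3) e (f q) (mfderiv 𝓘(ℝ, E) (𝓡 3) f q a)
      = fderiv ℝ g q a := by
    intro a
    have h1 : mfderiv 𝓘(ℝ, E) 𝓘(ℝ, E3) (e ∘ f) q = _ :=
      mfderiv_comp q (mdifferentiableAt_extChartAt (mem_chart_source _ (f q)))
        (hfat.mdifferentiableAt (by simp))
    rw [← mfderiv_eq_fderiv]
    change _ = mfderiv 𝓘(ℝ, E) 𝓘(ℝ, E3) (e ∘ f) q a
    rw [h1]
    rfl
  rw [dFlat, hA.fderiv]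
  simp only [OneForm.d]
  have hv := hch v
  have hw := hch w
  rw [← he]
  erw [hv, hw]
  simp [hsymm v w]
  rfl

end ExteriorDerivative

/-! ### Local inverses of polar coordinates -/

section LocalInverse

variable {M : Type*} [TopologicalSpace M] [ChartedSpace E3 M] [IsManifold (𝓡 3) ∞ M]
  {E : Type*} [NormedAddCommGroup E] [NormedSpace ℝ E]

/-- A smooth map with bijective derivative has a smooth local inverse. -/
theorem exists_smooth_localInverse [CompleteSpace E] {f : E → M} {q : E}
    (hf : ContMDiffAt 𝓘(ℝ, E) (𝓡 3) ∞ f q)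
    (hbij : Function.Bijective (mfderiv 𝓘(ℝ, E) (𝓡 3) f q)) :
    ∃ ψ : M → E, ContMDiffAt (𝓡 3) 𝓘(ℝ, E) ∞ ψ (f q) ∧ ψ (f q) = q ∧
      (∀ᶠ x in 𝓝 (f q), f (ψ x) = x) ∧ ∀ᶠ y in 𝓝 q, ψ (f y) = y := by
  set e := extChartAt (𝓡 3) (f q) with he
  set g : E → E3 := fun y => e (f y) with hg
  have hgsm : ContDiffAt ℝ ∞ g q := contDiffAt_extChartAt_comp hf
  have hch : mfderiv 𝓘(ℝ, E) 𝓘(ℝ, E3) (e ∘ f) q =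
      (mfderiv (𝓡 3) 𝓘(ℝ, E3) e (f q)).comp (mfderiv 𝓘(ℝ, E) (𝓡 3) f q) :=
    mfderiv_comp q (mdifferentiableAt_extChartAt (mem_chart_source _ (f q)))
      (hf.mdifferentiableAt (by simp))
  have hgbij : Function.Bijective (fderiv ℝ g q) := by
    have h1 : Function.Bijective (mfderiv (𝓡 3) 𝓘(ℝ, E3) e (f q)) :=
      (isInvertible_mfderiv_extChartAt (mem_extChartAt_source (f q))).bijective
    have h2 : (fderiv ℝ g q : E → E3) = mfderiv 𝓘(ℝ, E) 𝓘(ℝ, E3) (e ∘ f) q := by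
      rw [mfderiv_eq_fderiv]; rfl
    rw [h2, hch]
    exact h1.comp hbij
  let L : E ≃L[ℝ] E3 := ContinuousLinearEquiv.ofBijective (fderiv ℝ g q)
    (LinearMap.ker_eq_bot.2 hgbij.1) (LinearMap.range_eq_top.2 hgbij.2)
  have hL : HasFDerivAt g (L : E →L[ℝ] E3) q := by
    have : (L : E →L[ℝ] E3) = fderiv ℝ g q := by ext v; rfl
    rw [this]
    exact (hgsm.differentiableAt (by simp)).hasFDerivAt
  set h := hgsm.localInverse hL (by simp) with hh
  have hst : HasStrictFDerivAt g (L : E →L[ℝ] E3) q := hgsm.hasStrictFDerivAt' hL (by simp)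
  have hsm : ContDiffAt ℝ ∞ h (g q) := hgsm.to_localInverse hL (by simp)
  have hq : h (g q) = q := hgsm.localInverse_apply_image hL (by simp)
  have hright : ∀ᶠ y in 𝓝 (g q), g (h y) = y := hst.eventually_right_inverse
  have hleft : ∀ᶠ y in 𝓝 q, h (g y) = y := hst.eventually_left_inverse
  have hecont : ContinuousAt e (f q) := continuousAt_extChartAt (f q)
  have hψ : ContMDiffAt (𝓡 3) 𝓘(ℝ, E) ∞ (fun x => h (e x)) (f q) :=
    (hsm.contMDiffAt).comp (f q) (contMDiffAt_extChartAt (I := 𝓡 3) (n := ∞) (x := f q))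
  refine ⟨fun x => h (e x), hψ, hq, ?_, hleft⟩
  have hcf : ContinuousAt f (h (e (f q))) := by
    have : h (e (f q)) = q := hq
    rw [this]; exact hf.continuousAt
  have h1 : ∀ᶠ x in 𝓝 (f q), f (h (e x)) ∈ e.source := by
    have : ContinuousAt (fun x => f (h (e x))) (f q) :=
      ContinuousAt.comp (g := f) (f := fun x => h (e x)) hcf hψ.continuousAt
    refine this.eventually_mem ?_
    have hq' : h (e (f q)) = q := hq
    simp only [hq']
    exact extChartAt_source_mem_nhds (f q)
  filter_upwards [h1, extChartAt_source_mem_nhds (I := 𝓡 3) (f q), hecont.eventually hright]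
    with x hx1 hx2 hx3
  exact e.injOn hx1 hx2 hx3

end LocalInverse

namespace PolarCoords

variable {M : Type*} [TopologicalSpace M] [ChartedSpace E3 M]
  {o : ManifoldOrientation M} {L : Set M} (c : PolarCoords o L)

lemma smooth' : ContMDiffOn 𝓘(ℝ, ℂ × ℝ) (𝓡 3) ∞ c.Φ (Tube c.R) := c.smooth

lemma smoothAt {q : ℂ × ℝ} (hq : q ∈ Tube c.R) : ContMDiffAt 𝓘(ℝ, ℂ × ℝ) (𝓡 3) ∞ c.Φ q :=
  c.smooth'.contMDiffAt ((isOpen_tube _).mem_nhds hq)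

lemma mdifferentiableAt {q : ℂ × ℝ} (hq : q ∈ Tube c.R) :
    MDifferentiableAt 𝓘(ℝ, ℂ × ℝ) (𝓡 3) c.Φ q :=
  (c.smoothAt hq).mdifferentiableAt (by simp)

lemma core_mem (l : ℝ) : ((0 : ℂ), l) ∈ Tube c.R := by simpa [mem_tube] using c.R_pos

lemma Φ_periodic {z : ℂ} (hz : ‖z‖ < c.R) (l : ℝ) : c.Φ (z, l + 2 * Real.pi) = c.Φ (z, l) :=
  ((c.inj (z, l) (z, l + 2 * Real.pi) hz hz).2 ⟨rfl, 1, by simp⟩).symm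

lemma bijective_mfderiv {q : ℂ × ℝ} (hq : q ∈ Tube c.R) :
    Function.Bijective (mfderiv 𝓘(ℝ, ℂ × ℝ) (𝓡 3) c.Φ q) := by
  obtain ⟨b, hb, -⟩ := c.posFrame q hq
  let T : ℂ × ℝ →L[ℝ] E3 := mfderiv 𝓘(ℝ, ℂ × ℝ) (𝓡 3) c.Φ q
  let b' : Module.Basis (Fin 3) ℝ E3 := b
  have hb' : ∀ i, b' i = T ((![((1 : ℂ), (0 : ℝ)), (Complex.I, 0), (0, 1)] : Fin 3 → ℂ × ℝ) i) := hb
  have hsurj : Function.Surjective T := by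
    intro y
    refine ⟨∑ i, b'.repr y i •
      ((![((1 : ℂ), (0 : ℝ)), (Complex.I, 0), (0, 1)] : Fin 3 → ℂ × ℝ) i), ?_⟩
    rw [map_sum]
    conv_rhs => rw [← b'.sum_repr y]
    exact Finset.sum_congr rfl fun i _ => by rw [map_smul, hb']
  have hdim : Module.finrank ℝ (ℂ × ℝ) = Module.finrank ℝ E3 := by
    simp [Complex.finrank_real_complex]
  exact ⟨(LinearMap.injective_iff_surjective_of_finrank_eq_finrank hdim
    (f := (T : ℂ × ℝ →ₗ[ℝ] E3))).2 hsurj, hsurj⟩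

variable [IsManifold (𝓡 3) ∞ M]

lemma exists_localInverse {q : ℂ × ℝ} (hq : q ∈ Tube c.R) :
    ∃ ψ : M → ℂ × ℝ, ContMDiffAt (𝓡 3) 𝓘(ℝ, ℂ × ℝ) ∞ ψ (c.Φ q) ∧ ψ (c.Φ q) = q ∧
      (∀ᶠ x in 𝓝 (c.Φ q), c.Φ (ψ x) = x) ∧ ∀ᶠ y in 𝓝 q, ψ (c.Φ y) = y :=
  exists_smooth_localInverse (c.smoothAt hq) (c.bijective_mfderiv hq)

lemma isOpen_image {Ω : Set (ℂ × ℝ)} (hΩ : IsOpen Ω) (hsub : Ω ⊆ Tube c.R) :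
    IsOpen (c.Φ '' Ω) := by
  rw [isOpen_iff_mem_nhds]
  rintro _ ⟨q, hq, rfl⟩
  obtain ⟨ψ, hψ, hψq, hr, -⟩ := c.exists_localInverse (hsub hq)
  have h1 : ∀ᶠ x in 𝓝 (c.Φ q), ψ x ∈ Ω :=
    hψ.continuousAt.eventually_mem (by rw [hψq]; exact hΩ.mem_nhds hq)
  filter_upwards [h1, hr] with x hx hx'
  exact ⟨ψ x, hx, hx'⟩

/-- A function is smooth on a coordinate neighborhood if it is so in coordinates. -/
lemma contMDiffAt_of_comp {F : Type*} [NormedAddCommGroup F] [NormedSpace ℝ F] {κ : M → F}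
    {k : ℂ × ℝ → F} {q : ℂ × ℝ} (hq : q ∈ Tube c.R) (hk : ContDiffAt ℝ ∞ k q)
    (h : ∀ y ∈ Tube c.R, κ (c.Φ y) = k y) : ContMDiffAt (𝓡 3) 𝓘(ℝ, F) ∞ κ (c.Φ q) := by
  obtain ⟨ψ, hψ, hψq, hr, -⟩ := c.exists_localInverse hq
  have h1 : ∀ᶠ x in 𝓝 (c.Φ q), ψ x ∈ Tube c.R :=
    hψ.continuousAt.eventually_mem (by rw [hψq]; exact (isOpen_tube _).mem_nhds hq)
  have h2 : ContMDiffAt (𝓡 3) 𝓘(ℝ, F) ∞ (k ∘ ψ) (c.Φ q) :=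
    ContMDiffAt.comp (c.Φ q) (by rw [hψq]; exact hk.contMDiffAt) hψ
  refine h2.congr_of_eventuallyEq ?_
  filter_upwards [h1, hr] with x hx hx'
  rw [Function.comp, ← h _ hx, hx']

/-- A vector field is smooth on a coordinate neighborhood if it is so in coordinates. -/
lemma contMDiffAt_field {V : VField M} {X : ℂ × ℝ → ℂ × ℝ} {q : ℂ × ℝ} (hq : q ∈ Tube c.R)
    (hX : ContDiffOn ℝ ∞ X (Tube c.R))
    (h : ∀ y ∈ Tube c.R, V (c.Φ y) = mfderiv 𝓘(ℝ, ℂ × ℝ) (𝓡 3) c.Φ y (X y)) :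
    ContMDiffAt (𝓡 3) (𝓡 3).tangent ∞ (fun x => (⟨x, V x⟩ : TangentBundle (𝓡 3) M)) (c.Φ q) := by
  obtain ⟨ψ, hψ, hψq, hr, -⟩ := c.exists_localInverse hq
  have h1 : ∀ᶠ x in 𝓝 (c.Φ q), ψ x ∈ Tube c.R :=
    hψ.continuousAt.eventually_mem (by rw [hψq]; exact (isOpen_tube _).mem_nhds hq)
  have h3 := (contMDiffOn_mfderiv_apply (isOpen_tube c.R) c.smooth' hX).contMDiffAt
    ((isOpen_tube _).mem_nhds hq)
  rw [← hψq] at h3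
  refine (ContMDiffAt.comp (c.Φ q) h3 hψ).congr_of_eventuallyEq ?_
  filter_upwards [h1, hr] with x hx hx'
  simp only [Function.comp]
  rw [← h _ hx, hx']

end PolarCoords

/-! ### Changes of polar coordinates -/

section Frames

/-- The standard basis of `ℂ × ℝ`. -/
def stdBasis : Module.Basis (Fin 3) ℝ (ℂ × ℝ) :=
  .ofEquivFun
    { toFun := fun v => ![v.1.re, v.1.im, v.2]
      map_add' := fun v w => by ext i; fin_cases i <;> simp
      map_smul' := fun a v => by ext i; fin_cases i <;> simp
      invFun := fun a => (⟨a 0, a 1⟩, a 2)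
      left_inv := fun v => rfl
      right_inv := fun a => by ext i; fin_cases i <;> rfl }

lemma stdBasis_repr (v : ℂ × ℝ) (i : Fin 3) : stdBasis.repr v i = ![v.1.re, v.1.im, v.2] i := rfl

/-- The vectors of the standard basis, in the form in which they enter `PolarCoords`. -/
abbrev stdVec : Fin 3 → ℂ × ℝ := ![((1 : ℂ), (0 : ℝ)), (Complex.I, 0), (0, 1)]

lemma stdBasis_apply (i : Fin 3) : stdBasis i = stdVec i := by
  refine Module.Basis.apply_eq_iff.2 ?_
  ext j
  rw [stdBasis_repr]
  fin_cases i <;> fin_cases j <;> simp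

lemma stdBasis_det (v : Fin 3 → ℂ × ℝ) : stdBasis.det v =
    (v 0).1.re * ((v 1).1.im * (v 2).2 - (v 2).1.im * (v 1).2)
    - (v 1).1.re * ((v 0).1.im * (v 2).2 - (v 2).1.im * (v 0).2)
    + (v 2).1.re * ((v 0).1.im * (v 1).2 - (v 1).1.im * (v 0).2) := by
  rw [Module.Basis.det_apply, Matrix.det_fin_three]
  simp only [Module.Basis.toMatrix_apply, stdBasis_repr]
  simp
  ring

variable {M : Type*} [TopologicalSpace M] [ChartedSpace E3 M] {o : ManifoldOrientation M}

/-- `T` carries the standard basis to a positive basis, and determinants taken in a basis are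
unchanged when basis and vectors are moved by the same isomorphism. -/
lemma isPosFrame_map_iff {x : M} {T : ℂ × ℝ →L[ℝ] TangentSpace (𝓡 3) x}
    (hT : o.IsPosFrame x (fun i => T (stdVec i))) (v : Fin 3 → ℂ × ℝ) :
    o.IsPosFrame x (fun i => T (v i)) ↔ 0 < stdBasis.det v := by
  obtain ⟨b, hb, hbo⟩ := hT
  let Te : (ℂ × ℝ) ≃ₗ[ℝ] TangentSpace (𝓡 3) x := stdBasis.equiv b (Equiv.refl _)
  have hTe : ∀ v, Te v = T v := by
    intro v
    have : (Te : ℂ × ℝ →ₗ[ℝ] TangentSpace (𝓡 3) x) = (T : ℂ × ℝ →ₗ[ℝ] TangentSpace (𝓡 3) x) := by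
      refine stdBasis.ext fun i => ?_
      have h1 : Te (stdBasis i) = b i := by simp [Te]
      rw [LinearEquiv.coe_coe, h1, hb, stdBasis_apply]
      rfl
    exact LinearMap.congr_fun this v
  have hbm : stdBasis.map Te = b := by
    ext1 i
    simp [Te]
  have hdet : ∀ v : Fin 3 → ℂ × ℝ, b.det (fun i => T (v i)) = stdBasis.det v := by
    intro v
    rw [← hbm, Module.Basis.det_map]
    congr 1
    funext i
    simp [← hTe]
  constructor
  · rintro ⟨b', hb', hbo'⟩
    have h1 := (b.orientation_eq_iff_det_pos b').1 (hbo.trans hbo'.symm)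
    have h2 : (b' : Fin 3 → TangentSpace (𝓡 3) x) = fun i => T (v i) := funext hb'
    rwa [h2, hdet] at h1
  · intro hpos
    have hunit : IsUnit (b.det (fun i => T (v i))) := by
      rw [hdet]; exact hpos.ne'.isUnit
    obtain ⟨hli, hsp⟩ := (Module.Basis.is_basis_iff_det b).2 hunit
    refine ⟨Module.Basis.mk hli hsp.ge, fun i => Module.Basis.mk_apply hli hsp.ge i, ?_⟩
    rw [← hbo, eq_comm, b.orientation_eq_iff_det_pos, Module.Basis.coe_mk, hdet]
    exact hpos

end Frames

/-- A change of coordinates `(z, λ) ↦ (g z, S)` from the solid torus of radius `R'` to the one of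
radius `R`, which preserves the core pointwise and the angular coordinate. -/
structure Reparam (R R' : ℝ) where
  /-- the radial factor -/
  g : ℂ × ℝ → ℝ
  /-- the new longitude -/
  S : ℂ × ℝ → ℝ
  R'_pos : 0 < R'
  g_smooth : ContDiffOn ℝ ∞ g (Tube R')
  S_smooth : ContDiffOn ℝ ∞ S (Tube R')
  g_pos : ∀ q ∈ Tube R', 0 < g q
  maps : ∀ q ∈ Tube R', ((g q : ℂ) * q.1, S q) ∈ Tube R
  g_per : ∀ q ∈ Tube R', g (q.1, q.2 + 2 * Real.pi) = g q
  S_per : ∀ q ∈ Tube R', S (q.1, q.2 + 2 * Real.pi) = S q + 2 * Real.pi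
  S_core : ∀ l, S (0, l) = l
  inj : ∀ q ∈ Tube R', ∀ q' ∈ Tube R',
    (g q : ℂ) * q.1 = (g q' : ℂ) * q'.1 → S q = S q' → q = q'
  det_pos : ∀ q ∈ Tube R', 0 < stdBasis.det
    (fun i => fderiv ℝ (fun q : ℂ × ℝ => ((g q : ℂ) * q.1, S q)) q (stdVec i))

namespace Reparam

variable {R R' : ℝ} (ρ : Reparam R R')

/-- The underlying map. -/
def map (q : ℂ × ℝ) : ℂ × ℝ := ((ρ.g q : ℂ) * q.1, ρ.S q)

lemma map_smooth : ContDiffOn ℝ ∞ ρ.map (Tube R') :=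
  ((Complex.ofRealCLM.contDiff.comp_contDiffOn ρ.g_smooth).mul contDiffOn_fst).prodMk ρ.S_smooth

lemma map_differentiableAt {q : ℂ × ℝ} (hq : q ∈ Tube R') : DifferentiableAt ℝ ρ.map q :=
  (ρ.map_smooth.contDiffAt ((isOpen_tube R').mem_nhds hq)).differentiableAt (by simp)

lemma map_core (l : ℝ) : ρ.map (0, l) = (0, l) := by simp [map, ρ.S_core]

/-- The change of coordinates commutes with the deck transformations, so its injectivity on the
cover gives the identification modulo `2π` required of polar coordinates. -/
lemma map_add_int {q : ℂ × ℝ} (hq : q ∈ Tube R') (n : ℤ) :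
    ρ.map (q.1, q.2 + n * (2 * Real.pi)) = ((ρ.map q).1, (ρ.map q).2 + n * (2 * Real.pi)) := by
  have hstep : ∀ q ∈ Tube R', ρ.map (q.1, q.2 + 2 * Real.pi)
      = ((ρ.map q).1, (ρ.map q).2 + 2 * Real.pi) := by
    intro q hq
    simp [map, ρ.g_per q hq, ρ.S_per q hq]
  induction n with
  | zero => simp
  | succ n ih =>
    have h1 := hstep (q.1, q.2 + (n : ℤ) * (2 * Real.pi)) hq
    rw [ih] at h1
    simp only at h1
    have e : q.2 + (((n : ℤ) + 1 : ℤ) : ℝ) * (2 * Real.pi)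
        = q.2 + ((n : ℤ) : ℝ) * (2 * Real.pi) + 2 * Real.pi := by push_cast; ring
    rw [e, h1]
    refine Prod.ext rfl ?_
    push_cast
    ring
  | pred n ih =>
    have h1 := hstep (q.1, q.2 + ((-n - 1 : ℤ) : ℝ) * (2 * Real.pi)) hq
    have e : q.2 + ((-n - 1 : ℤ) : ℝ) * (2 * Real.pi) + 2 * Real.pi
        = q.2 + ((-n : ℤ) : ℝ) * (2 * Real.pi) := by push_cast; ring
    simp only [e] at h1
    rw [ih] at h1
    have h2 := congrArg Prod.fst h1
    have h3 := congrArg Prod.snd h1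
    simp only at h2 h3
    refine Prod.ext h2.symm ?_
    push_cast at h3 ⊢
    linarith

end Reparam

namespace PolarCoords

variable {M : Type*} [TopologicalSpace M] [ChartedSpace E3 M]
  {o : ManifoldOrientation M} {L : Set M} (c : PolarCoords o L) {R' : ℝ} (ρ : Reparam c.R R')

lemma mfderiv_comp_reparam {q : ℂ × ℝ} (hq : q ∈ Tube R') :
    mfderiv 𝓘(ℝ, ℂ × ℝ) (𝓡 3) (fun y => c.Φ (ρ.map y)) q =
      (mfderiv 𝓘(ℝ, ℂ × ℝ) (𝓡 3) c.Φ (ρ.map q)).comp (fderiv ℝ ρ.map q) := by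
  have h1 := mfderiv_comp q (c.mdifferentiableAt (ρ.maps q hq))
    (ρ.map_differentiableAt hq).mdifferentiableAt
  rw [mfderiv_eq_fderiv] at h1
  exact h1

/-- New polar coordinates from old ones by a change of coordinates. -/
def reparam : PolarCoords o L where
  R := R'
  R_pos := ρ.R'_pos
  Φ := fun q => c.Φ (ρ.map q)
  smooth := c.smooth'.comp ρ.map_smooth.contMDiffOn ρ.maps
  inj := by
    intro q q' hq hq'
    rw [c.inj (ρ.map q) (ρ.map q') (ρ.maps q hq) (ρ.maps q' hq')]
    constructor
    · rintro ⟨h1, n, h2⟩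
      have h3 := ρ.map_add_int hq n
      have h4 : (q.1, q.2 + n * (2 * Real.pi)) = q' := by
        refine ρ.inj (q.1, q.2 + n * (2 * Real.pi)) hq q' hq' ?_ ?_
        · exact (congrArg Prod.fst h3).trans h1
        · exact (congrArg Prod.snd h3).trans h2.symm
      exact ⟨(Prod.ext_iff.1 h4).1, n, (Prod.ext_iff.1 h4).2.symm⟩
    · rintro ⟨h1, n, h2⟩
      have h3 := ρ.map_add_int hq n
      have h4 : q' = (q.1, q.2 + n * (2 * Real.pi)) := Prod.ext h1.symm h2
      rw [h4, h3]
      exact ⟨rfl, n, rfl⟩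
  posFrame := by
    intro q hq
    rw [c.mfderiv_comp_reparam ρ hq]
    exact (isPosFrame_map_iff (T := mfderiv 𝓘(ℝ, ℂ × ℝ) (𝓡 3) c.Φ (ρ.map q))
      (c.posFrame _ (ρ.maps q hq)) _).2 (ρ.det_pos q hq)
  mem_link := by
    intro q hq
    rw [c.mem_link (ρ.map q) (ρ.maps q hq)]
    have : (ρ.g q : ℂ) ≠ 0 := Complex.ofReal_ne_zero.2 (ρ.g_pos q hq).ne'
    simp [Reparam.map, this]

lemma reparam_isAround {x : M} (h : c.IsAround x) : (c.reparam ρ).IsAround x := by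
  obtain ⟨l, rfl⟩ := h
  refine ⟨l, ?_⟩
  change c.Φ (ρ.map (0, l)) = _
  rw [ρ.map_core]

/-- A positive real factor does not change the argument of `z`, and `p = μ` ignores the longitude.
-/
lemma reparam_fibrationIs {p : M → Circle} (h : c.FibrationIs p 1 0) :
    (c.reparam ρ).FibrationIs p 1 0 := by
  intro r m l hr hrR
  have hq : (((r : ℂ) * Complex.exp (m * Complex.I), l) : ℂ × ℝ) ∈ Tube R' := by
    rw [mem_tube, norm_mul, Complex.norm_exp_ofReal_mul_I, mul_one, Complex.norm_real,
      Real.norm_of_nonneg hr.le]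
    exact hrR
  set q : ℂ × ℝ := ((r : ℂ) * Complex.exp (m * Complex.I), l) with hqdef
  have hg := ρ.g_pos q hq
  have hm := ρ.maps q hq
  have e : ρ.map q = (((ρ.g q * r : ℝ) : ℂ) * Complex.exp (m * Complex.I), ρ.S q) := by
    simp [Reparam.map, hqdef, mul_assoc]
  have hlt : ρ.g q * r < c.R := by
    have h1 : ‖(ρ.map q).1‖ < c.R := hm
    rw [e] at h1
    rw [norm_mul, Complex.norm_exp_ofReal_mul_I, mul_one, Complex.norm_real,
      Real.norm_of_nonneg (mul_pos hg hr).le] at h1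
    exact h1
  have := h (ρ.g q * r) m (ρ.S q) (mul_pos hg hr) hlt
  change p (c.Φ (ρ.map q)) = _
  rw [e, this]
  simp

lemma pullbackForm_reparam (α : OneForm M) {q : ℂ × ℝ} (hq : q ∈ Tube R') (v : ℂ × ℝ) :
    pullbackForm (c.reparam ρ).Φ α q v =
      pullbackForm c.Φ α (ρ.map q) (fderiv ℝ ρ.map q v) := by
  rw [pullbackForm_apply]
  have := c.mfderiv_comp_reparam ρ hq
  change α (c.Φ (ρ.map q)) (mfderiv 𝓘(ℝ, ℂ × ℝ) (𝓡 3) (fun y => c.Φ (ρ.map y)) q v) = _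
  rw [this]
  rfl

end PolarCoords

/-! ### Polar coordinates adapted to a contact structure -/

section Periodic

variable {F : Type*} [NormedAddCommGroup F] [NormedSpace ℝ F]

/-- The constant `a` covers both periodic functions and longitudes, which grow by `2π` in one
period. -/
lemma fderiv_add_period {f : ℂ × ℝ → F} {R : ℝ} {a : F}
    (h : ∀ q ∈ Tube R, f (q.1, q.2 + 2 * Real.pi) = f q + a) {z : ℂ} (hz : ‖z‖ < R) (l : ℝ) :
    fderiv ℝ f (z, l + 2 * Real.pi) = fderiv ℝ f (z, l) := by
  have h1 : (fun q : ℂ × ℝ => f (q + ((0 : ℂ), 2 * Real.pi))) =ᶠ[𝓝 (z, l)] fun q => f q + a := by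
    filter_upwards [(isOpen_tube R).mem_nhds (show (z, l) ∈ Tube R from hz)] with q hq
    have := h q hq
    simpa [Prod.add_def] using this
  have h2 := fderiv_comp_add_right (𝕜 := ℝ) (f := f) (x := (z, l)) ((0 : ℂ), 2 * Real.pi)
  rw [h1.fderiv_eq, fderiv_add_const] at h2
  rw [h2]
  simp

end Periodic

/-! ### The contact condition on a vector space -/

section Wedge

variable {E : Type*} [NormedAddCommGroup E] [NormedSpace ℝ E]

/-- The value of `A ∧ dA` on a triple of vectors. -/
def wedgeFlat (A : E → E →L[ℝ] ℝ) (q : E) (v : Fin 3 → E) : ℝ :=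
  A q (v 0) * dFlat A q (v 1) (v 2) - A q (v 1) * dFlat A q (v 0) (v 2)
    + A q (v 2) * dFlat A q (v 0) (v 1)

/-- The terms with `dh` combine to `h A ∧ dh ∧ A = 0`. Thus rescaling by a nonvanishing function
leaves the sign of `A ∧ dA` unchanged. -/
lemma wedgeFlat_smul {h : E → ℝ} {A : E → E →L[ℝ] ℝ} {q : E} (hh : DifferentiableAt ℝ h q)
    (hA : DifferentiableAt ℝ A q) (v : Fin 3 → E) :
    wedgeFlat (fun y => h y • A y) q v = h q ^ 2 * wedgeFlat A q v := by
  have hd : ∀ a b, dFlat (fun y => h y • A y) q a b =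
      fderiv ℝ h q a * A q b - fderiv ℝ h q b * A q a + h q * dFlat A q a b := by
    intro a b
    simp only [dFlat, fderiv_fun_smul hh hA]
    simp
    ring
  simp only [wedgeFlat, hd]
  simp
  ring

lemma dFlat_congr {A B : E → E →L[ℝ] ℝ} {q : E} (h : A =ᶠ[𝓝 q] B) : dFlat A q = dFlat B q := by
  funext v w
  simp only [dFlat, h.fderiv_eq]

end Wedge

namespace PolarCoords

variable {M : Type*} [TopologicalSpace M] [ChartedSpace E3 M]
  {o : ManifoldOrientation M} {L : Set M} (c : PolarCoords o L)

lemma pullbackForm_periodic (α : OneForm M) {z : ℂ} (hz : ‖z‖ < c.R) (l : ℝ) :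
    pullbackForm c.Φ α (z, l + 2 * Real.pi) = pullbackForm c.Φ α (z, l) := by
  have hz' : ((z, l + 2 * Real.pi) : ℂ × ℝ) ∈ Tube c.R := hz
  have h1 : c.Φ =ᶠ[𝓝 (z, l)] fun q => c.Φ (q + ((0 : ℂ), 2 * Real.pi)) := by
    filter_upwards [(isOpen_tube c.R).mem_nhds (show (z, l) ∈ Tube c.R from hz)] with q hq
    have := c.Φ_periodic hq q.2
    simpa [Prod.add_def] using this.symm
  have e : ((z, l) : ℂ × ℝ) + ((0 : ℂ), 2 * Real.pi) = (z, l + 2 * Real.pi) := by simp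
  have hd : HasFDerivAt (fun q : ℂ × ℝ => q + ((0 : ℂ), 2 * Real.pi)) (.id ℝ (ℂ × ℝ)) (z, l) :=
    (hasFDerivAt_id _).add_const _
  have hΦ : MDifferentiableAt 𝓘(ℝ, ℂ × ℝ) (𝓡 3) c.Φ ((z, l) + ((0 : ℂ), 2 * Real.pi)) := by
    rw [e]; exact c.mdifferentiableAt hz'
  have h2 := (hΦ.hasMFDerivAt.comp (z, l) hd.hasMFDerivAt).congr_of_eventuallyEq h1
  have h3 := h2.mfderiv
  have hα : ∀ {x x' : M} (h : x = x') (w : E3), α x w = α x' w := by rintro x _ rfl w; rfl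
  refine ContinuousLinearMap.ext fun v => ?_
  rw [pullbackForm_apply, pullbackForm_apply, h3]
  have h4 : ∀ {q q' : ℂ × ℝ} (h : q = q') (v : ℂ × ℝ), (mfderiv 𝓘(ℝ, ℂ × ℝ) (𝓡 3) c.Φ q v : E3)
      = mfderiv 𝓘(ℝ, ℂ × ℝ) (𝓡 3) c.Φ q' v := by rintro q _ rfl v; rfl
  refine (hα (c.Φ_periodic hz l) _).trans ?_
  exact congrArg (fun w : E3 => α (c.Φ (z, l)) w) (h4 e.symm v)

variable [IsManifold (𝓡 3) ∞ M]

lemma contDiffOn_pullback {α : OneForm M} (hα : α.IsSmoothOn univ) :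
    ContDiffOn ℝ ∞ (pullbackForm c.Φ α) (Tube c.R) :=
  contDiffOn_pullbackForm (isOpen_tube _) c.smooth' hα (mapsTo_univ _ _)

/-- Positivity of a contact structure in polar coordinates. -/
theorem wedgeFlat_pos (ξ : ContactStructure o) {B : ℂ × ℝ → ℂ × ℝ →L[ℝ] ℝ} {q : ℂ × ℝ}
    (hq : q ∈ Tube c.R) (hB : DifferentiableAt ℝ B q)
    (hker : ∀ᶠ y in 𝓝 q, ∀ v,
      B y v = 0 ↔ (mfderiv 𝓘(ℝ, ℂ × ℝ) (𝓡 3) c.Φ y v) ∈ ξ.plane (c.Φ y))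
    (hone : ∀ᶠ y in 𝓝 q, B y (0, 1) = 1) : 0 < wedgeFlat B q stdVec := by
  obtain ⟨U, hU, hqU, α, hα, hαU⟩ := ξ.contact (c.Φ q)
  have hcont : ContinuousOn c.Φ (Tube c.R) := c.smooth'.continuousOn
  set Ω := Tube c.R ∩ c.Φ ⁻¹' U with hΩ
  have hΩo : IsOpen Ω := hcont.isOpen_inter_preimage (isOpen_tube _) hU
  have hqΩ : q ∈ Ω := ⟨hq, hqU⟩
  have hsm : ContMDiffOn 𝓘(ℝ, ℂ × ℝ) (𝓡 3) ∞ c.Φ Ω := c.smooth'.mono inter_subset_left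
  have hA : ContDiffOn ℝ ∞ (pullbackForm c.Φ α) Ω :=
    contDiffOn_pullbackForm hΩo hsm hα (fun y hy => hy.2)
  have hAd : DifferentiableAt ℝ (pullbackForm c.Φ α) q :=
    (hA.contDiffAt (hΩo.mem_nhds hqΩ)).differentiableAt (by simp)
  -- `B` and the pull-back of `α` have the same kernel and `B(∂_λ) = 1`, so the pull-back is `h B`
  -- with `h` its value on `∂_λ`.
  set h : ℂ × ℝ → ℝ := fun y => pullbackForm c.Φ α y (0, 1) with hh
  have hhd : DifferentiableAt ℝ h q := hAd.clm_apply (differentiableAt_const _)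
  have heq : pullbackForm c.Φ α =ᶠ[𝓝 q] fun y => h y • B y := by
    filter_upwards [hΩo.mem_nhds hqΩ, hker, hone] with y hyΩ hy hy1
    refine ContinuousLinearMap.ext fun v => ?_
    have h1 : B y (v - B y v • ((0 : ℂ), (1 : ℝ))) = 0 := by
      rw [map_sub, map_smul, hy1]; simp
    have h2 := (hy _).1 h1
    rw [(hαU _ hyΩ.2).1] at h2
    have h3 : pullbackForm c.Φ α y (v - B y v • ((0 : ℂ), (1 : ℝ))) = 0 := h2
    rw [map_sub, map_smul, sub_eq_zero] at h3
    rw [h3]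
    simp [hh, mul_comm]
  have hpos := (hαU _ hqU).2 _ (c.posFrame q hq)
  have hw : α.wedgeD (c.Φ q) (fun i => mfderiv 𝓘(ℝ, ℂ × ℝ) (𝓡 3) c.Φ q (stdVec i))
      = wedgeFlat (pullbackForm c.Φ α) q stdVec := by
    have hd := fun v w => dFlat_pullbackForm hU hα hΩo hsm hqΩ hqU v w
    simp only [wedgeFlat, OneForm.wedgeD, hd, pullbackForm_apply]
  have hpos' : 0 < wedgeFlat (pullbackForm c.Φ α) q stdVec := hw ▸ hpos
  have hs : wedgeFlat (pullbackForm c.Φ α) q stdVec = h q ^ 2 * wedgeFlat B q stdVec := by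
    rw [← wedgeFlat_smul hhd hB]
    simp only [wedgeFlat, dFlat_congr heq, heq.eq_of_nhds]
  rw [hs] at hpos'
  exact pos_of_mul_pos_right hpos' (sq_nonneg _)

end PolarCoords

namespace PolarCoords

variable {M : Type*} [TopologicalSpace M] [ChartedSpace E3 M]
  {o : ManifoldOrientation M} {L : Set M} (c : PolarCoords o L)

/-- The `1`-form `a` such that the pull-back of `α` is proportional to `dλ + a`. -/
def normalizedForm (α : OneForm M) (q : ℂ × ℝ) : ℂ →L[ℝ] ℝ :=
  (pullbackForm c.Φ α q (0, 1))⁻¹ • (pullbackForm c.Φ α q).comp (.inl ℝ ℂ ℝ)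

lemma pullbackForm_eq_normalizedForm (α : OneForm M) {q : ℂ × ℝ}
    (h0 : pullbackForm c.Φ α q (0, 1) ≠ 0) (v : ℂ × ℝ) :
    pullbackForm c.Φ α q v = pullbackForm c.Φ α q (0, 1) * (v.2 + c.normalizedForm α q v.1) := by
  have h1 : v = ContinuousLinearMap.inl ℝ ℂ ℝ v.1 + v.2 • ((0 : ℂ), (1 : ℝ)) := by ext <;> simp
  conv_lhs => rw [h1, map_add, map_smul]
  simp only [normalizedForm, smul_apply, ContinuousLinearMap.comp_apply, smul_eq_mul]
  field_simp
  ring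

lemma normalizedForm_periodic (α : OneForm M) {z : ℂ} (hz : ‖z‖ < c.R) (l : ℝ) :
    c.normalizedForm α (z, l + 2 * Real.pi) = c.normalizedForm α (z, l) := by
  simp only [normalizedForm, c.pullbackForm_periodic α hz l]

variable [IsManifold (𝓡 3) ∞ M]

lemma contDiffOn_normalizedForm {α : OneForm M} (hα : α.IsSmoothOn univ) {R : ℝ} (hR : R ≤ c.R)
    (h0 : ∀ q ∈ Tube R, pullbackForm c.Φ α q (0, 1) ≠ 0) :
    ContDiffOn ℝ ∞ (c.normalizedForm α) (Tube R) := by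
  have hA := (c.contDiffOn_pullback hα).mono (tube_mono hR)
  exact ((hA.clm_apply contDiffOn_const).inv h0).smul (hA.clm_comp contDiffOn_const)

/-- Polar coordinates near a transverse core can be changed so that the rays become tangent to the
kernel of the form. -/
theorem exists_reparam_radial {α : OneForm M} (hα : α.IsSmoothOn univ)
    (hcore : ∀ l, 0 < pullbackForm c.Φ α (0, l) (0, 1)) :
    ∃ (R' : ℝ) (ρ : Reparam c.R R'), ∀ q ∈ Tube R',
      0 < pullbackForm (c.reparam ρ).Φ α q (0, 1) ∧
        pullbackForm (c.reparam ρ).Φ α q (q.1, 0) = 0 := by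
  have hA := c.contDiffOn_pullback hα
  obtain ⟨ε₁, hε₁, h₁⟩ := exists_tube_of_eventually
    (P := fun q => q ∈ Tube c.R ∧ 0 < pullbackForm c.Φ α q (0, 1))
    (fun z l => and_congr_right fun hz => by rw [c.pullbackForm_periodic α hz l])
    (fun l => by
      have hm := (isOpen_tube c.R).mem_nhds (c.core_mem l)
      have hc : ContinuousAt (fun q => pullbackForm c.Φ α q (0, 1)) (0, l) :=
        ((hA.contDiffAt hm).continuousAt).clm_apply continuousAt_const
      exact (Filter.eventually_mem_set.2 hm).and (hc.eventually (lt_mem_nhds (hcore l))))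
  -- A larger `ε₁` would put a point of radius exactly `c.R` into the open tube of radius `c.R`.
  have hε₁R : ε₁ ≤ c.R := by
    by_contra hlt
    rw [not_le] at hlt
    have := (h₁ ((c.R : ℂ), 0) (by
      simpa [mem_tube, Complex.norm_real, abs_of_pos c.R_pos] using hlt)).1
    simp [mem_tube, abs_of_pos c.R_pos] at this
  obtain ⟨a, ha, haper, haeq, -, C, haC⟩ := exists_periodic_extension hε₁
    (c.contDiffOn_normalizedForm hα hε₁R (fun q hq => (h₁ q hq).2.ne'))
    (fun z l hz => c.normalizedForm_periodic α (hz.trans_le hε₁R) l)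
  obtain ⟨ε₂, hε₂, S, hS, hSper, hScore, hSrad⟩ := exists_ray_integral ha haper haC
  have hSd : ∀ q ∈ Tube ε₂, ContDiffAt ℝ ∞ S q := fun q hq =>
    hS.contDiffAt ((isOpen_tube _).mem_nhds hq)
  obtain ⟨ε₃, hε₃, h₃⟩ := exists_tube_of_eventually
    (P := fun q => q ∈ Tube (min ε₂ (ε₁ / 2)) ∧ 0 < fderiv ℝ S q (0, 1))
    (fun z l => and_congr_right fun hz => by
      rw [fderiv_add_period hSper (lt_of_lt_of_le hz (min_le_left _ _)) l])
    (fun l => by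
      have h0 : ((0 : ℂ), l) ∈ Tube (min ε₂ (ε₁ / 2)) := by
        simp [mem_tube, hε₂, hε₁]
      have h0' : ((0 : ℂ), l) ∈ Tube ε₂ := tube_mono (min_le_left _ _) h0
      have hc : ContinuousAt (fun q => fderiv ℝ S q (0, 1)) (0, l) :=
        (((hSd _ h0').fderiv_right (m := ∞) (by simp)).continuousAt).clm_apply continuousAt_const
      -- On the core the new longitude is the old one, so `∂_λ S = 1` there and `∂_λ S > 0` nearby.
      have h1 : fderiv ℝ S (0, l) (0, 1) = 1 := by
        have hd1 : HasDerivAt (fun t : ℝ => S (0, t)) (fderiv ℝ S (0, l) (0, 1)) l :=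
          ((hSd _ h0').differentiableAt (by simp)).hasFDerivAt.comp_hasDerivAt l
            ((hasDerivAt_const l (0 : ℂ)).prodMk (hasDerivAt_id l))
        have hd2 : HasDerivAt (fun t : ℝ => S (0, t)) 1 l := by
          simp only [hScore]
          exact hasDerivAt_id l
        exact hd1.unique hd2
      refine (Filter.eventually_mem_set.2 ((isOpen_tube _).mem_nhds h0)).and
        (hc.eventually (lt_mem_nhds ?_))
      simp only [h1, zero_lt_one])
  have hmem₂ : ∀ q ∈ Tube ε₃, q ∈ Tube ε₂ := fun q hq =>
    tube_mono (min_le_left _ _) (h₃ q hq).1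
  have hmem₁ : ∀ q ∈ Tube ε₃, q ∈ Tube (ε₁ / 2) := fun q hq =>
    tube_mono (min_le_right _ _) (h₃ q hq).1
  have hfd : ∀ q ∈ Tube ε₃, ∀ v : ℂ × ℝ,
      fderiv ℝ (fun q : ℂ × ℝ => (((1 : ℝ) : ℂ) * q.1, S q)) q v = (v.1, fderiv ℝ S q v) := by
    intro q hq v
    have h1 : HasFDerivAt (fun q : ℂ × ℝ => (((1 : ℝ) : ℂ) * q.1, S q))
        ((ContinuousLinearMap.fst ℝ ℂ ℝ).prod (fderiv ℝ S q)) q := by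
      simp only [Complex.ofReal_one, one_mul]
      exact hasFDerivAt_fst.prodMk ((hSd q (hmem₂ q hq)).differentiableAt (by simp)).hasFDerivAt
    rw [h1.fderiv]
    rfl
  let ρ : Reparam c.R ε₃ :=
    { g := fun _ => 1
      S := S
      R'_pos := hε₃
      g_smooth := contDiffOn_const
      S_smooth := hS.mono hmem₂
      g_pos := fun _ _ => one_pos
      maps := fun q hq => by
        have : q ∈ Tube c.R := tube_mono (by linarith) (hmem₁ q hq)
        simpa [mem_tube] using this
      g_per := fun _ _ => rfl
      S_per := fun q hq => hSper q (hmem₂ q hq)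
      S_core := hScore
      inj := by
        rintro ⟨z, l⟩ hq ⟨z', l'⟩ hq' h1 h2
        have hz : z = z' := by simpa using h1
        subst hz
        -- For fixed `z`, `S` is strictly increasing along the whole line of longitudes, so it
        -- separates points.
        have hmono : StrictMono (fun t : ℝ => S (z, t)) := by
          refine strictMono_of_hasDerivAt_pos (f' := fun t => fderiv ℝ S (z, t) (0, 1))
            (fun t => ?_) (fun t => (h₃ (z, t) hq).2)
          exact ((hSd _ (hmem₂ (z, t) hq)).differentiableAt (by simp)).hasFDerivAt.comp_hasDerivAt t
            ((hasDerivAt_const t z).prodMk (hasDerivAt_id t))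
        rw [hmono.injective h2]
      det_pos := fun q hq => by
        rw [stdBasis_det]
        simp only [hfd q hq]
        simpa using (h₃ q hq).2 }
  refine ⟨ε₃, ρ, fun q hq => ?_⟩
  have hmapeq : ρ.map q = (q.1, S q) := by simp [Reparam.map, ρ]
  have hm1 : ((q.1, S q) : ℂ × ℝ) ∈ Tube (ε₁ / 2) := hmem₁ q hq
  have hpos : 0 < pullbackForm c.Φ α (q.1, S q) (0, 1) :=
    (h₁ _ (tube_mono (by linarith) hm1)).2
  have key : ∀ v : ℂ × ℝ, pullbackForm (c.reparam ρ).Φ α q v =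
      pullbackForm c.Φ α (q.1, S q) (0, 1) * (fderiv ℝ S q v + a (q.1, S q) v.1) := by
    intro v
    have hfd' : fderiv ℝ ρ.map q v = (v.1, fderiv ℝ S q v) := hfd q hq v
    rw [c.pullbackForm_reparam ρ α hq, hmapeq, c.pullbackForm_eq_normalizedForm α hpos.ne', hfd',
      haeq _ hm1]
  refine ⟨?_, ?_⟩
  · rw [key]
    simpa using mul_pos hpos (h₃ q hq).2
  -- By construction `dS(z, 0) = -a(z, S) z`, so the two terms cancel and the rays lie in the
  -- kernel.
  · rw [key, hSrad q (hmem₂ q hq)]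
    simp

/-- If the rays are tangent to a contact structure, it can be brought into the normal form
`ker (dλ + r² dμ)` by rescaling the radial coordinate. -/
theorem exists_reparam_standard (ξ : ContactStructure o) {α : OneForm M} (hα : α.IsSmoothOn univ)
    (hker : ∀ x, ξ.plane x = LinearMap.ker (α x : TangentSpace (𝓡 3) x →ₗ[ℝ] ℝ))
    (hpos : ∀ q ∈ Tube c.R, 0 < pullbackForm c.Φ α q (0, 1))
    (hrad : ∀ q ∈ Tube c.R, pullbackForm c.Φ α q (q.1, 0) = 0) :
    ∃ (R' : ℝ) (ρ : Reparam c.R R'), ∀ q ∈ Tube R',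
      0 < pullbackForm (c.reparam ρ).Φ α q (0, 1) ∧
        pullbackForm (c.reparam ρ).Φ α q =
          pullbackForm (c.reparam ρ).Φ α q (0, 1) • stdForm q := by
  have hnf := c.contDiffOn_normalizedForm hα le_rfl (fun q hq => (hpos q hq).ne')
  obtain ⟨b, hb, hbper, hbeq, -, -⟩ := exists_periodic_extension c.R_pos hnf
    (fun z l hz => c.normalizedForm_periodic α hz l)
  have hhalf : ∀ q ∈ Tube (c.R / 2), q ∈ Tube c.R := fun q hq =>
    tube_mono (by linarith [c.R_pos]) hq
  have hbrad : ∀ q ∈ Tube (c.R / 2), b q q.1 = 0 := by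
    intro q hq
    have h1 := hrad q (hhalf q hq)
    rw [c.pullbackForm_eq_normalizedForm α (hpos q (hhalf q hq)).ne', ← hbeq q hq] at h1
    simpa using (mul_eq_zero.1 h1).resolve_left (hpos q (hhalf q hq)).ne'
  obtain ⟨G, hG, hGper, hGb⟩ := exists_eq_mul_angular hb hbper hbrad
  have hAG : ∀ q ∈ Tube (c.R / 2), ∀ v, pullbackForm c.Φ α q v =
      pullbackForm c.Φ α q (0, 1) * (v.2 + G q * (conj q.1 * v.1).im) := by
    intro q hq v
    rw [c.pullbackForm_eq_normalizedForm α (hpos q (hhalf q hq)).ne', ← hbeq q hq, hGb q hq]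
  -- For `B = dλ + G (x dy - y dx)`, the value of `B ∧ dB` on the standard frame at the core is `2
  -- G`; the contact condition makes it positive.
  have hGcore : ∀ l, 0 < G (0, l) := by
    intro l
    have h0 : ((0 : ℂ), l) ∈ Tube (c.R / 2) := by simpa [mem_tube] using c.R_pos
    set B : ℂ × ℝ → ℂ × ℝ →L[ℝ] ℝ := fun q =>
      G q • stdForm q + (1 - G q) • ContinuousLinearMap.snd ℝ ℂ ℝ with hB
    have hBapp : ∀ q v, B q v = v.2 + G q * (conj q.1 * v.1).im := by
      intro q v
      simp [hB]
      ring
    have hGd : DifferentiableAt ℝ G (0, l) := hG.differentiable (by simp) _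
    have hd1 : DifferentiableAt ℝ (fun q => G q • stdForm q) (0, l) :=
      hGd.smul (contDiff_stdForm.differentiable (by simp) _)
    have hd2 : HasFDerivAt (fun q => (1 - G q) • ContinuousLinearMap.snd ℝ ℂ ℝ)
        ((-fderiv ℝ G (0, l)).smulRight (ContinuousLinearMap.snd ℝ ℂ ℝ)) (0, l) :=
      HasFDerivAt.smul_const (F := ℂ × ℝ →L[ℝ] ℝ) (hGd.hasFDerivAt.const_sub 1)
        (ContinuousLinearMap.snd ℝ ℂ ℝ)
    have hBd : DifferentiableAt ℝ B (0, l) := hd1.add hd2.differentiableAt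
    have hw := c.wedgeFlat_pos ξ (hhalf _ h0) hBd ?_ ?_
    · have hdB : ∀ v w, dFlat B (0, l) v w = fderiv ℝ B (0, l) v w - fderiv ℝ B (0, l) w v :=
        fun _ _ => rfl
      have hfB : ∀ v w, fderiv ℝ B (0, l) v w = fderiv ℝ G (0, l) v * stdForm (0, l) w
          + G (0, l) * (conj v.1 * w.1).im - fderiv ℝ G (0, l) v * w.2 := by
        intro v w
        have : fderiv ℝ B (0, l) = _ := fderiv_add hd1 hd2.differentiableAt
        rw [this, add_apply, add_apply, fderiv_smul_stdForm hGd, hd2.fderiv]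
        simp
      simp [wedgeFlat, hdB, hfB, hBapp] at hw
      linarith
    · filter_upwards [(isOpen_tube _).mem_nhds h0] with y hy v
      rw [hker, hBapp]
      change _ ↔ pullbackForm c.Φ α y v = 0
      rw [hAG y hy]
      simp [(hpos y (hhalf y hy)).ne']
    · filter_upwards with y
      simp [hBapp]
  obtain ⟨ε₁, hε₁, h₁⟩ := exists_tube_of_eventually
    (P := fun q => q ∈ Tube (c.R / 2) ∧ 0 < G q)
    (fun z l => and_congr_right fun _ => by rw [hGper])
    (fun l => by
      have h0 : ((0 : ℂ), l) ∈ Tube (c.R / 2) := by simpa [mem_tube] using c.R_pos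
      exact (Filter.eventually_mem_set.2 ((isOpen_tube _).mem_nhds h0)).and
        (hG.continuous.continuousAt.eventually (lt_mem_nhds (hGcore l))))
  -- With `h = G^(-1/2)`, the equation `κ = h(κ z, λ)` says `κ² G(κ z, λ) = 1`, which normalizes the
  -- angular coefficient.
  obtain ⟨h, hh, hhper, hheq, -, C, hhC⟩ := exists_periodic_extension
    (f := fun q => (Real.sqrt (G q))⁻¹) hε₁
    ((hG.contDiffOn.sqrt (fun q hq => (h₁ q hq).2.ne')).inv
      (fun q hq => (Real.sqrt_pos.2 (h₁ q hq).2).ne'))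
    (fun z l _ => by simp only [hGper])
  obtain ⟨ε₂, hε₂, κ, hκ, hκper, hκeq⟩ := exists_radial_rescaling hh hhper hhC
  have hκd : ∀ q ∈ Tube ε₂, ContDiffAt ℝ ∞ κ q := fun q hq =>
    hκ.contDiffAt ((isOpen_tube _).mem_nhds hq)
  -- The Jacobian of `z ↦ κ z` is `κ (κ + r ∂_r κ)`; both factors are positive near the core.
  obtain ⟨ε₃, hε₃, h₃⟩ := exists_tube_of_eventually
    (P := fun q => q ∈ Tube ε₂ ∧ 0 < κ q ∧ ((κ q : ℂ) * q.1, q.2) ∈ Tube (ε₁ / 2) ∧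
      0 < κ q + fderiv ℝ κ q (q.1, 0))
    (fun z l => and_congr_right fun hz => by
      have h1 : κ (z, l + 2 * Real.pi) = κ (z, l) := hκper (z, l) hz
      have h2 := fderiv_add_period (f := κ) (a := 0) (fun q hq => by rw [hκper q hq, add_zero]) hz l
      rw [h1, h2]
      rfl)
    (fun l => by
      have h0 : ((0 : ℂ), l) ∈ Tube ε₂ := by simpa [mem_tube] using hε₂
      have h0' : ((0 : ℂ), l) ∈ Tube (ε₁ / 2) := by simpa [mem_tube] using hε₁
      have hκ0 : 0 < κ (0, l) := by
        rw [hκeq _ h0]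
        simp only [mul_zero]
        rw [hheq _ h0']
        exact inv_pos.2 (Real.sqrt_pos.2 (hGcore l))
      have hc := (hκd _ h0).continuousAt
      have hcd : ContinuousAt (fun q : ℂ × ℝ => κ q + fderiv ℝ κ q (q.1, 0)) (0, l) :=
        hc.add ((((hκd _ h0).fderiv_right (m := ∞) (by simp)).continuousAt).clm_apply
          (by fun_prop))
      have hcm : ContinuousAt (fun q : ℂ × ℝ => ((κ q : ℂ) * q.1, q.2)) (0, l) :=
        ((Complex.continuous_ofReal.continuousAt.comp hc).mul continuousAt_fst).prodMk
          continuousAt_snd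
      refine (Filter.eventually_mem_set.2 ((isOpen_tube _).mem_nhds h0)).and
        ((hc.eventually (lt_mem_nhds hκ0)).and ((hcm.eventually_mem ?_).and
          (hcd.eventually (lt_mem_nhds ?_))))
      · exact (isOpen_tube _).mem_nhds (by simpa using h0')
      · have : (((0 : ℂ), (0 : ℝ)) : ℂ × ℝ) = 0 := rfl
        simpa [this] using hκ0)
  have hfd : ∀ q ∈ Tube ε₃, ∀ v : ℂ × ℝ,
      fderiv ℝ (fun q : ℂ × ℝ => ((κ q : ℂ) * q.1, q.2)) q v
        = ((κ q : ℂ) * v.1 + (fderiv ℝ κ q v : ℂ) * q.1, v.2) := by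
    intro q hq v
    have hd := ((hκd q (h₃ q hq).1).differentiableAt (by simp)).hasFDerivAt
    have h1 := ((Complex.ofRealCLM.hasFDerivAt.comp q hd).mul (hasFDerivAt_fst (𝕜 := ℝ) (p := q)))
    have h2 : HasFDerivAt (fun q : ℂ × ℝ => ((κ q : ℂ) * q.1, q.2)) _ q :=
      h1.prodMk (hasFDerivAt_snd (𝕜 := ℝ))
    rw [h2.fderiv]
    simp [mul_comm]
  let ρ : Reparam c.R ε₃ :=
    { g := κ
      S := fun q => q.2
      R'_pos := hε₃
      g_smooth := hκ.mono fun q hq => (h₃ q hq).1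
      S_smooth := contDiffOn_snd
      g_pos := fun q hq => (h₃ q hq).2.1
      maps := fun q hq =>
        hhalf _ (h₁ _ (tube_mono (by linarith) (h₃ q hq).2.2.1)).1
      g_per := fun q hq => hκper q (h₃ q hq).1
      S_per := fun _ _ => rfl
      S_core := fun _ => rfl
      -- The factor `κ q` is the value of `h` at the image point, so the image determines `κ q` and
      -- then `z`.
      inj := by
        intro q hq q' hq' e1 e2
        have hk : κ q = κ q' := by
          rw [hκeq q (h₃ q hq).1, hκeq q' (h₃ q' hq').1, e1]
          exact congrArg _ (Prod.ext rfl e2)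
        rw [hk] at e1
        have h0 : (κ q' : ℂ) ≠ 0 := Complex.ofReal_ne_zero.2 (h₃ q' hq').2.1.ne'
        exact Prod.ext (mul_left_cancel₀ h0 e1) e2
      det_pos := fun q hq => by
        rw [stdBasis_det]
        simp only [hfd q hq]
        have hp := mul_pos (h₃ q hq).2.1 (h₃ q hq).2.2.2
        rw [clm_apply_prod _ (q.1, 0)] at hp
        simp at hp ⊢
        linarith }
  refine ⟨ε₃, ρ, fun q hq => ?_⟩
  have hm := (h₃ q hq).2.2.1
  have hm' := h₁ _ (tube_mono (by linarith) hm)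
  set y : ℂ × ℝ := ((κ q : ℂ) * q.1, q.2) with hy
  have hmapeq : ρ.map q = y := rfl
  have hκG : κ q ^ 2 * G y = 1 := by
    have h1 : κ q = (Real.sqrt (G y))⁻¹ := by rw [hκeq q (h₃ q hq).1, hheq _ hm]
    have h2 := Real.sqrt_pos.2 hm'.2
    rw [h1, inv_pow, Real.sq_sqrt hm'.2.le, inv_mul_cancel₀ hm'.2.ne']
  have key : ∀ v : ℂ × ℝ, pullbackForm (c.reparam ρ).Φ α q v =
      pullbackForm c.Φ α y (0, 1) * stdForm q v := by
    intro v
    have hfd' : fderiv ℝ ρ.map q v = _ := hfd q hq v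
    rw [c.pullbackForm_reparam ρ α hq, hmapeq, hAG y hm'.1, hfd', stdForm_apply]
    congr 2
    have : (conj y.1 * ((κ q : ℂ) * v.1 + (fderiv ℝ κ q v : ℂ) * q.1)).im
        = κ q ^ 2 * (conj q.1 * v.1).im := by
      simp [hy, Complex.mul_im]
      ring
    simp only [this]
    rw [← mul_assoc, mul_comm (G y), hκG, one_mul]
  have key1 : pullbackForm (c.reparam ρ).Φ α q (0, 1) = pullbackForm c.Φ α y (0, 1) := by
    rw [key]; simp
  refine ⟨?_, ?_⟩
  · rw [key1]
    exact hpos _ (hhalf _ hm'.1)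
  · refine ContinuousLinearMap.ext fun v => ?_
    rw [key1, key]
    rfl

end PolarCoords

/-! ### Reeb pairs -/

section ReebPair

variable {M : Type*} [TopologicalSpace M] [ChartedSpace E3 M] [IsManifold (𝓡 3) ∞ M]
  {o : ManifoldOrientation M}

/-- Near `x`, `α` is a contact form for `ξ` with Reeb vector field `V`. -/
structure ReebPairAt (ξ : ContactStructure o) (α : OneForm M) (V : VField M) (x : M) : Prop where
  smooth_form : ContMDiffAt (𝓡 3) ((𝓡 3).prod 𝓘(ℝ, E3 →L[ℝ] ℝ)) ∞
    (fun x => TotalSpace.mk' (E3 →L[ℝ] ℝ)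
      (E := fun x : M => TangentSpace (𝓡 3) x →L[ℝ] Bundle.Trivial M ℝ x) x (α x)) x
  smooth_field : ContMDiffAt (𝓡 3) (𝓡 3).tangent ∞
    (fun x => (⟨x, V x⟩ : TangentBundle (𝓡 3) M)) x
  ker : ξ.plane x = LinearMap.ker (α x : TangentSpace (𝓡 3) x →ₗ[ℝ] ℝ)
  apply_eq_one : α x (V x) = 1
  d_eq_zero : ∀ w, α.d x (V x) w = 0

variable {ξ : ContactStructure o} {α β : OneForm M} {V W : VField M} {x : M}

/-- In its pointwise form the Reeb condition can be checked separately on the pieces of a glued pair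
of form and field. -/
lemma isReeb_iff : ξ.IsReeb V ↔ ∃ α : OneForm M, ∀ x, ReebPairAt ξ α V x := by
  constructor
  · rintro ⟨hV, α, hα, h1, h2, h3⟩
    exact ⟨α, fun x => ⟨hα.contMDiffAt Filter.univ_mem, hV x, h1 x, h2 x, h3 x⟩⟩
  · rintro ⟨α, h⟩
    exact ⟨fun x => (h x).smooth_field, α, fun x _ => (h x).smooth_form.contMDiffWithinAt,
      fun x => (h x).ker, fun x => (h x).apply_eq_one, fun x => (h x).d_eq_zero⟩

lemma isSmoothOn_univ (h : ∀ x, ReebPairAt ξ α V x) : α.IsSmoothOn univ :=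
  fun x _ => (h x).smooth_form.contMDiffWithinAt

lemma ReebPairAt.congr (h : ReebPairAt ξ α V x) (hα : ∀ᶠ y in 𝓝 x, β y = α y)
    (hV : ∀ᶠ y in 𝓝 x, W y = V y) : ReebPairAt ξ β W x where
  smooth_form := h.smooth_form.congr_of_eventuallyEq (by
    filter_upwards [hα] with y hy
    rw [hy])
  smooth_field := h.smooth_field.congr_of_eventuallyEq (by
    filter_upwards [hV] with y hy
    rw [hy])
  ker := by rw [hα.self_of_nhds]; exact h.ker
  apply_eq_one := by rw [hα.self_of_nhds, hV.self_of_nhds]; exact h.apply_eq_one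
  d_eq_zero := by rw [OneForm.d_congr hα, hV.self_of_nhds]; exact h.d_eq_zero

lemma ReebPairAt.neg (h : ReebPairAt ξ α V x) : ReebPairAt ξ (-α) (-V) x where
  smooth_form := ContMDiffAt.neg_section h.smooth_form
  smooth_field := ContMDiffAt.neg_section h.smooth_field
  ker := by
    rw [h.ker]
    ext v
    simp [LinearMap.mem_ker]
  apply_eq_one := by
    have : (-α) x ((-V) x) = α x (V x) := by
      change -(α x (-(V x))) = _
      rw [map_neg, neg_neg]
    rw [this, h.apply_eq_one]
  d_eq_zero := fun w => by
    rw [OneForm.d_neg]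
    change -(α.d x (-(V x)) w) = 0
    rw [OneForm.d_neg_left, h.d_eq_zero, neg_zero, neg_zero]

end ReebPair

/-! ### The angular derivative of the fibration in polar coordinates -/

section AngularDerivative

variable {M : Type*} [TopologicalSpace M]

lemma contMDiff_circle_coe : ContMDiff (𝓡 1) 𝓘(ℝ, ℂ) ∞ (fun z : Circle => (z : ℂ)) :=
  haveI : Fact (Module.finrank ℝ ℂ = 1 + 1) := finrank_real_complex_fact'
  contMDiff_coe_sphere

variable [ChartedSpace E3 M]

lemma IsLink.isCompact {L : Set M} (h : IsLink L) : IsCompact L := by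
  obtain ⟨n, γ, hγ, -, rfl⟩ := h
  exact isCompact_iUnion fun i => isCompact_range (hγ i).isEmbedding.continuous

lemma PolarCoords.coe_fibration {o : ManifoldOrientation M} {L : Set M} (c : PolarCoords o L)
    {p : M → Circle} (h : c.FibrationIs p 1 0) {q : ℂ × ℝ} (hq : q ∈ Tube c.R) (hz : q.1 ≠ 0) :
    (p (c.Φ q) : ℂ) = ((‖q.1‖⁻¹ : ℝ) : ℂ) * q.1 := by
  have h1 := h ‖q.1‖ q.1.arg q.2 (norm_pos_iff.2 hz) hq
  have h2 : (‖q.1‖ : ℂ) * Complex.exp (q.1.arg * Complex.I) = q.1 :=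
    Complex.norm_mul_exp_arg_mul_I q.1
  rw [h2] at h1
  rw [show q = (q.1, q.2) from rfl, h1, Circle.coe_exp]
  have h0 : (‖q.1‖ : ℂ) ≠ 0 := Complex.ofReal_ne_zero.2 (norm_ne_zero_iff.2 hz)
  simp only [one_mul, zero_mul, add_zero]
  rw [Complex.ofReal_inv]
  field_simp
  rw [mul_comm, h2]

variable [T2Space M]

lemma FiberedLink.isClosed (F : FiberedLink M) : IsClosed F.L := F.isLink.isCompact.isClosed

lemma FiberedLink.contMDiffAt_coe (F : FiberedLink M) {x : M} (hx : x ∉ F.L) :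
    ContMDiffAt (𝓡 3) 𝓘(ℝ, ℂ) ∞ (fun y => (F.p y : ℂ)) x :=
  contMDiff_circle_coe.contMDiffAt.comp x
    (F.smooth.contMDiffAt (F.isClosed.isOpen_compl.mem_nhds hx))

/-- `dμ` in polar coordinates with `p = μ`. -/
lemma FiberedLink.angularDeriv_push {o : ManifoldOrientation M} (F : FiberedLink M)
    (c : PolarCoords o F.L) (h : c.FibrationIs F.p 1 0) {q : ℂ × ℝ} (hq : q ∈ Tube c.R)
    (hz : q.1 ≠ 0) (v : ℂ × ℝ) :
    angularDeriv F.p (c.Φ q) (mfderiv 𝓘(ℝ, ℂ × ℝ) (𝓡 3) c.Φ q v)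
      = (conj q.1 * v.1).im / ‖q.1‖ ^ 2 := by
  have hx : c.Φ q ∉ F.L := fun hmem => hz ((c.mem_link q hq).1 hmem)
  set P : M → ℂ := fun y => (F.p y : ℂ) with hP
  have hPd := (F.contMDiffAt_coe hx).mdifferentiableAt (by simp)
  have hch : mfderiv 𝓘(ℝ, ℂ × ℝ) 𝓘(ℝ, ℂ) (P ∘ c.Φ) q =
      (mfderiv (𝓡 3) 𝓘(ℝ, ℂ) P (c.Φ q)).comp (mfderiv 𝓘(ℝ, ℂ × ℝ) (𝓡 3) c.Φ q) :=
    mfderiv_comp q hPd (c.mdifferentiableAt hq)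
  set r : ℂ × ℝ → ℝ := fun q => ‖q.1‖⁻¹ with hr
  have hrd : DifferentiableAt ℝ r q :=
    ((differentiableAt_fst (𝕜 := ℝ) (p := q)).norm ℝ hz).inv (norm_ne_zero_iff.2 hz)
  have hd : HasFDerivAt (P ∘ c.Φ) _ q :=
    ((Complex.ofRealCLM.hasFDerivAt.comp q hrd.hasFDerivAt).mul
      (hasFDerivAt_fst (𝕜 := ℝ) (p := q))).congr_of_eventuallyEq (by
        have ho : IsOpen {y : ℂ × ℝ | y.1 ≠ 0} := isOpen_ne_fun continuous_fst continuous_const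
        filter_upwards [(isOpen_tube c.R).mem_nhds hq, ho.mem_nhds hz] with y hy hyz
        exact c.coe_fibration h hy hyz)
  have hval : mfderiv (𝓡 3) 𝓘(ℝ, ℂ) P (c.Φ q) (mfderiv 𝓘(ℝ, ℂ × ℝ) (𝓡 3) c.Φ q v)
      = (r q : ℂ) * v.1 + (fderiv ℝ r q v : ℂ) * q.1 := by
    have h1 : mfderiv 𝓘(ℝ, ℂ × ℝ) 𝓘(ℝ, ℂ) (P ∘ c.Φ) q v = fderiv ℝ (P ∘ c.Φ) q v := by
      rw [mfderiv_eq_fderiv]; rfl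
    rw [hch, hd.fderiv] at h1
    refine Eq.trans h1 ?_
    simp [mul_comm]
    rfl
  have hdef : angularDeriv F.p (c.Φ q) (mfderiv 𝓘(ℝ, ℂ × ℝ) (𝓡 3) c.Φ q v)
      = (conj (F.p (c.Φ q) : ℂ) * ((r q : ℂ) * v.1 + (fderiv ℝ r q v : ℂ) * q.1)).im := by
    rw [← hval]; rfl
  -- The variation of `1 / r` contributes a real multiple of `conj z * z`, which has no imaginary
  -- part.
  rw [hdef, c.coe_fibration h hq hz]
  simp [hr, Complex.mul_im]
  field_simp
  ring

end AngularDerivative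

/-! ### Modification of a contact form near a component of the binding -/

namespace PolarCoords

variable {M : Type*} [TopologicalSpace M] [ChartedSpace E3 M]
  {o : ManifoldOrientation M} {L : Set M} (c : PolarCoords o L)

/-- Restriction of polar coordinates to a smaller neighborhood. -/
def shrink {ε : ℝ} (hε : 0 < ε) (hle : ε ≤ c.R) : PolarCoords o L where
  R := ε
  R_pos := hε
  Φ := c.Φ
  smooth := c.smooth.mono fun _ hq => lt_of_lt_of_le hq hle
  inj := fun q q' hq hq' => c.inj q q' (hq.trans_le hle) (hq'.trans_le hle)
  posFrame := fun q hq => c.posFrame q (hq.trans_le hle)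
  mem_link := fun q hq => c.mem_link q (hq.trans_le hle)

/-- A periodic function of the coordinates depends on the point only. -/
lemma eq_of_Φ_eq {F : Type*} {k : ℂ × ℝ → F}
    (hper : ∀ z l, ‖z‖ < c.R → k (z, l + 2 * Real.pi) = k (z, l)) {q q' : ℂ × ℝ}
    (hq : q ∈ Tube c.R) (hq' : q' ∈ Tube c.R) (h : c.Φ q = c.Φ q') : k q = k q' := by
  obtain ⟨h1, n, h2⟩ := (c.inj q q' hq hq').1 h
  have hp : Function.Periodic (fun l => k (q.1, l)) (2 * Real.pi) := fun l => hper q.1 l hq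
  have h3 := hp.int_mul n q.2
  rw [show q' = (q.1, q.2 + n * (2 * Real.pi)) from Prod.ext h1.symm h2]
  exact h3.symm

lemma exists_descent {F : Type*} (a : F) {k : ℂ × ℝ → F}
    (hper : ∀ z l, ‖z‖ < c.R → k (z, l + 2 * Real.pi) = k (z, l)) :
    ∃ κ : M → F, (∀ q ∈ Tube c.R, κ (c.Φ q) = k q) ∧ ∀ x ∉ c.Φ '' Tube c.R, κ x = a := by
  classical
  refine ⟨fun x => if h : x ∈ c.Φ '' Tube c.R then k h.choose else a, fun q hq => ?_,
    fun x hx => dif_neg hx⟩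
  have h : c.Φ q ∈ c.Φ '' Tube c.R := mem_image_of_mem _ hq
  simp only [dif_pos h]
  exact c.eq_of_Φ_eq hper h.choose_spec.1 hq h.choose_spec.2

lemma exists_mem_Icc {q : ℂ × ℝ} (hq : q ∈ Tube c.R) :
    ∃ l ∈ Icc (0 : ℝ) (2 * Real.pi), c.Φ (q.1, l) = c.Φ q := by
  have hp : Function.Periodic (fun l => c.Φ (q.1, l)) (2 * Real.pi) := fun l => c.Φ_periodic hq l
  obtain ⟨l, hl, h⟩ := hp.exists_mem_Ico₀ Real.two_pi_pos q.2
  exact ⟨l, ⟨hl.1, hl.2.le⟩, h.symm⟩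

lemma isCompact_image_closedTube {r : ℝ} (hr : r < c.R) :
    IsCompact (c.Φ '' {q : ℂ × ℝ | ‖q.1‖ ≤ r}) := by
  have hK : IsCompact (Metric.closedBall (0 : ℂ) r ×ˢ Icc (0 : ℝ) (2 * Real.pi)) :=
    (isCompact_closedBall _ _).prod isCompact_Icc
  have hsub : ∀ q ∈ Metric.closedBall (0 : ℂ) r ×ˢ Icc (0 : ℝ) (2 * Real.pi), q ∈ Tube c.R := by
    rintro q ⟨h, -⟩
    exact lt_of_le_of_lt (by simpa using h) hr
  convert hK.image_of_continuousOn (c.smooth'.continuousOn.mono hsub) using 1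
  ext x
  constructor
  · rintro ⟨q, hq, rfl⟩
    have hqr : ‖q.1‖ ≤ r := hq
    obtain ⟨l, hl, h⟩ := c.exists_mem_Icc (hqr.trans_lt hr)
    exact ⟨(q.1, l), ⟨by simpa using hqr, hl⟩, h⟩
  · rintro ⟨q, ⟨h, -⟩, rfl⟩
    exact ⟨q, by simpa using h, rfl⟩

lemma isAround_iff_mem {x : M} (hx : x ∈ L) : c.IsAround x ↔ x ∈ c.Φ '' Tube c.R := by
  constructor
  · rintro ⟨l, rfl⟩
    exact mem_image_of_mem _ (c.core_mem l)
  · rintro ⟨q, hq, rfl⟩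
    have h0 : q.1 = 0 := (c.mem_link q hq).1 hx
    exact ⟨q.2, by rw [← h0]⟩

lemma IsAround.mem {c : PolarCoords o L} {x : M} (h : c.IsAround x) : x ∈ L := by
  obtain ⟨l, rfl⟩ := h
  exact (c.mem_link _ (c.core_mem l)).2 rfl

variable [T2Space M]

lemma isClosed_core : IsClosed {x | c.IsAround x} := by
  convert (c.isCompact_image_closedTube c.R_pos).isClosed using 1
  ext x
  constructor
  · rintro ⟨l, rfl⟩
    exact ⟨(0, l), by simp, rfl⟩
  · rintro ⟨q, hq, rfl⟩
    have h0 : q.1 = 0 := by simpa using hq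
    exact ⟨q.2, by rw [← h0]⟩

variable [IsManifold (𝓡 3) ∞ M]

/-- The core of polar coordinates is a component of the link. -/
theorem IsAround.of_isAround {c c' : PolarCoords o L} {x y : M} (hx : c.IsAround x)
    (hx' : c'.IsAround x) (hy : c.IsAround y) : c'.IsAround y := by
  have hcont : Continuous (fun l : ℝ => c.Φ (0, l)) :=
    c.smooth'.continuousOn.comp_continuous (by fun_prop) c.core_mem
  have hL : ∀ l, c.Φ (0, l) ∈ L := fun l => (c.mem_link _ (c.core_mem l)).2 rfl
  -- The parameters whose core point lies on the core of `c'` form a closed set, as that core is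
  -- compact, and an open set, as the open image of `c'` meets the link only in its core.
  -- Connectedness of `ℝ` finishes.
  have hclosed : IsClosed {l : ℝ | c'.IsAround (c.Φ (0, l))} := c'.isClosed_core.preimage hcont
  have hopen : IsOpen {l : ℝ | c'.IsAround (c.Φ (0, l))} := by
    convert (c'.isOpen_image (isOpen_tube c'.R) subset_rfl).preimage hcont using 1
    ext l
    exact c'.isAround_iff_mem (hL l)
  obtain ⟨l, rfl⟩ := hx
  obtain ⟨l', rfl⟩ := hy
  have := IsClopen.eq_univ ⟨hclosed, hopen⟩ ⟨l, hx'⟩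
  exact eq_univ_iff_forall.1 this l'

end PolarCoords

section Modification

variable {M : Type*} [TopologicalSpace M] [ChartedSpace E3 M] [IsManifold (𝓡 3) ∞ M]
  {o : ManifoldOrientation M}

/-- The Reeb vector field of a form which is a multiple of the standard one in coordinates. -/
lemma PolarCoords.reeb_iff {L : Set M} (c : PolarCoords o L) {α : OneForm M}
    (hα : α.IsSmoothOn univ) {H : ℂ × ℝ → ℝ} (hH : ContDiffOn ℝ ∞ H (Tube c.R))
    (hne : ∀ q ∈ Tube c.R, H q ≠ 0)
    (hform : ∀ q ∈ Tube c.R, pullbackForm c.Φ α q = (H q)⁻¹ • stdForm q) {q : ℂ × ℝ}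
    (hq : q ∈ Tube c.R) (X : ℂ × ℝ) :
    (α (c.Φ q) (mfderiv 𝓘(ℝ, ℂ × ℝ) (𝓡 3) c.Φ q X) = 1 ∧
      ∀ u, α.d (c.Φ q) (mfderiv 𝓘(ℝ, ℂ × ℝ) (𝓡 3) c.Φ q X) u = 0) ↔ X = reebField H q := by
  have hm := (isOpen_tube c.R).mem_nhds hq
  rw [← reeb_conditions_iff ((hH.contDiffAt hm).differentiableAt (by simp)) (hne q hq) X]
  have hev : pullbackForm c.Φ α =ᶠ[𝓝 q] fun q => (H q)⁻¹ • stdForm q := by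
    filter_upwards [hm] with y hy using hform y hy
  rw [← dFlat_congr hev]
  have hd := fun w => dFlat_pullbackForm isOpen_univ hα (isOpen_tube c.R) c.smooth' hq
    (mem_univ _) X w
  refine and_congr ?_ ?_
  · have h1 : pullbackForm c.Φ α q X = (H q)⁻¹ * stdForm q X := by
      rw [hform q hq]; rfl
    rw [← pullbackForm_apply, h1]
  · simp only [hd]
    exact (c.bijective_mfderiv hq).2.forall

variable [T2Space M]

/-- A Reeb vector field that is positively transverse to the pages can be changed near a component
of the binding to a linear one, if the contact structure is standard there. -/
theorem exists_linear_near_core (F : FiberedLink M) (c : PolarCoords o F.L)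
    {ξ : ContactStructure o} {α : OneForm M} {V : VField M} (h : ∀ x, ReebPairAt ξ α V x)
    (hV : ∀ x, x ∉ F.L → 0 < angularDeriv F.p x (V x)) (hfib : c.FibrationIs F.p 1 0)
    (hpos : ∀ q ∈ Tube c.R, 0 < pullbackForm c.Φ α q (0, 1))
    (hstd : ∀ q ∈ Tube c.R, pullbackForm c.Φ α q = pullbackForm c.Φ α q (0, 1) • stdForm q) :
    ∃ (κ : M → ℝ) (V' : VField M), (∀ x, 0 < κ x) ∧
      (∀ x, ReebPairAt ξ (fun x => κ x • α x) V' x) ∧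
      (∀ x, x ∉ F.L → 0 < angularDeriv F.p x (V' x)) ∧
      (∀ x ∉ c.Φ '' {q | ‖q.1‖ ≤ c.R / 2}, V' x = V x) ∧
      ∃ c₀ c₁ : ℝ, 0 < c₀ ∧
        ∀ q ∈ Tube (c.R / 4), V' (c.Φ q) = c.push q (c₁ * (Complex.I * q.1)) c₀ := by
  classical
  have hα := isSmoothOn_univ h
  have hA := c.contDiffOn_pullback hα
  have hR2 : c.R / 2 < c.R := by linarith [c.R_pos]
  set H : ℂ × ℝ → ℝ := fun q => (pullbackForm c.Φ α q (0, 1))⁻¹ with hHdef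
  have hH : ContDiffOn ℝ ∞ H (Tube c.R) :=
    (hA.clm_apply contDiffOn_const).inv fun q hq => (hpos q hq).ne'
  have hHpos : ∀ q ∈ Tube c.R, 0 < H q := fun q hq => inv_pos.2 (hpos q hq)
  have hHper : ∀ z l, ‖z‖ < c.R → H (z, l + 2 * Real.pi) = H (z, l) := fun z l hz => by
    simp only [hHdef, c.pullbackForm_periodic α hz l]
  have hform : ∀ q ∈ Tube c.R, pullbackForm c.Φ α q = (H q)⁻¹ • stdForm q := fun q hq => by
    rw [hHdef, inv_inv]; exact hstd q hq
  -- The Reeb conditions have a single solution in coordinates, so `V` is the coordinate Reeb field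
  -- of `H`.
  have hVX : ∀ q ∈ Tube c.R,
      V (c.Φ q) = mfderiv 𝓘(ℝ, ℂ × ℝ) (𝓡 3) c.Φ q (reebField H q) := by
    intro q hq
    obtain ⟨X, hX⟩ := (c.bijective_mfderiv hq).2 (V (c.Φ q))
    have := (c.reeb_iff hα hH (fun q hq => (hHpos q hq).ne') hform hq X).1
      (by rw [hX]; exact ⟨(h _).apply_eq_one, (h _).d_eq_zero⟩)
    rw [← this, hX]
  have hang : ∀ (G : ℂ × ℝ → ℝ), ∀ q ∈ Tube c.R, q.1 ≠ 0 →
      (0 < angularDeriv F.p (c.Φ q) (mfderiv 𝓘(ℝ, ℂ × ℝ) (𝓡 3) c.Φ q (reebField G q)) ↔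
        0 < fderiv ℝ G q (q.1, 0)) := by
    intro G q hq hz
    have hz2 : 0 < ‖q.1‖ ^ 2 := by positivity
    rw [F.angularDeriv_push c hfib hq hz, reebField_angular, div_pos_iff_of_pos_right hz2,
      div_pos_iff_of_pos_right two_pos]
  obtain ⟨H', hH', hH'per, hH'pos, hH'eq, hH'rad, c₀, c₁, hc₀, hquad⟩ :=
    exists_quadratic_near_core c.R_pos hH hHper (fun l => hHpos _ (c.core_mem l))
      (fun q hq hz => (hang H q hq hz).1 (by
        rw [← hVX q hq]
        exact hV _ fun hm => hz ((c.mem_link q hq).1 hm)))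
  -- Multiplication by `H / H'` replaces `H` by `H'` in the denominator of the form. The factor is
  -- `1` beyond radius `R / 2`, so it extends by the default value `1`.
  obtain ⟨κ, hκ, hκ1⟩ := c.exists_descent (1 : ℝ) (k := fun q => H q / H' q)
    (fun z l hz => by simp only [hHper z l hz, hH'per z l hz])
  set T := c.Φ '' {q | ‖q.1‖ ≤ c.R / 2} with hT
  have hTc : IsClosed T := (c.isCompact_image_closedTube hR2).isClosed
  have hHH : ∀ q ∈ Tube c.R, c.Φ q ∉ T → H' q = H q := fun q hq hqT =>
    hH'eq q (not_lt.1 fun hlt => hqT ⟨q, hlt.le, rfl⟩)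
  have hκT : ∀ x ∉ T, κ x = 1 := by
    intro x hx
    by_cases hxt : x ∈ c.Φ '' Tube c.R
    · obtain ⟨q, hq, rfl⟩ := hxt
      rw [hκ q hq, hHH q hq hx, div_self (hHpos q hq).ne']
    · exact hκ1 x hxt
  have hκpos : ∀ x, 0 < κ x := by
    intro x
    by_cases hxt : x ∈ c.Φ '' Tube c.R
    · obtain ⟨q, hq, rfl⟩ := hxt
      rw [hκ q hq]
      exact div_pos (hHpos q hq) (hH'pos q hq)
    · rw [hκ1 x hxt]; exact one_pos
  set α' : OneForm M := fun x => κ x • α x with hα'def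
  have hout : ∀ x ∉ T, ∀ᶠ y in 𝓝 x, y ∉ T := fun x hx => hTc.isOpen_compl.mem_nhds hx
  have hα'T : ∀ x ∉ T, α' x = α x := fun x hx => by rw [hα'def]; simp [hκT x hx]
  have hcase : ∀ x, x ∈ c.Φ '' Tube c.R ∨ x ∉ T := by
    intro x
    by_cases hx : x ∈ T
    · obtain ⟨q, hq, rfl⟩ := hx
      have hq' : ‖q.1‖ ≤ c.R / 2 := hq
      exact Or.inl ⟨q, hq'.trans_lt hR2, rfl⟩
    · exact Or.inr hx
  have hα'at : ∀ x, ContMDiffAt (𝓡 3) ((𝓡 3).prod 𝓘(ℝ, E3 →L[ℝ] ℝ)) ∞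
      (fun x => TotalSpace.mk' (E3 →L[ℝ] ℝ)
        (E := fun x : M => TangentSpace (𝓡 3) x →L[ℝ] Bundle.Trivial M ℝ x) x (α' x)) x := by
    intro x
    rcases hcase x with ⟨q, hq, rfl⟩ | hx
    · have hm := (isOpen_tube c.R).mem_nhds hq
      have hκs : ContMDiffAt (𝓡 3) 𝓘(ℝ, ℝ) ∞ κ (c.Φ q) :=
        c.contMDiffAt_of_comp hq ((hH.contDiffAt hm).div (hH'.contDiffAt hm) (hH'pos q hq).ne') hκ
      exact ContMDiffAt.smul_section hκs (h (c.Φ q)).smooth_form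
    · refine (h x).smooth_form.congr_of_eventuallyEq ?_
      filter_upwards [hout x hx] with y hy
      rw [hα'T y hy]
  have hα' : α'.IsSmoothOn univ := fun x _ => (hα'at x).contMDiffWithinAt
  have hform' : ∀ q ∈ Tube c.R, pullbackForm c.Φ α' q = (H' q)⁻¹ • stdForm q := by
    intro q hq
    have h1 : pullbackForm c.Φ α' q = κ (c.Φ q) • pullbackForm c.Φ α q := rfl
    rw [h1, hform q hq, hκ q hq, smul_smul]
    congr 1
    have := (hHpos q hq).ne'
    field_simp
  have hreeb' := fun {q} (hq : q ∈ Tube c.R) X =>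
    c.reeb_iff hα' hH' (fun q hq => (hH'pos q hq).ne') hform' hq X
  -- The new vector is characterized by the Reeb conditions at the point of `M`, so no lift to the
  -- tube has to be chosen.
  set V' : VField M := fun x => if x ∈ c.Φ '' Tube c.R then
    Classical.epsilon fun w : TangentSpace (𝓡 3) x => α' x w = 1 ∧ ∀ u, α'.d x w u = 0
    else V x with hV'def
  have hV'X : ∀ q ∈ Tube c.R,
      V' (c.Φ q) = mfderiv 𝓘(ℝ, ℂ × ℝ) (𝓡 3) c.Φ q (reebField H' q) := by
    intro q hq
    have hmem : c.Φ q ∈ c.Φ '' Tube c.R := mem_image_of_mem _ hq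
    simp only [hV'def, if_pos hmem]
    have hs := Classical.epsilon_spec (p := fun w : TangentSpace (𝓡 3) (c.Φ q) =>
      α' (c.Φ q) w = 1 ∧ ∀ u, α'.d (c.Φ q) w u = 0) ⟨_, (hreeb' hq _).2 rfl⟩
    obtain ⟨X, hX⟩ := (c.bijective_mfderiv hq).2 (Classical.epsilon
      fun w : TangentSpace (𝓡 3) (c.Φ q) => α' (c.Φ q) w = 1 ∧ ∀ u, α'.d (c.Φ q) w u = 0)
    rw [← hX] at hs ⊢
    rw [(hreeb' hq X).1 hs]
  have hV'T : ∀ x ∉ T, V' x = V x := by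
    intro x hx
    by_cases hxt : x ∈ c.Φ '' Tube c.R
    · obtain ⟨q, hq, rfl⟩ := hxt
      -- Equality of values at `q` alone would not do, since the Reeb field involves first
      -- derivatives; the complement of `T` is open.
      have hev : H' =ᶠ[𝓝 q] H := by
        have hcont := (c.smoothAt hq).continuousAt
        filter_upwards [(isOpen_tube c.R).mem_nhds hq, hcont.eventually (hout _ hx)] with y hy hyT
        exact hHH y hy hyT
      have hXX : reebField H' q = reebField H q := by
        simp only [reebField, hev.fderiv_eq, hev.eq_of_nhds]
      rw [hV'X q hq, hVX q hq, hXX]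
    · exact if_neg hxt
  refine ⟨κ, V', hκpos, fun x => ?_, fun x hx => ?_, hV'T, c₀, c₁, hc₀, fun q hq => ?_⟩
  · rcases hcase x with ⟨q, hq, rfl⟩ | hx
    · have hs := (hreeb' hq _).2 rfl
      rw [← hV'X q hq] at hs
      refine ⟨hα'at _, ?_, ?_, hs.1, hs.2⟩
      · refine c.contMDiffAt_field hq (X := reebField H') ?_ hV'X
        exact fun y hy => (contDiffAt_reebField
          (hH'.contDiffAt ((isOpen_tube c.R).mem_nhds hy))).contDiffWithinAt
      · rw [(h _).ker]
        ext v
        have := (hκpos (c.Φ q)).ne'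
        simp [LinearMap.mem_ker, this]
    · exact (h x).congr ((hout x hx).mono hα'T) ((hout x hx).mono hV'T)
  · by_cases hxt : x ∈ c.Φ '' Tube c.R
    · obtain ⟨q, hq, rfl⟩ := hxt
      have hz : q.1 ≠ 0 := fun h0 => hx ((c.mem_link q hq).2 h0)
      rw [hV'X q hq]
      exact (hang H' q hq hz).2 (hH'rad q hq hz)
    · rw [hV'def]
      simp only [if_neg hxt]
      exact hV x hx
  · rw [hV'X q (tube_mono (by linarith [c.R_pos]) hq), reebField_quadratic hquad hq]
    rfl

end Modification

/-! ### Positive Reeb vector fields -/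

section Sign

variable {M : Type*} [TopologicalSpace M] [ChartedSpace E3 M] {o : ManifoldOrientation M}

lemma angularDeriv_neg (p : M → Circle) (x : M) (v : TangentSpace (𝓡 3) x) :
    angularDeriv p x (-v) = -angularDeriv p x v := by
  have h : ∀ (T : TangentSpace (𝓡 3) x →L[ℝ] ℂ) (z : ℂ), (z * T (-v)).im = -(z * T v).im := by
    intro T z
    rw [map_neg, mul_neg, Complex.neg_im]
  exact h (mfderiv (𝓡 3) 𝓘(ℝ, ℂ) (fun y => (p y : ℂ)) x) (conj (p x : ℂ))

/-- Every neighborhood of a point of the core contains points off the link. -/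
lemma PolarCoords.exists_off_core {L : Set M} (c : PolarCoords o L) {l : ℝ} {P : M → Prop}
    (h : ∀ᶠ y in 𝓝 (c.Φ (0, l)), P y) : ∃ q ∈ Tube c.R, q.1 ≠ 0 ∧ P (c.Φ q) := by
  have hm := c.core_mem l
  have h1 : ∀ᶠ q in 𝓝 ((0 : ℂ), l), q ∈ Tube c.R ∧ P (c.Φ q) :=
    ((isOpen_tube c.R).eventually_mem hm).and ((c.smoothAt hm).continuousAt.eventually h)
  have hc : ContinuousAt (fun z : ℂ => (z, l)) 0 := by fun_prop
  obtain ⟨z, ⟨h2, h3⟩, hz⟩ := (((hc.eventually h1).filter_mono nhdsWithin_le_nhds).and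
    (self_mem_nhdsWithin (a := (0 : ℂ)) (s := {0}ᶜ))).exists
  exact ⟨(z, l), h2, hz, h3⟩

variable [IsManifold (𝓡 3) ∞ M] [T2Space M]

lemma FiberedLink.continuousAt_angularDeriv (F : FiberedLink M) {V : VField M} (hV : V.IsSmooth)
    {x : M} (hx : x ∉ F.L) : ContinuousAt (fun y => angularDeriv F.p y (V y)) x := by
  have ho := F.isClosed.isOpen_compl
  have hP : ContMDiffOn (𝓡 3) 𝓘(ℝ, ℂ) ∞ (fun y => (F.p y : ℂ)) F.Lᶜ :=
    fun y hy => (F.contMDiffAt_coe hy).contMDiffWithinAt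
  have h1 := (hP.contMDiffOn_tangentMapWithin (m := ∞) (by simp) ho.uniqueMDiffOn).comp
    hV.contMDiffOn (fun y hy => hy)
  have h2 : ContinuousOn (fun y => (mfderiv (𝓡 3) 𝓘(ℝ, ℂ) (fun y => (F.p y : ℂ)) y (V y) : ℂ))
      F.Lᶜ := by
    have h3 := ((contMDiff_snd_tangentBundle_modelSpace ℂ 𝓘(ℝ, ℂ) (n := ∞)).comp_contMDiffOn
      h1).continuousOn
    refine h3.congr fun y hy => ?_
    simp only [Function.comp, tangentMapWithin, mfderivWithin_of_isOpen ho hy]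
    rfl
  have h3 : ContinuousOn (fun y => angularDeriv F.p y (V y)) F.Lᶜ :=
    Complex.continuous_im.comp_continuousOn
      ((Complex.continuous_conj.comp_continuousOn hP.continuousOn).mul h2)
  exact h3.continuousAt (ho.mem_nhds hx)

/-- After changing signs on components of `M`, a Reeb vector field that respects an open book is
positively transverse to the pages, and its contact form is positive on the binding. -/
theorem OpenBook.RespectedBy.exists_pos {B : OpenBook o} {ξ : ContactStructure o} {α : OneForm M}
    {V : VField M} (hV : B.RespectedBy V) (h : ∀ x, ReebPairAt ξ α V x) :
    ∃ (α' : OneForm M) (V' : VField M), (∀ x, ReebPairAt ξ α' V' x) ∧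
      (∀ x, x ∉ B.L → 0 < angularDeriv B.p x (V' x)) ∧
      ∀ x ∈ B.L, ∃ c : PolarCoords o B.L, c.IsAround x ∧ c.FibrationIs B.p 1 0 ∧
        ∀ l, 0 < pullbackForm c.Φ α' (0, l) (0, 1) := by
  classical
  obtain ⟨hne, hbind⟩ := hV
  set a : M → ℝ := fun y => angularDeriv B.p y (V y) with ha
  -- `N` and `P` are open by construction and turn out to be complementary, so a change of sign on
  -- `N` keeps everything smooth. The binding is exempted because `p` means nothing there.
  set N : Set M := {x | ∀ᶠ y in 𝓝 x, y ∉ B.L → a y < 0} with hN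
  set P : Set M := {x | ∀ᶠ y in 𝓝 x, y ∉ B.L → 0 < a y} with hP
  have hNo : ∀ x ∈ N, ∀ᶠ y in 𝓝 x, y ∈ N := fun x hx => eventually_eventually_nhds.2 hx
  have hPo : ∀ x ∈ P, ∀ᶠ y in 𝓝 x, y ∈ P := fun x hx => eventually_eventually_nhds.2 hx
  have hcover : ∀ x, x ∉ N → x ∈ P := by
    intro x hxN
    by_cases hx : x ∈ B.L
    · obtain ⟨c, ⟨l, rfl⟩, -, hc⟩ := hbind x hx
      obtain ⟨b, -, hb⟩ := hc l
      have hnhds : c.Φ '' Tube c.R ∈ 𝓝 (c.Φ (0, l)) :=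
        (c.isOpen_image (isOpen_tube _) subset_rfl).mem_nhds (mem_image_of_mem _ (c.core_mem l))
      have hq : ∀ q ∈ Tube c.R, c.Φ q ∉ B.L → 0 < b * a (c.Φ q) := fun q hq hqL =>
        hb q (norm_pos_iff.2 fun h0 => hqL ((c.mem_link q hq).2 h0)) hq
      -- Near a point of the binding, `dp(V)` has the sign of the single number `b`.
      rcases le_or_gt b 0 with hb0 | hb0
      · refine absurd ?_ hxN
        filter_upwards [hnhds]
        rintro _ ⟨q, hqt, rfl⟩ hqL
        have := hq q hqt hqL
        by_contra hcon
        nlinarith [not_lt.1 hcon]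
      · filter_upwards [hnhds]
        rintro _ ⟨q, hqt, rfl⟩ hqL
        exact pos_of_mul_pos_right (hq q hqt hqL) hb0.le
    · have hcont : ContinuousAt a x :=
        B.toFiberedLink.continuousAt_angularDeriv (fun x => (h x).smooth_field) hx
      rcases lt_or_gt_of_ne (hne x hx) with hlt | hgt
      · exact absurd (show x ∈ N from
          (hcont.eventually_lt_const hlt).mono fun y hy _ => hy) hxN
      · exact (hcont.eventually_const_lt hgt).mono fun y hy _ => hy
  -- A common point would have a neighbourhood contained in the binding, which has empty interior.
  have hdisj : ∀ x ∈ P, x ∉ N := by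
    intro x hxP hxN
    have hL : ∀ᶠ y in 𝓝 x, y ∈ B.L := by
      filter_upwards [hxP, hxN] with y hy1 hy2
      by_contra hy
      exact lt_asymm (hy1 hy) (hy2 hy)
    obtain ⟨c, ⟨l, rfl⟩, -⟩ := hbind x hL.self_of_nhds
    obtain ⟨q, hq, hz, hqL⟩ := c.exists_off_core hL
    exact hz ((c.mem_link q hq).1 hqL)
  refine ⟨fun x => if x ∈ N then -α x else α x, fun x => if x ∈ N then -V x else V x,
    fun x => ?_, fun x hx => ?_, fun x hx => ?_⟩
  · by_cases hx : x ∈ N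
    · exact (h x).neg.congr ((hNo x hx).mono fun y hy => if_pos hy)
        ((hNo x hx).mono fun y hy => if_pos hy)
    · exact (h x).congr ((hPo x (hcover x hx)).mono fun y hy => if_neg (hdisj y hy))
        ((hPo x (hcover x hx)).mono fun y hy => if_neg (hdisj y hy))
  · by_cases hxN : x ∈ N
    · simp only [if_pos hxN]
      rw [angularDeriv_neg]
      exact neg_pos.2 (hxN.self_of_nhds hx)
    · simp only [if_neg hxN]
      exact (hcover x hxN).self_of_nhds hx
  · obtain ⟨c, hcx, hfib, hc⟩ := hbind x hx
    refine ⟨c, hcx, hfib, fun l => ?_⟩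
    obtain ⟨b, hbV, hb⟩ := hc l
    -- On the core `V = b ∂_λ` and `α(V) = 1`, so `α(∂_λ)` has the sign of `b`, which is that of
    -- `dp(V)` nearby.
    have h1 : b * α (c.Φ (0, l)) (c.push (0, l) 0 1) = 1 := by
      have h2 := (h (c.Φ (0, l))).apply_eq_one
      have h3 : c.push (0, l) 0 b = b • c.push (0, l) 0 1 := by
        have h4 : ∀ T : ℂ × ℝ →L[ℝ] E3, T (0, b) = b • T (0, 1) := fun T => by
          rw [← map_smul]; simp
        exact h4 _
      rw [hbV, h3, map_smul] at h2
      exact h2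
    by_cases hy : c.Φ (0, l) ∈ N
    · obtain ⟨q, hq, hz, hqa⟩ := c.exists_off_core hy
      have h2 := hqa fun hL => hz ((c.mem_link q hq).1 hL)
      have h3 : 0 < b * a (c.Φ q) := hb q (norm_pos_iff.2 hz) hq
      have h4 : α (c.Φ (0, l)) (c.push (0, l) 0 1) < 0 := by
        by_contra hcon
        nlinarith [not_lt.1 hcon]
      rw [pullbackForm_apply, if_pos hy]
      exact neg_pos.2 h4
    · obtain ⟨q, hq, hz, hqa⟩ := c.exists_off_core (hcover _ hy)
      have h2 := hqa fun hL => hz ((c.mem_link q hq).1 hL)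
      have h3 : 0 < b * a (c.Φ q) := hb q (norm_pos_iff.2 hz) hq
      have h4 : 0 < b := pos_of_mul_pos_left h3 h2.le
      rw [pullbackForm_apply, if_neg hy]
      exact pos_of_mul_pos_right (h1.symm ▸ one_pos) h4.le

end Sign

/-! ### From open books to nicely fibered links -/

section Nice

variable {M : Type*} [TopologicalSpace M] [ChartedSpace E3 M] [IsManifold (𝓡 3) ∞ M]
  {o : ManifoldOrientation M}

/-- The polar coordinates `c` show that `V` and `ξ` are nice near a component of an open book. -/
structure IsNiceIn (B : OpenBook o) (ξ : ContactStructure o) (V : VField M)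
    (c : PolarCoords o B.L) : Prop where
  plane : ∃ f g : ℝ → ℝ, ContDiff ℝ ∞ f ∧ ContDiff ℝ ∞ g ∧ c.PlaneIs ξ.plane f g
  field : ∃ a b : ℝ, 0 < b ∧ c.FieldIs V a b
  fibration : c.FibrationIs B.p 1 0

/-- `α` is a contact form for `ξ` with Reeb vector field `V`, which is positively transverse to the
pages, and `α` is positive on the binding. -/
structure IsPositivePair (B : OpenBook o) (ξ : ContactStructure o) (α : OneForm M)
    (V : VField M) : Prop where
  reeb : ∀ x, ReebPairAt ξ α V x
  transverse : ∀ x, x ∉ B.L → 0 < angularDeriv B.p x (V x)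
  binding : ∀ x ∈ B.L, ∃ c : PolarCoords o B.L, c.IsAround x ∧ c.FibrationIs B.p 1 0 ∧
    ∀ l, 0 < pullbackForm c.Φ α (0, l) (0, 1)

lemma IsNiceIn.shrink {B : OpenBook o} {ξ : ContactStructure o} {V V' : VField M}
    {c : PolarCoords o B.L} (h : IsNiceIn B ξ V c) {ε : ℝ} (hε : 0 < ε) (hle : ε ≤ c.R)
    (hV : ∀ q ∈ Tube ε, V' (c.Φ q) = V (c.Φ q)) : IsNiceIn B ξ V' (c.shrink hε hle) := by
  obtain ⟨⟨f, g, hf, hg, hfg⟩, ⟨a, b, hb, hab⟩, hfib⟩ := h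
  exact ⟨⟨f, g, hf, hg, fun q h1 h2 => hfg q h1 (h2.trans_le hle)⟩,
    ⟨a, b, hb, fun q hq => (hV q hq).trans (hab q (hq.trans_le hle))⟩,
    fun r m l h1 h2 => hfib r m l h1 (h2.trans_le hle)⟩

/-- Polar coordinates in which the contact structure is standard. -/
lemma IsPositivePair.exists_standard {B : OpenBook o} {ξ : ContactStructure o} {α : OneForm M}
    {V : VField M} (h : IsPositivePair B ξ α V) {x : M} (hx : x ∈ B.L) :
    ∃ c : PolarCoords o B.L, c.IsAround x ∧ c.FibrationIs B.p 1 0 ∧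
      ∀ q ∈ Tube c.R, 0 < pullbackForm c.Φ α q (0, 1) ∧
        pullbackForm c.Φ α q = pullbackForm c.Φ α q (0, 1) • stdForm q := by
  have hα := isSmoothOn_univ h.reeb
  obtain ⟨c, hcx, hfib, hpos⟩ := h.binding x hx
  obtain ⟨R₁, ρ₁, h₁⟩ := c.exists_reparam_radial hα hpos
  obtain ⟨R₂, ρ₂, h₂⟩ := (c.reparam ρ₁).exists_reparam_standard ξ hα (fun x => (h.reeb x).ker)
    (fun q hq => (h₁ q hq).1) (fun q hq => (h₁ q hq).2)
  exact ⟨(c.reparam ρ₁).reparam ρ₂,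
    (c.reparam ρ₁).reparam_isAround ρ₂ (c.reparam_isAround ρ₁ hcx),
    (c.reparam ρ₁).reparam_fibrationIs ρ₂ (c.reparam_fibrationIs ρ₁ hfib), h₂⟩

/-- Since `dμ(w) = Im (w / z)`, the angular part `Im (conj z * w)` of `stdForm` is `r² dμ(w)`. -/
lemma PolarCoords.planeIs_of_standard {L : Set M} (c : PolarCoords o L) {ξ : ContactStructure o}
    {α : OneForm M}
    (hker : ∀ x, ξ.plane x = LinearMap.ker (α x : TangentSpace (𝓡 3) x →ₗ[ℝ] ℝ))
    (h : ∀ q ∈ Tube c.R, 0 < pullbackForm c.Φ α q (0, 1) ∧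
        pullbackForm c.Φ α q = pullbackForm c.Φ α q (0, 1) • stdForm q) :
    c.PlaneIs ξ.plane (fun _ => 1) (fun r => r ^ 2) := by
  intro q hq0 hq w s
  have h1 : c.push q w s ∈ ξ.plane (c.Φ q) ↔ pullbackForm c.Φ α q (w, s) = 0 := by
    rw [hker]; rfl
  have h2 : ‖q.1‖ ^ 2 * (w / q.1).im = (conj q.1 * w).im := by
    have hn : Complex.normSq q.1 ≠ 0 := (Complex.normSq_pos.2 (norm_pos_iff.1 hq0)).ne'
    rw [← Complex.normSq_eq_norm_sq, Complex.div_im]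
    simp
    field_simp
    ring
  rw [h1, (h q hq).2, h2, smul_apply, smul_eq_mul, mul_eq_zero,
    or_iff_right (h q hq).1.ne', stdForm_apply, one_mul]

variable [T2Space M]

/-- A Reeb vector field can be made nice near one more component of the binding. -/
theorem IsPositivePair.exists_nice_at {B : OpenBook o} {ξ : ContactStructure o} {α : OneForm M}
    {V : VField M} (h : IsPositivePair B ξ α V) {x : M} (hx : x ∈ B.L) :
    ∃ (α' : OneForm M) (V' : VField M), IsPositivePair B ξ α' V' ∧
      (∃ c, c.IsAround x ∧ IsNiceIn B ξ V' c) ∧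
      ∀ y, (∃ c, c.IsAround y ∧ IsNiceIn B ξ V c) → ∃ c, c.IsAround y ∧ IsNiceIn B ξ V' c := by
  obtain ⟨c, hcx, hfib, hstd⟩ := h.exists_standard hx
  obtain ⟨κ, V', hκ, hreeb, htrans, hT, c₀, c₁, hc₀, hlin⟩ :=
    exists_linear_near_core B.toFiberedLink c h.reeb h.transverse hfib
      (fun q hq => (hstd q hq).1) (fun q hq => (hstd q hq).2)
  have hR4 : 0 < c.R / 4 := by linarith [c.R_pos]
  have hle : c.R / 4 ≤ c.R := by linarith [c.R_pos]
  have hR2 : c.R / 2 < c.R := by linarith [c.R_pos]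
  have hplane := c.planeIs_of_standard (fun x => (h.reeb x).ker) hstd
  have hnice : IsNiceIn B ξ V' (c.shrink hR4 hle) :=
    ⟨⟨fun _ => 1, fun r => r ^ 2, contDiff_const, contDiff_id.pow 2,
      fun q h1 h2 => hplane q h1 (h2.trans_le hle)⟩, ⟨c₁, c₀, hc₀, hlin⟩,
      fun r m l h1 h2 => hfib r m l h1 (h2.trans_le hle)⟩
  refine ⟨fun x => κ x • α x, V', ⟨hreeb, htrans, fun y hy => ?_⟩, ⟨c.shrink hR4 hle, hcx, hnice⟩,
    ?_⟩
  · obtain ⟨c', h1, h2, h3⟩ := h.binding y hy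
    exact ⟨c', h1, h2, fun l => mul_pos (hκ _) (h3 l)⟩
  · rintro y ⟨c', hy, hnice'⟩
    -- On the component just treated the new coordinates serve. Any other component is disjoint from
    -- `T`, off which the field is unchanged, so its coordinates only have to be shrunk.
    by_cases hyc : c.IsAround y
    · exact ⟨c.shrink hR4 hle, hyc, hnice⟩
    set T := c.Φ '' {q | ‖q.1‖ ≤ c.R / 2} with hTdef
    have hTc : IsClosed T := (c.isCompact_image_closedTube hR2).isClosed
    have hcore : ∀ l, c'.Φ (0, l) ∉ T := by
      rintro l ⟨q, hq, hqe⟩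
      have hq' : ‖q.1‖ ≤ c.R / 2 := hq
      have hl : c'.IsAround (c'.Φ (0, l)) := ⟨l, rfl⟩
      have hl' : c.IsAround (c'.Φ (0, l)) :=
        (c.isAround_iff_mem hl.mem).2 ⟨q, hq'.trans_lt hR2, hqe⟩
      exact hyc (hl.of_isAround hl' hy)
    obtain ⟨ε, hε, hεT⟩ := exists_tube_of_eventually
      (P := fun q => q ∈ Tube c'.R → c'.Φ q ∉ T)
      (fun z l => forall_congr' fun hz => by rw [c'.Φ_periodic hz l])
      (fun l => ((c'.smoothAt (c'.core_mem l)).continuousAt.eventually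
        (hTc.isOpen_compl.mem_nhds (hcore l))).mono fun q hq _ => hq)
    refine ⟨c'.shrink (lt_min hε c'.R_pos) (min_le_right _ _), hy,
      hnice'.shrink _ _ fun q hq => hT _ ?_⟩
    exact hεT q (tube_mono (min_le_left _ _) hq) (tube_mono (min_le_right _ _) hq)

/-- Finitely many coordinate neighbourhoods cover the compact binding. The field is made nice at one
centre after another, each time without losing what holds at the others; niceness at a centre serves
its whole component. -/
theorem IsPositivePair.nicelySupports {B : OpenBook o} {ξ : ContactStructure o} {α : OneForm M}
    {V : VField M} (h : IsPositivePair B ξ α V) : B.toFiberedLink.NicelySupports ξ := by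
  have hfin : ∀ t : Finset M, (∀ x ∈ t, x ∈ B.L) → ∃ (α' : OneForm M) (V' : VField M),
      IsPositivePair B ξ α' V' ∧ ∀ x ∈ t, ∃ c, c.IsAround x ∧ IsNiceIn B ξ V' c := by
    classical
    intro t
    induction t using Finset.induction_on with
    | empty => exact fun _ => ⟨α, V, h, by simp⟩
    | insert x t _ ih =>
      intro ht
      obtain ⟨α₁, V₁, h₁, hn₁⟩ := ih fun y hy => ht y (Finset.mem_insert_of_mem hy)
      obtain ⟨α₂, V₂, h₂, hx, hn₂⟩ := h₁.exists_nice_at (ht x (Finset.mem_insert_self x t))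
      refine ⟨α₂, V₂, h₂, fun y hy => ?_⟩
      rcases Finset.mem_insert.1 hy with rfl | hy
      · exact hx
      · exact hn₂ y (hn₁ y hy)
  have : Nonempty (PolarCoords o B.L) :=
    let ⟨c, _⟩ := B.longitudinal _ B.nonempty.some_mem
    ⟨c⟩
  choose! c hcx _ using B.longitudinal
  obtain ⟨t, htL, htc⟩ := B.isLink.isCompact.elim_nhds_subcover
    (fun x => (c x).Φ '' Tube (c x).R) fun x hx =>
      ((c x).isOpen_image (isOpen_tube _) subset_rfl).mem_nhds
        (((c x).isAround_iff_mem hx).1 (hcx x hx))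
  obtain ⟨α', V', h', hn⟩ := hfin t htL
  refine ⟨V', isReeb_iff.2 ⟨α', h'.reeb⟩, h'.transverse, fun y hy => ?_⟩
  obtain ⟨x, hxt, hyx⟩ := mem_iUnion₂.1 (htc hy)
  obtain ⟨c', hc', hplane, ⟨a, b, hb, hab⟩, hfib⟩ := hn x hxt
  have hxL := htL x hxt
  exact ⟨c', (hcx x hxL).of_isAround hc' (((c x).isAround_iff_mem hy).2 hyx), hplane,
    a, b, 1, 0, hb, one_pos, hab, hfib⟩

/-- If an open book supports `ξ`, then it is a nicely fibered link supporting `ξ`. -/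
theorem OpenBook.Supports.nicelySupports {B : OpenBook o} {ξ : ContactStructure o}
    (h : B.Supports ξ) : B.toFiberedLink.NicelySupports ξ := by
  obtain ⟨V, hV, hB⟩ := h
  obtain ⟨α, hα⟩ := isReeb_iff.1 hV
  obtain ⟨α', V', h1, h2, h3⟩ := hB.exists_pos hα
  exact IsPositivePair.nicelySupports ⟨h1, h2, h3⟩

end Nice

/-! ### From nicely fibered links to open books -/

section Transition

variable {M : Type*} [TopologicalSpace M] [ChartedSpace E3 M] [IsManifold (𝓡 3) ∞ M]
  {o : ManifoldOrientation M} {L : Set M}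

/-- If `f` vanishes at `0` and takes values in the ray spanned by `e` afterwards, then its
derivative lies in this ray. -/
lemma eq_norm_mul_of_hasDerivAt_of_ray {f : ℝ → ℂ} {w e : ℂ} (hf : HasDerivAt f w 0) (h0 : f 0 = 0)
    (h : ∀ᶠ r in 𝓝[>] (0 : ℝ), f r = ‖f r‖ * e) : w = ‖w‖ * e := by
  have h1 := hf.tendsto_slope_zero_right
  have hcl : IsClosed {w : ℂ | w = ‖w‖ * e} := isClosed_eq continuous_id (by fun_prop)
  refine hcl.mem_of_tendsto h1 ?_
  filter_upwards [h, self_mem_nhdsWithin] with r hr hr0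
  have hr0' : 0 < r := hr0
  simp only [zero_add, h0, sub_zero, norm_smul, norm_inv, Real.norm_of_nonneg hr0'.le]
  conv_lhs => rw [hr]
  rw [Complex.real_smul]
  push_cast
  ring

/-- Two polar coordinate systems near the same component of the binding, both with fibrations that
are positive on the meridians, define the same orientation of the component. -/
theorem PolarCoords.exists_pos_transition (F : FiberedLink M) (c c' : PolarCoords o F.L) {C D : ℝ}
    (hC : 0 < C) (h : c.FibrationIs F.p C D) (h' : c'.FibrationIs F.p 1 0) {l l' : ℝ}
    (he : c.Φ (0, l) = c'.Φ (0, l')) :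
    ∃ β : ℝ, 0 < β ∧ (mfderiv 𝓘(ℝ, ℂ × ℝ) (𝓡 3) c.Φ (0, l) ((0, 1) : ℂ × ℝ) : E3) =
      mfderiv 𝓘(ℝ, ℂ × ℝ) (𝓡 3) c'.Φ (0, l') ((0, β) : ℂ × ℝ) := by
  have hm := c.core_mem l
  have hm' := c'.core_mem l'
  obtain ⟨ψ, hψ, hψq, hr, -⟩ := c'.exists_localInverse hm'
  rw [← he] at hψ hψq hr
  -- The transition map from `c` to `c'` near the given core point.
  set τ : ℂ × ℝ → ℂ × ℝ := fun q => ψ (c.Φ q) with hτdef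
  have hτ0 : τ (0, l) = (0, l') := hψq
  have hτs : ContDiffAt ℝ ∞ τ (0, l) :=
    contMDiffAt_iff_contDiffAt.1 (ContMDiffAt.comp (0, l) hψ (c.smoothAt hm))
  have hτd : HasFDerivAt τ (fderiv ℝ τ (0, l)) (0, l) :=
    (hτs.differentiableAt (by simp)).hasFDerivAt
  set T := fderiv ℝ τ (0, l) with hT
  have hev : ∀ᶠ q in 𝓝 ((0 : ℂ), l), q ∈ Tube c.R ∧ τ q ∈ Tube c'.R ∧ c'.Φ (τ q) = c.Φ q :=
    ((isOpen_tube _).eventually_mem hm).and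
      ((hτs.continuousAt.eventually_mem (by rw [hτ0]; exact (isOpen_tube _).mem_nhds hm')).and
        ((c.smoothAt hm).continuousAt.eventually hr))
  have hzero : ∀ q, q ∈ Tube c.R → τ q ∈ Tube c'.R → c'.Φ (τ q) = c.Φ q →
      ((τ q).1 = 0 ↔ q.1 = 0) := fun q h1 h2 h3 => by
    rw [← c'.mem_link _ h2, h3, c.mem_link _ h1]
  have hmf : ∀ v : ℂ × ℝ, (mfderiv 𝓘(ℝ, ℂ × ℝ) (𝓡 3) c.Φ (0, l) v : E3) =
      mfderiv 𝓘(ℝ, ℂ × ℝ) (𝓡 3) c'.Φ (0, l') (T v) := by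
    intro v
    have h1 : c.Φ =ᶠ[𝓝 ((0 : ℂ), l)] c'.Φ ∘ τ := hev.mono fun q hq => hq.2.2.symm
    have hd : MDifferentiableAt 𝓘(ℝ, ℂ × ℝ) (𝓡 3) c'.Φ (τ (0, l)) := by
      rw [hτ0]; exact c'.mdifferentiableAt hm'
    have h2 := ((hd.hasMFDerivAt.comp (0, l) hτd.hasMFDerivAt).congr_of_eventuallyEq h1).mfderiv
    rw [h2]
    have h3 : ∀ {q q' : ℂ × ℝ} (_ : q = q') (v : ℂ × ℝ),
        (mfderiv 𝓘(ℝ, ℂ × ℝ) (𝓡 3) c'.Φ q v : E3) = mfderiv 𝓘(ℝ, ℂ × ℝ) (𝓡 3) c'.Φ q' v := by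
      rintro q _ rfl v; rfl
    exact h3 hτ0 (T v)
  have hcurve : ∀ u : ℂ × ℝ, HasDerivAt (fun t : ℝ => (τ ((0, l) + t • u)).1) (T u).1 0 := by
    intro u
    have h1 : HasDerivAt (fun t : ℝ => ((0 : ℂ), l) + t • u) u 0 := by
      simpa using ((hasDerivAt_id (0 : ℝ)).smul_const u).const_add ((0 : ℂ), l)
    have h2 : HasFDerivAt τ T ((0, l) + (0 : ℝ) • u) := by simpa using hτd
    have h3 : HasDerivAt (fun t : ℝ => τ ((0, l) + t • u)) (T u) 0 :=
      HasFDerivAt.comp_hasDerivAt (l := τ) (l' := T) 0 h2 h1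
    exact (ContinuousLinearMap.fst ℝ ℂ ℝ).hasFDerivAt.comp_hasDerivAt 0 h3
  have hlim : ∀ u : ℂ × ℝ, Filter.Tendsto (fun t : ℝ => ((0 : ℂ), l) + t • u) (𝓝 0)
      (𝓝 ((0 : ℂ), l)) := by
    intro u
    have : Continuous (fun t : ℝ => ((0 : ℂ), l) + t • u) := by fun_prop
    simpa using this.tendsto 0
  -- `τ` preserves the core, so its derivative is block triangular.
  have hT01 : (T (0, 1)).1 = 0 := by
    have h1 : (fun t : ℝ => (τ ((0, l) + t • ((0 : ℂ), (1 : ℝ)))).1) =ᶠ[𝓝 0] fun _ => 0 := by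
      filter_upwards [(hlim (0, 1)).eventually hev] with t ht
      exact (hzero _ ht.1 ht.2.1 ht.2.2).2 (by simp)
    exact (hcurve (0, 1)).unique ((hasDerivAt_const (0 : ℝ) (0 : ℂ)).congr_of_eventuallyEq h1)
  -- On the ray of angle `m` one has `p = C m + D l`, and `p` is the angle in `c'`. Hence `τ` maps
  -- this ray into points of constant angle, and so does its derivative.
  have hray : ∀ m : ℝ, (T (Complex.exp (m * Complex.I), 0)).1 =
      ‖(T (Complex.exp (m * Complex.I), 0)).1‖ * Complex.exp ((C * m + D * l : ℝ) * Complex.I) := by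
    intro m
    refine eq_norm_mul_of_hasDerivAt_of_ray (hcurve (Complex.exp (m * Complex.I), 0))
      (by simp [hτ0]) ?_
    have hev' := (hlim (Complex.exp (m * Complex.I), 0)).eventually hev
    filter_upwards [hev'.filter_mono nhdsWithin_le_nhds, self_mem_nhdsWithin] with r hr hr0
    have hr0' : 0 < r := hr0
    have hq : ((0 : ℂ), l) + r • (Complex.exp (m * Complex.I), (0 : ℝ))
        = (r * Complex.exp (m * Complex.I), l) := by simp
    rw [hq] at hr ⊢
    obtain ⟨h1, h2, h3⟩ := hr
    have hrR : r < c.R := by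
      have : ‖(r : ℂ) * Complex.exp (m * Complex.I)‖ < c.R := h1
      rwa [norm_mul, Complex.norm_exp_ofReal_mul_I, mul_one, Complex.norm_real,
        Real.norm_of_nonneg hr0'.le] at this
    have hne : (τ (r * Complex.exp (m * Complex.I), l)).1 ≠ 0 := fun h0 => by
      have := (hzero _ h1 h2 h3).1 h0
      simp [hr0'.ne'] at this
    have h4 := c'.coe_fibration h' h2 hne
    rw [h3, h r m l hr0' hrR, Circle.coe_exp] at h4
    rw [h4, ← mul_assoc, ← Complex.ofReal_mul, mul_inv_cancel₀ (norm_ne_zero_iff.2 hne),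
      Complex.ofReal_one, one_mul]
  set a := (T (1, 0)).1 with hadef
  set b := (T (Complex.I, 0)).1 with hbdef
  set β := (T (0, 1)).2 with hβdef
  -- Both coordinate systems are positive, and the determinant of `T` is `β` times that of its
  -- normal block.
  have hdet : 0 < β * (a.re * b.im - b.re * a.im) := by
    have hframe : o.IsPosFrame (c'.Φ (0, l')) (fun i =>
        mfderiv 𝓘(ℝ, ℂ × ℝ) (𝓡 3) c'.Φ (0, l') (T (stdVec i))) := by
      have htr : ∀ {x x' : M} (_ : x = x') (v w : Fin 3 → E3), v = w →
          o.IsPosFrame x v → o.IsPosFrame x' w := by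
        rintro x _ rfl v _ rfl h; exact h
      exact htr he _ _ (funext fun i => hmf (stdVec i)) (c.posFrame (0, l) hm)
    have hdp := (isPosFrame_map_iff (T := mfderiv 𝓘(ℝ, ℂ × ℝ) (𝓡 3) c'.Φ (0, l'))
      (c'.posFrame (0, l') hm') fun i => T (stdVec i)).1 hframe
    rw [stdBasis_det] at hdp
    have e0 : stdVec 0 = (1, 0) := rfl
    have e1 : stdVec 1 = (Complex.I, 0) := rfl
    have e2 : stdVec 2 = (0, 1) := rfl
    simp only [e0, e1, e2, hT01, Complex.zero_re, Complex.zero_im] at hdp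
    rw [← hadef, ← hbdef, ← hβdef] at hdp
    linarith
  -- The images of the directions of angle `0` and `m` lie on rays whose angles differ by `C m`. For
  -- small `m`, `sin m` and `sin (C m)` are both positive, so the normal block cannot reverse
  -- orientation; degeneracy is already excluded by `hdet`.
  have hnonneg : 0 ≤ a.re * b.im - b.re * a.im := by
    obtain ⟨m, hm0, hm1, hCm⟩ : ∃ m : ℝ, 0 < m ∧ m ≤ 1 ∧ C * m ≤ 1 :=
      ⟨min 1 C⁻¹, lt_min one_pos (inv_pos.2 hC), min_le_left _ _, by
        calc C * min 1 C⁻¹ ≤ C * C⁻¹ := by gcongr; exact min_le_right _ _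
          _ = 1 := mul_inv_cancel₀ hC.ne'⟩
    have hpi := Real.pi_gt_three
    have hs1 : 0 < Real.sin m := Real.sin_pos_of_pos_of_lt_pi hm0 (by linarith)
    have hs2 : 0 < Real.sin (C * m) :=
      Real.sin_pos_of_pos_of_lt_pi (mul_pos hC hm0) (by linarith)
    have ha := hray 0
    have hw := hray m
    have hwab : (T (Complex.exp (m * Complex.I), 0)).1 = Real.cos m * a + Real.sin m * b := by
      have : ((Complex.exp (m * Complex.I), 0) : ℂ × ℝ) =
          Real.cos m • ((1 : ℂ), (0 : ℝ)) + Real.sin m • (Complex.I, (0 : ℝ)) := by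
        simp [Complex.exp_mul_I]
      rw [this, map_add, map_smul, map_smul]
      simp [hadef, hbdef]
    set w := (T (Complex.exp (m * Complex.I), 0)).1 with hwdef
    have ha' : a = ‖a‖ * Complex.exp ((D * l : ℝ) * Complex.I) := by
      simpa using ha
    have h1 : (conj a * w).im = Real.sin m * (a.re * b.im - b.re * a.im) := by
      rw [hwab]
      simp [-Complex.ofReal_cos, -Complex.ofReal_sin]
      ring
    have h2 : (conj a * w).im = ‖a‖ * ‖w‖ * Real.sin (C * m) := by
      rw [hw, ha', show C * m = (C * m + D * l) - D * l by ring, Real.sin_sub]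
      simp [-Complex.ofReal_mul, -Complex.ofReal_add, Complex.exp_ofReal_mul_I_re,
        Complex.exp_ofReal_mul_I_im]
      ring
    have h3 : 0 ≤ Real.sin m * (a.re * b.im - b.re * a.im) := by
      rw [← h1, h2]; positivity
    exact nonneg_of_mul_nonneg_right h3 hs1
  refine ⟨β, pos_of_mul_pos_left hdet hnonneg, ?_⟩
  rw [hmf, show T (0, 1) = (0, β) from Prod.ext hT01 rfl]

variable [T2Space M]

/-- A nicely fibered link supporting `ξ` which is an open book supports `ξ` as such. -/
theorem OpenBook.supports_of_nicelySupports {B : OpenBook o} {ξ : ContactStructure o}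
    (h : B.toFiberedLink.NicelySupports ξ) : B.Supports ξ := by
  obtain ⟨V, hV, hpos, hcoord⟩ := h
  refine ⟨V, hV, fun x hx => (hpos x hx).ne', fun x hx => ?_⟩
  obtain ⟨c', hcx', hfib'⟩ := B.longitudinal x hx
  obtain ⟨c, hcx, -, A, b, C, D, hb, hC, hfield, hfib⟩ := hcoord x hx
  refine ⟨c', hcx', hfib', fun l' => ?_⟩
  obtain ⟨l, hl⟩ : c.IsAround (c'.Φ (0, l')) := hcx'.of_isAround hcx ⟨l', rfl⟩
  obtain ⟨β, hβ, heq⟩ := c.exists_pos_transition B.toFiberedLink c' hC hfib hfib' hl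
  -- On the core of `c'` the field is `b β ∂_λ`, and `b β > 0` agrees in sign with `dp(V)`.
  refine ⟨b * β, ?_, fun q hq0 hq => mul_pos (mul_pos hb hβ) (hpos _ fun hL =>
    norm_pos_iff.1 hq0 ((c'.mem_link q hq).1 hL))⟩
  have hVeq : ∀ {x x' : M} (_ : x = x'), (V x : E3) = V x' := by rintro x _ rfl; rfl
  have hsmul : ∀ (T : ℂ × ℝ →L[ℝ] E3) (s : ℝ), T (0, b * s) = b • T (0, s) := fun T s => by
    rw [← map_smul]; simp
  have h1 : (V (c.Φ (0, l)) : E3) =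
      mfderiv 𝓘(ℝ, ℂ × ℝ) (𝓡 3) c.Φ (0, l) ((0, b * 1) : ℂ × ℝ) := by
    have := hfield (0, l) (c.core_mem l)
    simpa [PolarCoords.push] using this
  refine (hVeq hl.symm).trans (h1.trans ?_)
  refine (hsmul _ 1).trans (Eq.trans ?_ (hsmul _ β).symm)
  exact congrArg (fun v : E3 => b • v) heq

end Transition

/-! ### The trivial isotopy used in part (a) -/

section Isotopy

variable {M : Type*} [TopologicalSpace M] [ChartedSpace E3 M] [IsManifold (𝓡 3) ∞ M]
  {o : ManifoldOrientation M}

/-- The constant isotopy. -/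
lemma ContactStructure.isotopic_refl (ξ : ContactStructure o) : ξ.Isotopic ξ := by
  refine ⟨fun _ => Diffeomorph.refl (𝓡 3) M ∞, contMDiff_snd, fun x => rfl, fun x => ?_⟩
  have hid : ∀ (T : TangentSpace (𝓡 3) x →L[ℝ] TangentSpace (𝓡 3) x)
      (_ : T = ContinuousLinearMap.id ℝ _) (S : Submodule ℝ (TangentSpace (𝓡 3) x)),
      S = S.map (T : TangentSpace (𝓡 3) x →ₗ[ℝ] TangentSpace (𝓡 3) x) := by
    rintro _ rfl S
    exact (Submodule.map_id S).symm
  exact hid _ mfderiv_id (ξ.plane x)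

end Isotopy

end OpenBook3

end

/-- In part (a) the constant isotopy suffices: the polar coordinates of a nicely fibered link may be
adapted to `ξ`, and the Reeb vector field is changed by rescaling the contact form only. -/
theorem lemma4p5 {M : Type*} [TopologicalSpace M] [ChartedSpace OpenBook3.E3 M]
    [IsManifold (𝓡 3) ∞ M] [T2Space M] [CompactSpace M]
    (o : OpenBook3.ManifoldOrientation M) (B : OpenBook3.OpenBook o)
    (ξ : OpenBook3.ContactStructure o) :
    (B.Supports ξ → ∃ ξ' : OpenBook3.ContactStructure o,
      ξ.Isotopic ξ' ∧ B.toFiberedLink.NicelySupports ξ') ∧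
    (B.toFiberedLink.NicelySupports ξ → B.Supports ξ) := by
  exact ⟨fun h => ⟨ξ, ξ.isotopic_refl, h.nicelySupports⟩,
    OpenBook3.OpenBook.supports_of_nicelySupports⟩
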